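/- Consider a source that sends status updates of two streams to a monitor through a single server. Ordinary packets (stream $\mathcal{U}_1$) and priority packets (stream $\mathcal{U}_2$) are generated by two independent Poisson processes of rates $\lambda_1>0$ and $\lambda_2>0$; service times are independent, exponential with rate $\mu_1>0$ for ordinary and $\mu_2>0$ for priority packets, and independent of the arrivals. Ordinary packets are kept in an unlimited buffer and served first-come first-served. A priority packet enters service at the instant of its generation: it discards a priority packet that is in service, and it preempts an ordinary packet that is in service, which returns to the head of the buffer and later resumes its service when the server is free of priority packets. The system is empty at time $0$, when the monitor holds information of age $\Delta_0\ge 0$. Let $u(t)$ be the generation time of the last ordinary packet received by the monitor before time $t$ (with $u(t)=-\Delta_0$ if there is none), let $\Delta(t)=t-u(t)$ be the instantaneous age of the ordinary stream, and let $K_j$ be the value of the age just before the reception of the $j$-th ordinary packet. Suppose that the system is stable, i.e. $\mu_1>\lambda_1\left(1+\frac{\lambda_2}{\mu_2}\right)$. Then the average peak age $\Delta_{peak,1}=\lim_{N\to\infty}\frac1N\sum_{j=1}^N K_j$ of the ordinary stream exists almost surely and $$\Delta_{peak,1}=\frac{1}{\lambda_1}+\frac{2\lambda_2\mu_2+\lambda_2\mu_1+\lambda_2^2+\mu_2^2}{(\mu_2+\lambda_2)\left(\mu_1\mu_2-\lambda_1(\mu_2+\lambda_2)\right)}\qquad\text{almost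 surely.}$$ -/

import Mathlib

open Filter Topology MeasureTheory ProbabilityTheory

namespace StatusQueue

/-- Generation time of packet `n` (packets are numbered `0, 1, 2, …`) of a stream whose successive
interarrival times are `x 0, x 1, x 2, …`; the clock starts at time `0`. -/
noncomputable def genTime (x : ℕ → ℝ) (n : ℕ) : ℝ :=
  ∑ i ∈ Finset.range (n + 1), x i

/-- The set of times at which the server is occupied by a priority packet. Priority packet `k`
enters service at the instant of its generation, whatever the server is doing, and stays there until
its service time `s₂ k` has elapsed or the next priority packet is generated (it is then discarded),
whichever comes first. -/
def priorityBusy (x₂ s₂ : ℕ → ℝ) : Set ℝ :=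
  {t | ∃ k : ℕ, genTime x₂ k ≤ t ∧ t < genTime x₂ k + s₂ k ∧ t < genTime x₂ (k + 1)}

/-- The amount of time in `[a, b]` during which the server is not held by the priority stream,
hence can work on ordinary packets. -/
noncomputable def availableTime (x₂ s₂ : ℕ → ℝ) (a b : ℝ) : ℝ :=
  volume.real (Set.Icc a b \ priorityBusy x₂ s₂)

/-- The time at which an ordinary packet that is at the head of the ordinary queue from time `a` on
is delivered, when it requires the service time `s`: the first time by which the server has spent
the amount `s` on it (its service is suspended, and later resumed, whenever a priority packet is
in service). -/
noncomputable def completionTime (x₂ s₂ : ℕ → ℝ) (a s : ℝ) : ℝ :=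
  sInf {d : ℝ | a ≤ d ∧ s ≤ availableTime x₂ s₂ a d}

/-- Delivery time of ordinary packet `n` in a system that is empty at time `0`. Ordinary packets are
served first-come first-served from an unlimited buffer, so packet `n + 1` is at the head of the
queue as soon as it has been generated and packet `n` has been delivered. -/
noncomputable def deliveryTime (x₁ s₁ x₂ s₂ : ℕ → ℝ) : ℕ → ℝ
  | 0 => completionTime x₂ s₂ (genTime x₁ 0) (s₁ 0)
  | n + 1 => completionTime x₂ s₂
      (max (deliveryTime x₁ s₁ x₂ s₂ n) (genTime x₁ (n + 1))) (s₁ (n + 1))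

/-- The generation time `u(t)` of the last ordinary packet received before time `t`; ordinary packets
are received in the order of their generation, so this is the largest generation time among the
packets received before `t`. Until a packet is received it is `-Δ₀`, where `Δ₀` is the age of the
information held by the monitor at time `0`. -/
noncomputable def lastReceivedGenTime (Δ₀ : ℝ) (x₁ s₁ x₂ s₂ : ℕ → ℝ) (t : ℝ) : ℝ :=
  sSup (insert (-Δ₀) (genTime x₁ '' {j : ℕ | deliveryTime x₁ s₁ x₂ s₂ j < t}))

/-- The instantaneous age `Δ(t) = t - u(t)` of the ordinary stream. As only packets received
strictly before `t` count, this is the left-continuous version of the sawtooth. -/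
noncomputable def age (Δ₀ : ℝ) (x₁ s₁ x₂ s₂ : ℕ → ℝ) (t : ℝ) : ℝ :=
  t - lastReceivedGenTime Δ₀ x₁ s₁ x₂ s₂ t

/-- The peak age at packet `j`: the age of the ordinary stream just before packet `j` is received,
which is the value of the left-continuous age at the delivery time. -/
noncomputable def peakAge (Δ₀ : ℝ) (x₁ s₁ x₂ s₂ : ℕ → ℝ) (j : ℕ) : ℝ :=
  age Δ₀ x₁ s₁ x₂ s₂ (deliveryTime x₁ s₁ x₂ s₂ j)

/-- The random input of the system: the interarrival times `X₁` and service times `S₁` of the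
ordinary stream and the interarrival times `X₂` and service times `S₂` of the priority stream are
exponential with rates `lam₁, mu₁, lam₂, mu₂`, and all of them are mutually independent. In
particular the two arrival streams are independent Poisson processes of rates `lam₁` and `lam₂`. -/
structure IsInput {Ω : Type*} [MeasurableSpace Ω] (P : Measure Ω) (lam₁ lam₂ mu₁ mu₂ : ℝ)
    (X₁ S₁ X₂ S₂ : ℕ → Ω → ℝ) : Prop where
  law_X₁ : ∀ n, HasLaw (X₁ n) (expMeasure lam₁) P
  law_S₁ : ∀ n, HasLaw (S₁ n) (expMeasure mu₁) P
  law_X₂ : ∀ n, HasLaw (X₂ n) (expMeasure lam₂) P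
  law_S₂ : ∀ n, HasLaw (S₂ n) (expMeasure mu₂) P
  indep : iIndepFun (Sum.elim (Sum.elim X₁ S₁) (Sum.elim X₂ S₂)) P

end StatusQueue

/-!
The server works on ordinary packets exactly while it is free of priority packets, so the ordinary
stream is a first-come first-served queue on a modified time axis, the *clock*, which stands still
while a priority packet is in service. Packet `n` is delivered when the clock reads `deliveryLevel n`,
and these levels satisfy Lindley's recursion. The age just before the delivery of packet `j + 1` is
its sojourn time plus the interarrival time that precedes it, so that the theorem amounts to a law of
large numbers for the sojourn times.

No stationary distribution is needed. Between times at which an ordinary packet finds the queue empty,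
the following identities are exact: the sojourn times add up to the time integral of the queue length
(`sum_queueArea`); each sojourn time consists of the work found and brought, the residual time of the
priority packet in service, and the time taken by priority packets that arrive later
(`sum_sojourn_eq`); and the queue lengths met by deliveries are those left by arrivals
(`sum_deliverySum`). Poisson arrivals see time averages, for the ordinary arrivals, for the priority
arrivals and, on the axis of the clock, for the deliveries. This turns the identities into linear
equations for the mean queue length and the mean sojourn time, which `tendsto_of_balance_equations`
solves.

Moments of the queue length are not known in advance, so the sampling property is shown in a
self-normalised form: the queue length is divided by the `weight` of the queue lengths so far. As the
queue grows by at most one per arrival, its square is at most of the order of this weight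
(`sq_le_two_mul_sum`), and the squares of the quotients have a bounded sum (`tsum_sq_div_weight_le`).
Hence the compensated sums are martingales bounded in `L²` (`ae_exists_tendsto_sum_of_resample`,
`ae_tendsto_sum_sub_integral`), and Kronecker's lemma gives errors small compared with the weight.

Stability says that the clock advances faster than work arrives. It follows that the last packet that
finds the queue empty up to packet `N` has an index asymptotic to `N` (`tendsto_lastIndex_div`), and
by monotonicity the limit along these packets is the limit along all packets.
-/

namespace StatusQueue

/-! ### Convergence of martingales on product spaces -/

section Resampling

variable {ι : Type*} (ν : ι → Measure ℝ) [∀ i, IsProbabilityMeasure (ν i)]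

open Classical in
theorem measurable_piecewise_pair (T : Set ι) :
    Measurable (fun p : (ι → ℝ) × (ι → ℝ) => T.piecewise p.2 p.1) := by
  refine measurable_pi_lambda _ fun i => ?_
  by_cases hi : i ∈ T <;> simp only [Set.piecewise, hi, if_true, if_false] <;> fun_prop

open Classical in
theorem map_piecewise_infinitePi (T : Set ι) :
    ((Measure.infinitePi ν).prod (Measure.infinitePi ν)).map (fun p => T.piecewise p.2 p.1)
      = Measure.infinitePi ν := by
  refine Measure.eq_infinitePi _ fun s t ht => ?_
  rw [Measure.map_apply (measurable_piecewise_pair T)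
    (MeasurableSet.pi s.countable_toSet fun _ _ => ht _)]
  have : (fun p : (ι → ℝ) × (ι → ℝ) => T.piecewise p.2 p.1) ⁻¹' (Set.pi s t) =
      (Set.pi (s.filter (· ∉ T) : Finset ι) t) ×ˢ (Set.pi (s.filter (· ∈ T) : Finset ι) t) := by
    ext p
    simp only [Set.mem_preimage, Set.mem_pi, Set.mem_prod, Finset.mem_coe, Finset.mem_filter,
      Set.piecewise]
    constructor
    · intro h
      refine ⟨fun i hi => ?_, fun i hi => ?_⟩
      · simpa [hi.2] using h i hi.1
      · simpa [hi.2] using h i hi.1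
    · rintro ⟨h1, h2⟩ i hi
      by_cases hT : i ∈ T
      · simpa [hT] using h2 i ⟨hi, hT⟩
      · simpa [hT] using h1 i ⟨hi, hT⟩
  rw [this, Measure.prod_prod, Measure.infinitePi_pi _ (fun i _ => ht i),
    Measure.infinitePi_pi _ (fun i _ => ht i), mul_comm]
  exact Finset.prod_filter_mul_prod_filter_not s (· ∈ T) _

open Classical in
theorem map_update_infinitePi (i : ι) :
    ((Measure.infinitePi ν).prod (ν i)).map (fun p => Function.update p.1 i p.2)
      = Measure.infinitePi ν := by
  have h1 : (Measure.infinitePi ν).prod (ν i) =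
      ((Measure.infinitePi ν).prod (Measure.infinitePi ν)).map (Prod.map id (fun x => x i)) := by
    rw [← Measure.map_prod_map _ _ measurable_id (measurable_pi_apply i), Measure.map_id,
      Measure.infinitePi_map_eval]
  rw [h1, Measure.map_map (by
    refine measurable_pi_lambda _ fun j => ?_
    by_cases hj : j = i
    · subst hj; simp only [Function.update_self]; fun_prop
    · simp only [Function.update_of_ne hj]; fun_prop) (by fun_prop)]
  conv_rhs => rw [← map_piecewise_infinitePi ν {i}]
  congr 1
  ext p j
  by_cases hj : j = i
  · subst hj; simp
  · simp [hj]

theorem measurable_update_pair [DecidableEq ι] (i : ι) :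
    Measurable (fun p : (ι → ℝ) × ℝ => Function.update p.1 i p.2) := by
  refine measurable_pi_lambda _ fun j => ?_
  by_cases hj : j = i
  · subst hj; simp only [Function.update_self]; fun_prop
  · simp only [Function.update_of_ne hj]; fun_prop

theorem lintegral_resample [DecidableEq ι] (i : ι) {g : (ι → ℝ) → ENNReal} (hg : Measurable g) :
    ∫⁻ v, g v ∂(Measure.infinitePi ν)
      = ∫⁻ v, ∫⁻ x, g (Function.update v i x) ∂(ν i) ∂(Measure.infinitePi ν) := by
  conv_lhs => rw [← map_update_infinitePi ν i]
  rw [lintegral_map hg (by convert measurable_update_pair i), lintegral_prod]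
  · congr!
  · refine (hg.comp ?_).aemeasurable
    convert measurable_update_pair i

open Classical in
/-- A function whose average over the coordinates in `T` vanishes is orthogonal to every function
that does not depend on these coordinates. -/
theorem integral_mul_eq_zero_of_resample (T : Set ι) {f g : (ι → ℝ) → ℝ}
    (hgT : ∀ v w, g (T.piecewise w v) = g v)
    (hfg : Integrable (fun v => g v * f v) (Measure.infinitePi ν))
    (hf : ∀ᵐ v ∂(Measure.infinitePi ν), ∫ w, f (T.piecewise w v) ∂(Measure.infinitePi ν) = 0) :
    ∫ v, g v * f v ∂(Measure.infinitePi ν) = 0 := by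
  have hm := (measurable_piecewise_pair (ι := ι) T).aemeasurable
    (μ := (Measure.infinitePi ν).prod (Measure.infinitePi ν))
  have hfg' : Integrable (fun v => g v * f v)
      (((Measure.infinitePi ν).prod (Measure.infinitePi ν)).map
        (fun p => T.piecewise p.2 p.1)) := by
    rw [map_piecewise_infinitePi]; exact hfg
  have e1 : ∫ v, g v * f v ∂(Measure.infinitePi ν) =
      ∫ p, g (T.piecewise p.2 p.1) * f (T.piecewise p.2 p.1)
        ∂((Measure.infinitePi ν).prod (Measure.infinitePi ν)) := by
    conv_lhs => rw [← map_piecewise_infinitePi ν T]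
    rw [integral_map hm hfg'.aestronglyMeasurable]
  have hint : Integrable (fun p : (ι → ℝ) × (ι → ℝ) =>
      g (T.piecewise p.2 p.1) * f (T.piecewise p.2 p.1))
      ((Measure.infinitePi ν).prod (Measure.infinitePi ν)) := hfg'.comp_aemeasurable hm
  rw [e1, integral_prod _ hint]
  simp only [hgT, integral_const_mul]
  rw [integral_eq_zero_of_ae]
  filter_upwards [hf] with v hv
  simp [hv]

end Resampling

section Martingale

variable {ι : Type*} (ν : ι → Measure ℝ) [∀ i, IsProbabilityMeasure (ν i)]

open Classical in
/-- The information carried by the coordinates in `S`. -/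
noncomputable abbrev coordSigma (S : Set ι) : MeasurableSpace (ι → ℝ) :=
  MeasurableSpace.comap (fun v => S.piecewise v (fun _ => (1 : ℝ))) inferInstance

open Classical in
theorem measurable_mask (S : Set ι) :
    Measurable (fun v : ι → ℝ => S.piecewise v (fun _ => (1 : ℝ))) := by
  refine measurable_pi_lambda _ fun i => ?_
  by_cases hi : i ∈ S <;> simp only [Set.piecewise, hi, if_true, if_false] <;> fun_prop

open Classical in
/-- The filtration generated by an increasing sequence of sets of coordinates. -/
noncomputable def coordFiltration {S : ℕ → Set ι} (hS : Monotone S) :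
    Filtration ℕ (inferInstance : MeasurableSpace (ι → ℝ)) where
  seq n := coordSigma (S n)
  mono' := by
    intro m n hmn
    have : (fun v : ι → ℝ => (S m).piecewise v (fun _ => (1 : ℝ))) =
        (fun v => (S m).piecewise v (fun _ => (1 : ℝ))) ∘
          (fun v => (S n).piecewise v (fun _ => (1 : ℝ))) := by
      ext v i
      by_cases hi : i ∈ S m
      · simp [hi, hS hmn hi]
      · simp [hi]
    change MeasurableSpace.comap _ _ ≤ MeasurableSpace.comap _ _
    rw [this, ← MeasurableSpace.comap_comp]
    exact MeasurableSpace.comap_mono (measurable_mask (S m)).comap_le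
  le' n := (measurable_mask (S n)).comap_le

open Classical in
/-- Convergence of an `L²`-bounded martingale whose increments are centred given ever more
coordinates of a product space. -/
theorem ae_exists_tendsto_sum_of_resample {S T : ℕ → Set ι} (hS : Monotone S)
    (hST : ∀ n, Disjoint (S n) (T n)) {f : ℕ → (ι → ℝ) → ℝ} (hfm : ∀ n, Measurable (f n))
    (hdep : ∀ n, ∀ᵐ v ∂(Measure.infinitePi ν),
      f n ((S (n + 1)).piecewise v (fun _ => (1 : ℝ))) = f n v)
    (hzero : ∀ n, ∀ᵐ v ∂(Measure.infinitePi ν),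
      ∫ w, f n ((T n).piecewise w v) ∂(Measure.infinitePi ν) = 0)
    (hL2 : ∀ n, MemLp (f n) 2 (Measure.infinitePi ν))
    (hsum : Summable fun n => ∫ v, f n v ^ 2 ∂(Measure.infinitePi ν)) :
    ∀ᵐ v ∂(Measure.infinitePi ν), ∃ l : ℝ,
      Tendsto (fun n => ∑ j ∈ Finset.range n, f j v) atTop (𝓝 l) := by
  set μ := Measure.infinitePi ν with hμ
  let φ : ℕ → (ι → ℝ) → ℝ := fun n v => f n ((S (n + 1)).piecewise v (fun _ => (1 : ℝ)))
  have hφf : ∀ n, φ n =ᵐ[μ] f n := hdep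
  have hφ2 : ∀ n, MemLp (φ n) 2 μ := fun n => (memLp_congr_ae (hφf n)).2 (hL2 n)
  let M : ℕ → (ι → ℝ) → ℝ := fun n v => ∑ j ∈ Finset.range n, φ j v
  have hM2 : ∀ n, MemLp (M n) 2 μ := fun n => memLp_finsetSum _ fun j _ => hφ2 j
  have hMm : ∀ n, Measurable[coordFiltration hS n] (M n) := by
    intro n
    refine Finset.measurable_fun_sum _ fun j hj => ?_
    have h1 : Measurable[coordFiltration hS (j + 1)] (φ j) := by
      refine Measurable.comp (hfm j) ?_
      exact comap_measurable _
    exact h1.mono ((coordFiltration hS).mono (Finset.mem_range.1 hj)) le_rfl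
  -- functions and sets known at time `n` are not changed by resampling the coordinates in `T n`
  have hmask : ∀ n v w, (S n).piecewise ((T n).piecewise w v) (fun _ => (1 : ℝ)) =
      (S n).piecewise v (fun _ => (1 : ℝ)) := by
    intro n v w
    ext i
    by_cases hi : i ∈ S n
    · simp [hi, Set.disjoint_left.1 (hST n) hi]
    · simp [hi]
  have horth : ∀ n (g : (ι → ℝ) → ℝ), Measurable[coordFiltration hS n] g →
      Integrable (fun v => g v * f n v) μ → ∫ v, g v * f n v ∂μ = 0 := by
    intro n g hg hint
    refine integral_mul_eq_zero_of_resample ν (T n) ?_ hint (hzero n)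
    obtain ⟨g', -, rfl⟩ := hg.exists_eq_measurable_comp
    intro v w
    simp only [Function.comp, hmask]
  have hmart : Martingale M (coordFiltration hS) μ := by
    refine martingale_of_setIntegral_eq_succ (fun n => (hMm n).stronglyMeasurable)
      (fun n => (hM2 n).integrable (by norm_num)) fun n s hs => ?_
    have hs' : MeasurableSet s := (coordFiltration hS).le n s hs
    have e : M (n + 1) = fun v => M n v + φ n v := by
      ext v; exact Finset.sum_range_succ _ _
    rw [e, integral_add ((hM2 n).integrable (by norm_num)).integrableOn
      ((hφ2 n).integrable (by norm_num)).integrableOn]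
    have hfi := (hL2 n).integrable (by norm_num : (1 : ENNReal) ≤ 2)
    have h0 : ∫ v in s, φ n v ∂μ = 0 := by
      rw [setIntegral_congr_ae (g := f n) hs' ((hφf n).mono fun v hv _ => hv),
        ← integral_indicator hs']
      have : s.indicator (f n) = fun v => s.indicator (fun _ => (1 : ℝ)) v * f n v := by
        ext v; by_cases hv : v ∈ s <;> simp [hv]
      rw [this]
      refine horth n _ (Measurable.indicator measurable_const hs) ?_
      rw [← this]
      exact hfi.indicator hs'
    rw [h0, add_zero]
  have hsq : ∀ n, ∫ v, M n v ^ 2 ∂μ = ∑ j ∈ Finset.range n, ∫ v, f j v ^ 2 ∂μ := by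
    intro n
    induction n with
    | zero => simp [M]
    | succ n ih =>
      rw [Finset.sum_range_succ, ← ih]
      have hi := (hM2 n).integrable_mul (hL2 n)
      have e : (fun v => M (n + 1) v ^ 2) =ᵐ[μ]
          fun v => (M n v ^ 2 + f n v ^ 2) + 2 * (M n v * f n v) := by
        filter_upwards [hφf n] with v hv
        simp only [M, Finset.sum_range_succ, hv]
        ring
      have hi' : Integrable (fun v => M n v * f n v) μ := hi
      have hadd : Integrable (fun v => M n v ^ 2 + f n v ^ 2) μ :=
        (hM2 n).integrable_sq.add (hL2 n).integrable_sq
      rw [integral_congr_ae e, integral_add hadd (hi'.const_mul 2),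
        integral_add (hM2 n).integrable_sq (hL2 n).integrable_sq, integral_const_mul,
        horth n _ (hMm n) hi']
      ring
  have hbdd : ∀ n, eLpNorm (M n) 1 μ ≤
      ((1 + ∑' j, ∫ v, f j v ^ 2 ∂μ).toNNReal : ENNReal) := by
    intro n
    rw [eLpNorm_one_eq_lintegral_enorm,
      ← ofReal_integral_norm_eq_lintegral_enorm ((hM2 n).integrable (by norm_num))]
    refine ENNReal.ofReal_le_ofReal ?_
    calc ∫ v, ‖M n v‖ ∂μ ≤ ∫ v, (1 + M n v ^ 2) ∂μ := by
          refine integral_mono ((hM2 n).integrable (by norm_num)).norm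
            ((integrable_const _).add (hM2 n).integrable_sq) fun v => ?_
          simp only [Real.norm_eq_abs]
          nlinarith [sq_abs (M n v), sq_nonneg (|M n v| - 1), abs_nonneg (M n v)]
      _ = 1 + ∑ j ∈ Finset.range n, ∫ v, f j v ^ 2 ∂μ := by
          rw [integral_add (integrable_const _) (hM2 n).integrable_sq, hsq]; simp
      _ ≤ _ := by
          have := hsum.sum_le_tsum (Finset.range n)
            (fun j _ => integral_nonneg fun v => sq_nonneg (f j v))
          linarith
  have hconv := hmart.submartingale.ae_tendsto_limitProcess hbdd
  filter_upwards [hconv, ae_all_iff.2 hφf] with v hv hvf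
  refine ⟨_, hv.congr fun n => ?_⟩
  exact Finset.sum_congr rfl fun j _ => hvf j

end Martingale

/-! ### Exponential coordinates and compensated sums -/

section Exponential

variable {r : ℝ}

theorem lintegral_expMeasure {g : ℝ → ENNReal} (hg : Measurable g) :
    ∫⁻ x, g x ∂(expMeasure r) =
      ∫⁻ x in Set.Ioi 0, ENNReal.ofReal (r * Real.exp (-(r * x))) * g x := by
  have hm : Measurable (exponentialPDF r) := (measurable_exponentialPDFReal r).ennreal_ofReal
  have h1 : expMeasure r = volume.withDensity (exponentialPDF r) := rfl
  rw [h1, lintegral_withDensity_eq_lintegral_mul _ hm hg, ← setLIntegral_congr Ioi_ae_eq_Ici.symm,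
    ← lintegral_indicator measurableSet_Ici]
  refine lintegral_congr fun x => ?_
  by_cases hx : 0 ≤ x
  · simp [hx, exponentialPDF_of_nonneg]
  · simp [hx, exponentialPDF_of_neg (not_le.1 hx)]

theorem ae_pos_expMeasure : ∀ᵐ x ∂(expMeasure r), 0 < x := by
  have h := lintegral_expMeasure (r := r) (g := (Set.Iic 0).indicator 1)
    (measurable_one.indicator measurableSet_Iic)
  rw [lintegral_indicator_one measurableSet_Iic] at h
  rw [ae_iff]
  simp only [not_lt]
  change expMeasure r (Set.Iic 0) = 0
  rw [h]
  refine (setLIntegral_congr_fun measurableSet_Ioi fun x hx => ?_).trans lintegral_zero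
  have : ¬ x ≤ 0 := not_le.2 hx
  simp [this]

theorem expMeasure_Ici (hr : 0 < r) {u : ℝ} (hu : 0 ≤ u) :
    expMeasure r (Set.Ici u) = ENNReal.ofReal (Real.exp (-(r * u))) := by
  have := isProbabilityMeasure_expMeasure hr
  have hIio : (expMeasure r) (Set.Iio u) = (expMeasure r) (Set.Iic u) := by
    refine measure_congr ?_
    have hac : expMeasure r ≪ volume := withDensity_absolutelyContinuous _ _
    exact hac.ae_le Iio_ae_eq_Iic
  have h1 : Set.Ici u = (Set.Iio u)ᶜ := by simp
  rw [h1, prob_compl_eq_one_sub measurableSet_Iio, hIio, ← ProbabilityTheory.ofReal_cdf,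
    cdf_expMeasure_eq hr, if_pos hu, ← ENNReal.ofReal_one,
    ← ENNReal.ofReal_sub _ (by simp [hr.le, mul_nonneg, hu])]
  simp

/-- The exponential law is characterised by a constant hazard rate: the expectation of `g` at an
exponential point is `r` times the expected integral of `g` up to that point. -/
theorem lintegral_expMeasure_eq_lintegral_Ioc (hr : 0 < r) {g : ℝ → ENNReal}
    (hg : Measurable g) :
    ∫⁻ x, g x ∂(expMeasure r) =
      ENNReal.ofReal r * ∫⁻ x, (∫⁻ u in Set.Ioc 0 x, g u) ∂(expMeasure r) := by
  have := isProbabilityMeasure_expMeasure hr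
  have e1 : ∀ x : ℝ, ∫⁻ u in Set.Ioc 0 x, g u =
      ∫⁻ u in Set.Ioi 0, (Set.Ici u).indicator (fun _ => g u) x := by
    intro x
    rw [← lintegral_indicator measurableSet_Ioc, ← lintegral_indicator measurableSet_Ioi]
    refine lintegral_congr fun u => ?_
    by_cases h0 : 0 < u <;> by_cases h1 : u ≤ x <;> simp [Set.indicator, h0, h1]
  have hm : Measurable (Function.uncurry
      fun x u : ℝ => (Set.Ici u).indicator (fun _ => g u) x) := by
    have : (Function.uncurry fun x u : ℝ => (Set.Ici u).indicator (fun _ => g u) x) =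
        {p : ℝ × ℝ | p.2 ≤ p.1}.indicator (fun p => g p.2) := by
      ext ⟨x, u⟩; by_cases h : u ≤ x <;> simp [Set.indicator, h]
    rw [this]
    exact (hg.comp measurable_snd).indicator (measurableSet_le measurable_snd measurable_fst)
  simp_rw [e1]
  rw [lintegral_lintegral_swap hm.aemeasurable, lintegral_expMeasure hg, ← lintegral_const_mul' _ _ ENNReal.ofReal_ne_top]
  refine setLIntegral_congr_fun measurableSet_Ioi fun u hu => ?_
  have : ∫⁻ x, (Set.Ici u).indicator (fun _ => g u) x ∂(expMeasure r) =
      g u * ENNReal.ofReal (Real.exp (-(r * u))) := by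
    rw [lintegral_indicator measurableSet_Ici, setLIntegral_const, expMeasure_Ici hr (le_of_lt hu)]
  simp only [this]
  rw [ENNReal.ofReal_mul hr.le]
  ring

theorem lintegral_pow_expMeasure (hr : 0 < r) (n : ℕ) :
    ∫⁻ x, ENNReal.ofReal (x ^ n) ∂(expMeasure r) = ENNReal.ofReal (n.factorial / r ^ n) := by
  have := isProbabilityMeasure_expMeasure hr
  induction n with
  | zero => simp
  | succ n ih =>
    rw [lintegral_expMeasure_eq_lintegral_Ioc hr (by fun_prop)] at ih
    have e : ∀ᵐ x ∂(expMeasure r), ∫⁻ u in Set.Ioc 0 x, ENNReal.ofReal (u ^ n) =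
        ENNReal.ofReal (((n : ℝ) + 1)⁻¹) * ENNReal.ofReal (x ^ (n + 1)) := by
      filter_upwards [ae_pos_expMeasure] with x hx
      rw [← ofReal_integral_eq_lintegral_ofReal]
      · rw [← intervalIntegral.integral_of_le hx.le, integral_pow, ← ENNReal.ofReal_mul (by positivity)]
        congr 1
        simp; field_simp
      · exact (intervalIntegral.intervalIntegrable_pow n).1
      · filter_upwards [ae_restrict_mem measurableSet_Ioc] with u hu
        exact pow_nonneg hu.1.le n
    rw [lintegral_congr_ae e, lintegral_const_mul' _ _ ENNReal.ofReal_ne_top, ← mul_assoc,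
      ← ENNReal.ofReal_mul hr.le] at ih
    have hne : ENNReal.ofReal (r * ((n : ℝ) + 1)⁻¹) ≠ 0 := by
      simp; positivity
    have h2 : ENNReal.ofReal (r * ((n : ℝ) + 1)⁻¹) *
        ENNReal.ofReal ((n + 1).factorial / r ^ (n + 1)) =
          ENNReal.ofReal (n.factorial / r ^ n) := by
      rw [← ENNReal.ofReal_mul (by positivity), Nat.factorial_succ]
      congr 1
      push_cast
      field_simp
      ring
    rw [← h2] at ih
    exact (ENNReal.mul_right_inj hne ENNReal.ofReal_ne_top).1 ih

theorem integrable_pow_expMeasure (hr : 0 < r) (n : ℕ) :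
    Integrable (fun x => x ^ n) (expMeasure r) := by
  refine ⟨by fun_prop, ?_⟩
  rw [HasFiniteIntegral]
  have : ∀ᵐ x ∂(expMeasure r), ‖x ^ n‖ₑ = ENNReal.ofReal (x ^ n) := by
    filter_upwards [ae_pos_expMeasure] with x hx
    rw [Real.enorm_eq_ofReal (by positivity)]
  rw [lintegral_congr_ae this, lintegral_pow_expMeasure hr]
  exact ENNReal.ofReal_lt_top

theorem integral_pow_expMeasure (hr : 0 < r) (n : ℕ) :
    ∫ x, x ^ n ∂(expMeasure r) = n.factorial / r ^ n := by
  rw [integral_eq_lintegral_of_nonneg_ae, lintegral_pow_expMeasure hr,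
    ENNReal.toReal_ofReal (by positivity)]
  · filter_upwards [ae_pos_expMeasure] with x hx
    positivity
  · fun_prop

/-- Two consequences of the constant hazard rate for a bounded nonnegative `g` with compensator
`H x = r * ∫ u in (0, x], g u`: the compensated variable `g - H` is centred, and it has the same
second moment as `g`. -/
theorem integral_compensated_expMeasure (hr : 0 < r) {g : ℝ → ℝ} (hg : Measurable g)
    (hg0 : ∀ x, 0 < x → 0 ≤ g x) {C : ℝ} (hgC : ∀ x, 0 < x → g x ≤ C) :
    (∫ x, (g x - r * ∫ u in Set.Ioc 0 x, g u) ∂(expMeasure r) = 0) ∧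
    (∫⁻ x, ENNReal.ofReal ((g x - r * ∫ u in Set.Ioc 0 x, g u) ^ 2) ∂(expMeasure r) =
      ∫⁻ x, ENNReal.ofReal (g x ^ 2) ∂(expMeasure r)) := by
  have := isProbabilityMeasure_expMeasure hr
  have hC : 0 ≤ C := (hg0 1 one_pos).trans (hgC 1 one_pos)
  set H : ℝ → ℝ := fun x => r * ∫ u in Set.Ioc 0 x, g u with hH
  have hint : ∀ x, IntegrableOn g (Set.Ioc 0 x) := by
    intro x
    refine Measure.integrableOn_of_bounded (M := C) (by simp) hg.aestronglyMeasurable ?_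
    filter_upwards [ae_restrict_mem measurableSet_Ioc] with u hu
    rw [Real.norm_of_nonneg (hg0 u hu.1)]; exact hgC u hu.1
  have hH0 : ∀ x, 0 ≤ H x := fun x => mul_nonneg hr.le
    (setIntegral_nonneg measurableSet_Ioc fun u hu => hg0 u hu.1)
  have hHC : ∀ x, 0 < x → H x ≤ r * (C * x) := by
    intro x hx
    refine mul_le_mul_of_nonneg_left ?_ hr.le
    calc ∫ u in Set.Ioc 0 x, g u ≤ ∫ u in Set.Ioc 0 x, C :=
          setIntegral_mono_on (hint x) (by simp) measurableSet_Ioc fun u hu => hgC u hu.1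
      _ = C * x := by simp [hx.le, mul_comm]
  have hHmono : Monotone H := by
    intro x y hxy
    refine mul_le_mul_of_nonneg_left ?_ hr.le
    refine setIntegral_mono_set (hint y) ?_ (Set.Ioc_subset_Ioc_right hxy).eventuallyLE
    filter_upwards [ae_restrict_mem measurableSet_Ioc] with u hu using hg0 u hu.1
  have hHm : Measurable H := hHmono.measurable
  have hpos := ae_pos_expMeasure (r := r)
  have hg1 : Integrable g (expMeasure r) := by
    refine Integrable.mono' (integrable_const C) hg.aestronglyMeasurable ?_
    filter_upwards [hpos] with x hx
    rw [Real.norm_of_nonneg (hg0 x hx)]; exact hgC x hx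
  have hg2 : Integrable (fun x => g x ^ 2) (expMeasure r) := by
    refine Integrable.mono' (integrable_const (C ^ 2)) (by fun_prop) ?_
    filter_upwards [hpos] with x hx
    rw [Real.norm_of_nonneg (by positivity)]
    exact pow_le_pow_left₀ (hg0 x hx) (hgC x hx) 2
  have hH1 : Integrable H (expMeasure r) := by
    refine Integrable.mono' (((integrable_pow_expMeasure hr 1).const_mul (r * C)))
      hHm.aestronglyMeasurable ?_
    filter_upwards [hpos] with x hx
    rw [Real.norm_of_nonneg (hH0 x), pow_one, mul_assoc]; exact hHC x hx
  have hH2 : Integrable (fun x => H x ^ 2) (expMeasure r) := by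
    refine Integrable.mono' (((integrable_pow_expMeasure hr 2).const_mul ((r * C) ^ 2)))
      (by fun_prop) ?_
    filter_upwards [hpos] with x hx
    rw [Real.norm_of_nonneg (by positivity), ← mul_pow, mul_assoc]
    exact pow_le_pow_left₀ (hH0 x) (hHC x hx) 2
  have hgH : Integrable (fun x => g x * H x) (expMeasure r) := by
    refine Integrable.mono' (((integrable_pow_expMeasure hr 1).const_mul (C * (r * C))))
      (by fun_prop) ?_
    filter_upwards [hpos] with x hx
    rw [Real.norm_of_nonneg (mul_nonneg (hg0 x hx) (hH0 x)), pow_one]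
    calc g x * H x ≤ C * (r * (C * x)) :=
          mul_le_mul (hgC x hx) (hHC x hx) (hH0 x) hC
      _ = _ := by ring
  -- the expectation of a primitive of `f`
  have key : ∀ f F : ℝ → ℝ, Measurable f → (∀ x, 0 < x → 0 ≤ f x) →
      Integrable f (expMeasure r) → Integrable F (expMeasure r) →
      (∀ x, 0 < x → IntegrableOn f (Set.Ioc 0 x)) →
      (∀ x, 0 < x → F x = r * ∫ u in Set.Ioc 0 x, f u) →
      ∫ x, F x ∂(expMeasure r) = ∫ x, f x ∂(expMeasure r) := by
    intro f F hf hf0 hfi hFi hfl hF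
    have hF0 : ∀ x, 0 < x → 0 ≤ F x := fun x hx => by
      rw [hF x hx]
      exact mul_nonneg hr.le (setIntegral_nonneg measurableSet_Ioc fun u hu => hf0 u hu.1)
    rw [integral_eq_lintegral_of_nonneg_ae (hpos.mono hF0) hFi.aestronglyMeasurable,
      integral_eq_lintegral_of_nonneg_ae (hpos.mono hf0) hfi.aestronglyMeasurable,
      lintegral_expMeasure_eq_lintegral_Ioc hr hf.ennreal_ofReal,
      ← lintegral_const_mul' _ _ ENNReal.ofReal_ne_top]
    congr 1
    refine lintegral_congr_ae ?_
    filter_upwards [hpos] with x hx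
    rw [hF x hx, ENNReal.ofReal_mul hr.le, ofReal_integral_eq_lintegral_ofReal (hfl x hx)]
    filter_upwards [ae_restrict_mem measurableSet_Ioc] with u hu using hf0 u hu.1
  have hmean : ∫ x, H x ∂(expMeasure r) = ∫ x, g x ∂(expMeasure r) :=
    key g H hg hg0 hg1 hH1 (fun x _ => hint x) fun x _ => rfl
  have hsq : ∫ x, H x ^ 2 ∂(expMeasure r) = ∫ x, 2 * (g x * H x) ∂(expMeasure r) := by
    refine key _ _ (by fun_prop) (fun x hx => ?_) (hgH.const_mul 2) hH2 (fun x hx => ?_)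
      fun x hx => ?_
    · have := hg0 x hx; have := hH0 x; positivity
    · refine Integrable.const_mul ?_ 2
      refine (hint x).mul_bdd (c := H x) hHm.aestronglyMeasurable ?_
      filter_upwards [ae_restrict_mem measurableSet_Ioc] with u hu
      rw [Real.norm_of_nonneg (hH0 u)]; exact hHmono hu.2
    · -- integration by parts for the absolutely continuous function `H`
      have hii : IntervalIntegrable g volume 0 x := (intervalIntegrable_iff_integrableOn_Ioc_of_le hx.le).2 (hint x)
      let G : ℝ → ℝ := fun y => ∫ u in (0 : ℝ)..y, g u
      have hGH : ∀ y, 0 ≤ y → H y = r * G y := fun y hy => by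
        simp only [hH, G, intervalIntegral.integral_of_le hy]
      have hac : AbsolutelyContinuousOnInterval G 0 x :=
        hii.absolutelyContinuousOnInterval_intervalIntegral (by simp)
      have hG := AbsolutelyContinuousOnInterval.integral_deriv_mul_eq_sub hac hac
      have hder := hii.ae_hasDerivAt_integral
      have e : ∫ y in (0 : ℝ)..x, (deriv G y * G y + G y * deriv G y) =
          ∫ y in (0 : ℝ)..x, 2 * (g y * G y) := by
        refine intervalIntegral.integral_congr_ae ?_
        filter_upwards [hder] with y hy hyx
        have := (hy (Set.uIoc_subset_uIcc hyx) 0 (by simp)).deriv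
        rw [this]; ring
      rw [e] at hG
      have hG0 : G 0 = 0 := by simp [G]
      rw [hG0, intervalIntegral.integral_of_le hx.le] at hG
      have e2 : ∫ u in Set.Ioc 0 x, 2 * (g u * H u) =
          ∫ u in Set.Ioc 0 x, r * (2 * (g u * G u)) := by
        refine setIntegral_congr_fun measurableSet_Ioc fun u hu => ?_
        simp only [hGH u hu.1.le]; ring
      rw [e2, integral_const_mul, hG, hGH x hx.le]; ring
  constructor
  · rw [integral_sub hg1 hH1, hmean, sub_self]
  · have hsub : Integrable (fun x => (g x - H x) ^ 2) (expMeasure r) := by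
      have : (fun x => (g x - H x) ^ 2) = fun x => g x ^ 2 - 2 * (g x * H x) + H x ^ 2 := by
        ext x; ring
      rw [this]; exact (hg2.sub (hgH.const_mul 2)).add hH2
    rw [← ofReal_integral_eq_lintegral_ofReal hsub (ae_of_all _ fun x => sq_nonneg _),
      ← ofReal_integral_eq_lintegral_ofReal hg2 (ae_of_all _ fun x => sq_nonneg _)]
    congr 1
    have e : ∀ x, (g x - H x) ^ 2 = g x ^ 2 - 2 * (g x * H x) + H x ^ 2 := fun x => by ring
    have hi : Integrable (fun x => g x ^ 2 - 2 * (g x * H x)) (expMeasure r) :=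
      hg2.sub (hgH.const_mul 2)
    simp_rw [e]
    rw [integral_add hi hH2, integral_sub hg2 (hgH.const_mul 2), hsq]
    ring

end Exponential

section Compensation

variable {ι : Type*} (ν : ι → Measure ℝ) [∀ i, IsProbabilityMeasure (ν i)]

theorem ae_forall_pos [Countable ι] (hpos : ∀ i, ∀ᵐ x ∂(ν i), 0 < x) :
    ∀ᵐ v ∂(Measure.infinitePi ν), ∀ i, 0 < v i := by
  rw [ae_all_iff]
  exact fun i => (measurePreserving_eval_infinitePi ν i).quasiMeasurePreserving.ae (hpos i)

theorem update_pos [DecidableEq ι] {v : ι → ℝ} (hv : ∀ i, 0 < v i) {i : ι} {x : ℝ} (hx : 0 < x) :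
    ∀ j, 0 < Function.update v i x j := by
  intro j
  by_cases hj : j = i
  · subst hj; simpa
  · simpa [hj] using hv j

theorem measurable_setIntegral_update [DecidableEq ι] (i : ι) {K : (ι → ℝ) → ℝ}
    (hK : Measurable K) :
    Measurable fun v : ι → ℝ => ∫ u in Set.Ioc 0 (v i), K (Function.update v i u) := by
  have e : ∀ v : ι → ℝ, ∫ u in Set.Ioc 0 (v i), K (Function.update v i u) =
      ∫ u, {p : (ι → ℝ) × ℝ | 0 < p.2 ∧ p.2 ≤ p.1 i}.indicator
        (fun p => K (Function.update p.1 i p.2)) (v, u) := by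
    intro v
    rw [← integral_indicator measurableSet_Ioc]
    rfl
  simp_rw [e]
  have hm : Measurable ({p : (ι → ℝ) × ℝ | 0 < p.2 ∧ p.2 ≤ p.1 i}.indicator
        (fun p => K (Function.update p.1 i p.2))) := by
    refine (hK.comp (measurable_update_pair i)).indicator ?_
    exact (measurableSet_lt measurable_const measurable_snd).inter
      (measurableSet_le measurable_snd (by fun_prop))
  exact (hm.stronglyMeasurable.integral_prod_right').measurable

theorem measurable_setLIntegral_update [DecidableEq ι] (i : ι) {K : (ι → ℝ) → ENNReal}
    (hK : Measurable K) :
    Measurable fun v : ι → ℝ => ∫⁻ u in Set.Ioc 0 (v i), K (Function.update v i u) := by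
  have e : ∀ v : ι → ℝ, ∫⁻ u in Set.Ioc 0 (v i), K (Function.update v i u) =
      ∫⁻ u, {p : (ι → ℝ) × ℝ | 0 < p.2 ∧ p.2 ≤ p.1 i}.indicator
        (fun p => K (Function.update p.1 i p.2)) (v, u) := by
    intro v
    rw [← lintegral_indicator measurableSet_Ioc]
    rfl
  simp_rw [e]
  refine Measurable.lintegral_prod_right' ?_
  refine (hK.comp (measurable_update_pair i)).indicator ?_
  exact (measurableSet_lt measurable_const measurable_snd).inter
    (measurableSet_le measurable_snd (by fun_prop))

/-- The constant hazard rate of an exponential coordinate, averaged over all the others. -/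
theorem lintegral_eq_lintegral_Ioc_update [DecidableEq ι] {r : ℝ} (hr : 0 < r) {i : ι}
    (hi : ν i = expMeasure r) {g : (ι → ℝ) → ENNReal} (hg : Measurable g) :
    ∫⁻ v, g v ∂(Measure.infinitePi ν) = ENNReal.ofReal r *
      ∫⁻ v, (∫⁻ u in Set.Ioc 0 (v i), g (Function.update v i u)) ∂(Measure.infinitePi ν) := by
  have hm := measurable_setLIntegral_update i hg
  rw [lintegral_resample ν i hg, lintegral_resample ν i hm,
    ← lintegral_const_mul' _ _ ENNReal.ofReal_ne_top]
  refine lintegral_congr fun v => ?_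
  have := lintegral_expMeasure_eq_lintegral_Ioc hr (hg.comp (measurable_update v (a := i)))
  simp only [Function.comp] at this
  simp [hi, this]

open Classical in
/-- Convergence of compensated sums over a Poisson stream. The interarrival times of the stream are
the coordinates `idx 0, idx 1, …`, of exponential law with rate `r`; `K n` is the value at the
`n`-th point of a bounded nonnegative integrand that is determined by what precedes this point, so
that `K n (update v (idx n) u)` is its value at the time `u` after the preceding point. -/
theorem ae_tendsto_sum_compensated [Countable ι] {S : ℕ → Set ι} (hS : Monotone S) {idx : ℕ → ι}
    (hidx : ∀ n, idx n ∉ S n) (hidx' : ∀ n, idx n ∈ S (n + 1)) {r : ℝ} (hr : 0 < r)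
    (hν : ∀ n, ν (idx n) = expMeasure r) (hpos : ∀ i, ∀ᵐ x ∂(ν i), 0 < x)
    {K : ℕ → (ι → ℝ) → ℝ} (hKm : ∀ n, Measurable (K n))
    (hK0 : ∀ n v, (∀ i, 0 < v i) → 0 ≤ K n v) {C : ℝ} (hKC : ∀ n v, (∀ i, 0 < v i) → K n v ≤ C)
    (hdep : ∀ n v, (∀ i, 0 < v i) → K n ((S (n + 1)).piecewise v (fun _ => (1 : ℝ))) = K n v)
    (hsum : ∑' n, ∫⁻ v, (∫⁻ u in Set.Ioc 0 (v (idx n)),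
      ENNReal.ofReal (K n (Function.update v (idx n) u) ^ 2)) ∂(Measure.infinitePi ν) ≠ ⊤) :
    ∀ᵐ v ∂(Measure.infinitePi ν),
      (∃ l : ℝ, Tendsto (fun n => ∑ j ∈ Finset.range n, (K j v -
        r * ∫ u in Set.Ioc 0 (v (idx j)), K j (Function.update v (idx j) u))) atTop (𝓝 l)) ∧
      Tendsto (fun n => K n v) atTop (𝓝 0) := by
  set μ := Measure.infinitePi ν with hμ
  have hP : ∀ᵐ v ∂μ, ∀ i, 0 < v i := ae_forall_pos ν hpos
  let f : ℕ → (ι → ℝ) → ℝ := fun n v =>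
    K n v - r * ∫ u in Set.Ioc 0 (v (idx n)), K n (Function.update v (idx n) u)
  have hfm : ∀ n, Measurable (f n) := fun n =>
    (hKm n).sub ((measurable_setIntegral_update (idx n) (hKm n)).const_mul r)
  have hfupd : ∀ n v x, f n (Function.update v (idx n) x) =
      K n (Function.update v (idx n) x) - r * ∫ u in Set.Ioc 0 x, K n (Function.update v (idx n) u) := by
    intro n v x
    simp [f]
  have hKsum : ∑' n, ∫⁻ v, ENNReal.ofReal (K n v ^ 2) ∂μ ≠ ⊤ := by
    have : ∀ n, ∫⁻ v, ENNReal.ofReal (K n v ^ 2) ∂μ = ENNReal.ofReal r *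
        ∫⁻ v, (∫⁻ u in Set.Ioc 0 (v (idx n)),
          ENNReal.ofReal (K n (Function.update v (idx n) u) ^ 2)) ∂μ := fun n =>
      lintegral_eq_lintegral_Ioc_update ν hr (hν n)
        (g := fun v => ENNReal.ofReal (K n v ^ 2)) ((hKm n).pow_const 2).ennreal_ofReal
    simp_rw [this]
    rw [ENNReal.tsum_mul_left]
    exact ENNReal.mul_ne_top ENNReal.ofReal_ne_top hsum
  have hone : ∀ n v, (∀ i, 0 < v i) →
      (∫ x, f n (Function.update v (idx n) x) ∂(expMeasure r) = 0) ∧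
      (∫⁻ x, ENNReal.ofReal (f n (Function.update v (idx n) x) ^ 2) ∂(expMeasure r) =
        ∫⁻ x, ENNReal.ofReal (K n (Function.update v (idx n) x) ^ 2) ∂(expMeasure r)) := by
    intro n v hv
    simp_rw [hfupd]
    exact integral_compensated_expMeasure hr ((hKm n).comp (measurable_update v))
      (fun x hx => hK0 n _ (update_pos hv hx)) (C := C) (fun x hx => hKC n _ (update_pos hv hx))
  have hf2 : ∀ n, ∫⁻ v, ENNReal.ofReal (f n v ^ 2) ∂μ = ∫⁻ v, ENNReal.ofReal (K n v ^ 2) ∂μ := by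
    intro n
    rw [hμ, lintegral_resample ν (idx n) ((hfm n).pow_const 2).ennreal_ofReal,
      lintegral_resample ν (idx n) ((hKm n).pow_const 2).ennreal_ofReal]
    refine lintegral_congr_ae ?_
    filter_upwards [hP] with v hv
    rw [hν n, (hone n v hv).2]
  have hfin : ∀ n, ∫⁻ v, ENNReal.ofReal (f n v ^ 2) ∂μ ≠ ⊤ := fun n => by
    rw [hf2]; exact ENNReal.ne_top_of_tsum_ne_top hKsum n
  have hL2 : ∀ n, MemLp (f n) 2 μ := by
    intro n
    rw [memLp_two_iff_integrable_sq (hfm n).aestronglyMeasurable]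
    refine ⟨((hfm n).pow_const 2).aestronglyMeasurable, ?_⟩
    rw [hasFiniteIntegral_iff_ofReal (ae_of_all _ fun v => sq_nonneg _)]
    exact (hfin n).lt_top
  have hint : ∀ n, ∫ v, f n v ^ 2 ∂μ = (∫⁻ v, ENNReal.ofReal (K n v ^ 2) ∂μ).toReal := by
    intro n
    rw [integral_eq_lintegral_of_nonneg_ae (ae_of_all _ fun v => sq_nonneg _)
      ((hfm n).pow_const 2).aestronglyMeasurable, hf2]
  have hmart := ae_exists_tendsto_sum_of_resample ν hS (T := fun n => {idx n})
    (fun n => Set.disjoint_singleton_right.2 (hidx n)) hfm ?_ ?_ hL2 ?_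
  · have hto : ∀ᵐ v ∂μ, ∑' n, ENNReal.ofReal (K n v ^ 2) < ⊤ := by
      refine ae_lt_top (Measurable.tsum fun n => ((hKm n).pow_const 2).ennreal_ofReal) ?_
      rwa [lintegral_tsum fun n => ((hKm n).pow_const 2).ennreal_ofReal.aemeasurable]
    filter_upwards [hmart, hto] with v hv hv2
    refine ⟨hv, ?_⟩
    have h1 := ENNReal.summable_toReal hv2.ne
    have h2 : Tendsto (fun n => K n v ^ 2) atTop (𝓝 0) := by
      refine h1.tendsto_atTop_zero.congr fun n => ?_
      rw [ENNReal.toReal_ofReal (sq_nonneg _)]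
    have h3 := h2.sqrt
    simp only [Real.sqrt_sq_eq_abs, Real.sqrt_zero] at h3
    exact (tendsto_zero_iff_abs_tendsto_zero _).2 h3
  · intro n
    filter_upwards [hP] with v hv
    have hu : ∀ u, Function.update ((S (n + 1)).piecewise v (fun _ => (1 : ℝ))) (idx n) u =
        (S (n + 1)).piecewise (Function.update v (idx n) u) (fun _ => (1 : ℝ)) := by
      intro u
      ext j
      by_cases hj : j = idx n
      · subst hj; simp [hidx' n]
      · by_cases hjS : j ∈ S (n + 1) <;> simp [hj, hjS]
    simp only [f, hdep n v hv, Set.piecewise_eq_of_mem _ _ _ (hidx' n)]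
    congr 2
    refine setIntegral_congr_fun measurableSet_Ioc fun u hu' => ?_
    rw [hu]
    exact hdep n _ (update_pos hv hu'.1)
  · intro n
    filter_upwards [hP] with v hv
    have e : ∀ w : ι → ℝ, Set.piecewise {idx n} w v = Function.update v (idx n) (w (idx n)) := by
      intro w; ext j
      by_cases hj : j = idx n
      · subst hj; simp
      · simp [hj]
    have e2 : ∫ w, f n (Function.update v (idx n) (w (idx n))) ∂μ =
        ∫ x, f n (Function.update v (idx n) x) ∂(ν (idx n)) := by
      rw [← (measurePreserving_eval_infinitePi ν (idx n)).map_eq, integral_map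
        (measurable_pi_apply _).aemeasurable
        ((hfm n).comp (measurable_update v)).aestronglyMeasurable]
    have e3 : ∀ w : ι → ℝ, f n (Set.piecewise {idx n} w v) =
        f n (Function.update v (idx n) (w (idx n))) := fun w => by rw [e w]
    calc _ = ∫ w, f n (Function.update v (idx n) (w (idx n))) ∂μ :=
          integral_congr_ae (ae_of_all _ fun w => by convert e3 w)
      _ = 0 := by rw [e2, hν n]; exact (hone n v hv).1
  · refine (funext hint : (fun n => ∫ v, f n v ^ 2 ∂μ) = _) ▸ ?_
    exact ENNReal.summable_toReal hKsum

end Compensation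

/-! ### Kronecker's lemma, counting and weights -/

section Deterministic

/-- **Kronecker's lemma.** -/
theorem tendsto_sum_mul_div_atTop_zero {a b : ℕ → ℝ} (hb : Monotone b) (hbt : Tendsto b atTop atTop)
    {l : ℝ} (ha : Tendsto (fun n => ∑ j ∈ Finset.range n, a j) atTop (𝓝 l)) :
    Tendsto (fun n => (∑ j ∈ Finset.range n, b j * a j) / b n) atTop (𝓝 0) := by
  set s : ℕ → ℝ := fun n => ∑ j ∈ Finset.range n, a j with hs
  have habel : ∀ n, ∑ j ∈ Finset.range n, b j * a j =
      b n * (s n - l) + b 0 * l - ∑ j ∈ Finset.range n, (b (j + 1) - b j) * (s (j + 1) - l) := by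
    intro n
    induction n with
    | zero => simp [hs]
    | succ n ih =>
      rw [Finset.sum_range_succ, Finset.sum_range_succ, ih]
      simp only [hs, Finset.sum_range_succ]
      ring
  have hsl : Tendsto (fun n => s n - l) atTop (𝓝 0) := by
    simpa using ha.sub_const l
  have hlo : (fun n => ∑ j ∈ Finset.range n, (b (j + 1) - b j) * (s (j + 1) - l)) =o[atTop]
      fun n => ∑ j ∈ Finset.range n, (b (j + 1) - b j) := by
    refine Asymptotics.IsLittleO.sum_range ?_ (fun n => sub_nonneg.2 (hb n.le_succ)) ?_
    · have : (fun n => s (n + 1) - l) =o[atTop] fun _ => (1 : ℝ) :=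
        (Asymptotics.isLittleO_one_iff ℝ).2 (hsl.comp (tendsto_add_atTop_nat 1))
      simpa using (Asymptotics.isBigO_refl (fun n => b (n + 1) - b n) atTop).mul_isLittleO this
    · simp_rw [Finset.sum_range_sub]
      exact tendsto_atTop_add_const_right _ _ hbt
  have hlo' : (fun n => ∑ j ∈ Finset.range n, (b (j + 1) - b j) * (s (j + 1) - l)) =o[atTop] b := by
    refine hlo.trans_isBigO ?_
    simp_rw [Finset.sum_range_sub]
    refine Asymptotics.IsBigO.sub (Asymptotics.isBigO_refl _ _) ?_
    exact (Asymptotics.isLittleO_const_left.2 (Or.inr (tendsto_norm_atTop_atTop.comp hbt))).isBigO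
  have h1 : Tendsto (fun n => b 0 * l / b n) atTop (𝓝 0) := hbt.const_div_atTop _
  have h2 := hlo'.tendsto_div_nhds_zero
  have h3 := (hsl.add h1).sub h2
  simp only [add_zero, sub_zero] at h3
  refine h3.congr' ?_
  filter_upwards [hbt.eventually_gt_atTop 0] with n hn
  rw [habel]
  field_simp

/-- The number of points of the sequence `p` in `(-∞, t]`. -/
noncomputable def countUpTo (p : ℕ → ℝ) (t : ℝ) : ℕ := sInf {k | t < p k}

theorem lt_countUpTo_iff {p : ℕ → ℝ} (hp : Monotone p) (hpt : Tendsto p atTop atTop) {t : ℝ}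
    {k : ℕ} : k < countUpTo p t ↔ p k ≤ t := by
  have hne : {k | t < p k}.Nonempty := (hpt.eventually_gt_atTop t).exists
  constructor
  · intro h
    by_contra! hk
    exact absurd (Nat.sInf_le (show k ∈ {k | t < p k} from hk)) (not_le.2 h)
  · intro h
    by_contra! hk
    exact absurd ((show t < p (countUpTo p t) from Nat.sInf_mem hne).trans_le (hp hk)) (not_lt.2 h)

theorem countUpTo_mono {p : ℕ → ℝ} (hp : Monotone p) (hpt : Tendsto p atTop atTop) :
    Monotone (countUpTo p) := by
  intro s t hst
  by_contra! h
  exact absurd (((lt_countUpTo_iff hp hpt).1 h).trans hst)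
    (fun h' => lt_irrefl _ ((lt_countUpTo_iff hp hpt).2 h'))

theorem tendsto_countUpTo {p : ℕ → ℝ} (hp : Monotone p) (hpt : Tendsto p atTop atTop) :
    Tendsto (countUpTo p) atTop atTop := by
  refine tendsto_atTop.2 fun k => ?_
  filter_upwards [eventually_ge_atTop (p k)] with t ht
  exact ((lt_countUpTo_iff hp hpt).2 ht).le

/-- If compensated sums over the points `p 0 ≤ p 1 ≤ …` converge along the points, with summands
tending to zero, then they also converge along any other sequence of times: between two points the
compensated sum decreases by at most the amount that the next summand restores. -/
theorem tendsto_sum_countUpTo_sub_integral {p : ℕ → ℝ} (hp : Monotone p)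
    (hpt : Tendsto p atTop atTop) {h : ℝ → ℝ} (h0 : ∀ t, 0 ≤ h t)
    (hint : ∀ t, IntegrableOn h (Set.Ioc 0 t)) {r : ℝ} (hr : 0 ≤ r) {l : ℝ}
    (hconv : Tendsto (fun n => ∑ k ∈ Finset.range (n + 1), h (p k) -
      r * ∫ u in Set.Ioc 0 (p n), h u) atTop (𝓝 l))
    (hzero : Tendsto (fun n => h (p n)) atTop (𝓝 0)) {t : ℕ → ℝ} (ht : Tendsto t atTop atTop) :
    Tendsto (fun n => ∑ k ∈ Finset.range (countUpTo p (t n)), h (p k) -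
      r * ∫ u in Set.Ioc 0 (t n), h u) atTop (𝓝 l) := by
  set m : ℕ → ℝ := fun n => ∑ k ∈ Finset.range (n + 1), h (p k) -
      r * ∫ u in Set.Ioc 0 (p n), h u with hm
  have hmono : ∀ {s t : ℝ}, s ≤ t → ∫ u in Set.Ioc 0 s, h u ≤ ∫ u in Set.Ioc 0 t, h u :=
    fun {s t} hst => setIntegral_mono_set (hint t) (ae_of_all _ h0)
      (Set.Ioc_subset_Ioc_right hst).eventuallyLE
  have hc := (tendsto_countUpTo hp hpt).comp ht
  have hc1 : Tendsto (fun n => countUpTo p (t n) - 1) atTop atTop :=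
    (tendsto_sub_atTop_nat 1).comp hc
  have hup : Tendsto (fun n => m (countUpTo p (t n) - 1)) atTop (𝓝 l) := hconv.comp hc1
  have hlow : Tendsto (fun n => m (countUpTo p (t n)) - h (p (countUpTo p (t n)))) atTop
      (𝓝 (l - 0)) := (hconv.comp hc).sub (hzero.comp hc)
  rw [sub_zero] at hlow
  have hge : ∀ᶠ n in atTop, 1 ≤ countUpTo p (t n) := hc.eventually_ge_atTop 1
  refine tendsto_of_tendsto_of_tendsto_of_le_of_le' hlow hup ?_ ?_
  · filter_upwards [] with n
    have : t n < p (countUpTo p (t n)) := by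
      by_contra! h'
      exact lt_irrefl _ ((lt_countUpTo_iff hp hpt).2 h')
    have := mul_le_mul_of_nonneg_left (hmono this.le) hr
    simp only [hm, Finset.sum_range_succ]
    linarith
  · filter_upwards [hge] with n hn
    obtain ⟨k, hk⟩ : ∃ k, countUpTo p (t n) = k + 1 := ⟨_, (Nat.sub_add_cancel hn).symm⟩
    have : p k ≤ t n := (lt_countUpTo_iff hp hpt).1 (by omega)
    have := mul_le_mul_of_nonneg_left (hmono this) hr
    simp only [hm, hk, Nat.add_sub_cancel]
    linarith

/-- A nonnegative sequence that grows by steps of at most one is dominated by the square root of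
its sum. -/
theorem sq_le_two_mul_sum {Q : ℕ → ℝ} (hQ0 : ∀ n, 0 ≤ Q n) (hQ1 : Q 0 ≤ 1)
    (hQs : ∀ n, Q (n + 1) ≤ Q n + 1) (n : ℕ) :
    Q n ^ 2 ≤ 2 * ∑ j ∈ Finset.range (n + 1), Q j := by
  induction n with
  | zero => simp; nlinarith [hQ0 0]
  | succ n ih =>
    rw [Finset.sum_range_succ]
    rcases le_total (Q (n + 1)) (Q n) with h | h
    · nlinarith [hQ0 n, hQ0 (n + 1)]
    · nlinarith [hQ0 n, hQ0 (n + 1), hQs n]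

/-- The normalisation `1 + ∑ j ≤ n, (1 + Q j)` used for sums weighted by `Q`. -/
noncomputable def weight (Q : ℕ → ℝ) (n : ℕ) : ℝ := 1 + ∑ j ∈ Finset.range (n + 1), (1 + Q j)

theorem weight_pos {Q : ℕ → ℝ} (hQ0 : ∀ n, 0 ≤ Q n) (n : ℕ) : 0 < weight Q n := by
  have : 0 ≤ ∑ j ∈ Finset.range (n + 1), (1 + Q j) :=
    Finset.sum_nonneg fun j _ => add_nonneg zero_le_one (hQ0 j)
  unfold weight; linarith

theorem weight_succ (Q : ℕ → ℝ) (n : ℕ) : weight Q (n + 1) = weight Q n + (1 + Q (n + 1)) := by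
  simp only [weight, Finset.sum_range_succ _ (n + 1)]; ring

theorem weight_mono {Q : ℕ → ℝ} (hQ0 : ∀ n, 0 ≤ Q n) : Monotone (weight Q) :=
  monotone_nat_of_le_succ fun n => by rw [weight_succ]; linarith [hQ0 (n + 1)]

theorem weight_eq (Q : ℕ → ℝ) (n : ℕ) :
    weight Q n = (n + 2) + ∑ j ∈ Finset.range (n + 1), Q j := by
  simp only [weight, Finset.sum_add_distrib, Finset.sum_const, Finset.card_range]
  simp; ring

theorem le_weight {Q : ℕ → ℝ} (hQ0 : ∀ n, 0 ≤ Q n) (n : ℕ) : (n : ℝ) + 2 ≤ weight Q n := by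
  rw [weight_eq]
  linarith [Finset.sum_nonneg (s := Finset.range (n + 1)) fun j _ => hQ0 j]

theorem le_weight' {Q : ℕ → ℝ} (hQ0 : ∀ n, 0 ≤ Q n) (n : ℕ) : Q n ≤ weight Q n := by
  rw [weight_eq]
  have := Finset.single_le_sum (f := Q) (fun j _ => hQ0 j) (Finset.self_mem_range_succ n)
  linarith [(Nat.cast_nonneg n : (0 : ℝ) ≤ n)]

theorem tendsto_weight {Q : ℕ → ℝ} (hQ0 : ∀ n, 0 ≤ Q n) : Tendsto (weight Q) atTop atTop :=
  tendsto_atTop_mono (fun n => (by linarith [le_weight hQ0 n] : (n : ℝ) ≤ weight Q n))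
    tendsto_natCast_atTop_atTop

/-- The squares of `Q n / weight Q n` have a sum bounded independently of `Q`: as `Q n` is of the
order of the square root of the weight, they are bounded by increments of `(weight Q)⁻¹ᐟ²`. -/
theorem tsum_sq_div_weight_le {Q : ℕ → ℝ} (hQ0 : ∀ n, 0 ≤ Q n) (hQ1 : Q 0 ≤ 1)
    (hQs : ∀ n, Q (n + 1) ≤ Q n + 1) :
    ∑' n, ENNReal.ofReal ((Q n / weight Q n) ^ 2) ≤ 4 := by
  have hw := weight_pos hQ0
  -- consecutive values `x ≤ y` of the weight
  have step : ∀ q x y : ℝ, 0 < x → 0 ≤ q → y = x + (1 + q) → q ^ 2 ≤ 2 * y →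
      (q / y) ^ 2 ≤ 4 * (1 / √x - 1 / √y) := by
    intro q x y hx hq hy hq2
    have hypos : 0 < y := by linarith
    have ha : 0 < √x := Real.sqrt_pos.2 hx
    have hb : 0 < √y := Real.sqrt_pos.2 hypos
    have hab : √x ≤ √y := Real.sqrt_le_sqrt (by linarith)
    have hxa : x = √x ^ 2 := (Real.sq_sqrt hx.le).symm
    have hyb : y = √y ^ 2 := (Real.sq_sqrt hypos.le).symm
    set a := √x
    set b := √y
    have hqb : q ≤ 2 * b := by
      refine abs_le_of_sq_le_sq' ?_ (by positivity) |>.2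
      nlinarith
    have hqab : q ≤ b ^ 2 - a ^ 2 := by rw [← hyb, ← hxa]; linarith
    have e : 4 * (1 / a - 1 / b) - (q / y) ^ 2 =
        (4 * (b - a) * b ^ 3 - q ^ 2 * a) / (a * b ^ 4) := by
      rw [hyb]; field_simp
    have hnum : 0 ≤ 4 * (b - a) * b ^ 3 - q ^ 2 * a := by
      have h1 : q ^ 2 ≤ 2 * b * (b ^ 2 - a ^ 2) := by
        rw [sq]; exact mul_le_mul hqb hqab hq (by positivity)
      have h2 : q ^ 2 * a ≤ 2 * b * (b ^ 2 - a ^ 2) * a := mul_le_mul_of_nonneg_right h1 ha.le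
      have h3 : 2 * b * (b ^ 2 - a ^ 2) * a ≤ 4 * (b - a) * b ^ 3 := by
        have : 0 ≤ (b - a) * b * (2 * b ^ 2 - (b + a) * a) := by
          refine mul_nonneg (mul_nonneg (sub_nonneg.2 hab) hb.le) ?_
          nlinarith
        nlinarith
      linarith
    have : 0 ≤ (4 * (b - a) * b ^ 3 - q ^ 2 * a) / (a * b ^ 4) := by positivity
    linarith
  have hq2 : ∀ n, Q n ^ 2 ≤ 2 * weight Q n := by
    intro n
    have := sq_le_two_mul_sum hQ0 hQ1 hQs n
    rw [weight_eq]; linarith [(Nat.cast_nonneg n : (0 : ℝ) ≤ n)]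
  have hpart : ∀ n, ∑ j ∈ Finset.range (n + 1), (Q j / weight Q j) ^ 2 ≤
      4 * (1 - 1 / √(weight Q n)) := by
    intro n
    induction n with
    | zero =>
      have := step (Q 0) 1 (weight Q 0) one_pos (hQ0 0) (by simp [weight]) (hq2 0)
      simpa using this
    | succ n ih =>
      rw [Finset.sum_range_succ]
      have := step (Q (n + 1)) (weight Q n) (weight Q (n + 1)) (hw n) (hQ0 _)
        (weight_succ Q n) (hq2 _)
      linarith
  refine ENNReal.tsum_le_of_sum_range_le fun n => ?_
  rw [← ENNReal.ofReal_sum_of_nonneg fun _ _ => sq_nonneg _,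
    show (4 : ENNReal) = ENNReal.ofReal 4 by simp]
  refine ENNReal.ofReal_le_ofReal ?_
  calc _ ≤ ∑ j ∈ Finset.range (n + 1), (Q j / weight Q j) ^ 2 := by
        rw [Finset.sum_range_succ]; linarith [sq_nonneg (Q n / weight Q n)]
    _ ≤ 4 * (1 - 1 / √(weight Q n)) := hpart n
    _ ≤ 4 := by
        have : 0 ≤ 1 / √(weight Q n) := by positivity
        linarith

end Deterministic

/-! ### The clock of the ordinary stream and delivery times -/

section Clock

variable {x₁ s₁ x₂ s₂ : ℕ → ℝ}

theorem genTime_succ (x : ℕ → ℝ) (n : ℕ) : genTime x (n + 1) = genTime x n + x (n + 1) :=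
  Finset.sum_range_succ _ _

theorem genTime_zero (x : ℕ → ℝ) : genTime x 0 = x 0 := by simp [genTime]

theorem genTime_strictMono {x : ℕ → ℝ} (hx : ∀ n, 0 < x n) : StrictMono (genTime x) :=
  strictMono_nat_of_lt_succ fun n => by rw [genTime_succ]; linarith [hx (n + 1)]

theorem genTime_pos {x : ℕ → ℝ} (hx : ∀ n, 0 < x n) (n : ℕ) : 0 < genTime x n :=
  Finset.sum_pos (fun i _ => hx i) ⟨0, by simp⟩

/-- The time for which priority packet `k` actually occupies the server, until it is completed or
discarded. -/
noncomputable def occupation (x₂ s₂ : ℕ → ℝ) (k : ℕ) : ℝ := min (s₂ k) (x₂ (k + 1))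

theorem priorityBusy_eq (x₂ s₂ : ℕ → ℝ) :
    priorityBusy x₂ s₂ = ⋃ k, Set.Ico (genTime x₂ k) (genTime x₂ k + occupation x₂ s₂ k) := by
  ext t
  simp only [priorityBusy, occupation, Set.mem_ofPred_eq, Set.mem_iUnion, Set.mem_Ico, genTime_succ]
  refine exists_congr fun k => and_congr_right fun _ => ?_
  rw [← lt_min_iff, min_add_add_left]

theorem measurableSet_priorityBusy (x₂ s₂ : ℕ → ℝ) : MeasurableSet (priorityBusy x₂ s₂) := by
  rw [priorityBusy_eq]; exact MeasurableSet.iUnion fun _ => measurableSet_Ico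

/-- The clock that runs only while the server is free of priority packets. -/
noncomputable def clock (x₂ s₂ : ℕ → ℝ) (t : ℝ) : ℝ := availableTime x₂ s₂ 0 t

theorem clock_add_availableTime {a b : ℝ} (ha : 0 ≤ a) (hab : a ≤ b) :
    clock x₂ s₂ a + availableTime x₂ s₂ a b = clock x₂ s₂ b := by
  have hB := measurableSet_priorityBusy x₂ s₂
  have h1 : (Set.Icc 0 b \ priorityBusy x₂ s₂ : Set ℝ) =
      (Set.Icc 0 a \ priorityBusy x₂ s₂) ∪ (Set.Ioc a b \ priorityBusy x₂ s₂) := by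
    rw [← Set.union_sdiff_distrib, Set.Icc_union_Ioc_eq_Icc ha hab]
  have h2 : Disjoint (Set.Icc 0 a \ priorityBusy x₂ s₂) (Set.Ioc a b \ priorityBusy x₂ s₂) := by
    rw [Set.disjoint_left]
    rintro t ⟨⟨-, h⟩, -⟩ ⟨⟨h', -⟩, -⟩
    linarith
  have h3 : volume.real (Set.Icc a b \ priorityBusy x₂ s₂) =
      volume.real (Set.Ioc a b \ priorityBusy x₂ s₂) :=
    measureReal_congr ((Ioc_ae_eq_Icc (a := a) (b := b)).symm.diff (ae_eq_refl _))
  unfold clock availableTime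
  rw [h1, h3, measureReal_union h2 (measurableSet_Ioc.diff hB)
    (measure_ne_top_of_subset Set.sdiff_subset (by simp))
    (measure_ne_top_of_subset Set.sdiff_subset (by simp))]

theorem availableTime_nonneg (a b : ℝ) : 0 ≤ availableTime x₂ s₂ a b := measureReal_nonneg

theorem availableTime_le {a b : ℝ} (hab : a ≤ b) : availableTime x₂ s₂ a b ≤ b - a := by
  unfold availableTime
  calc volume.real (Set.Icc a b \ priorityBusy x₂ s₂) ≤ volume.real (Set.Icc a b) :=
        measureReal_mono Set.sdiff_subset (by simp)
    _ = b - a := by simp [hab]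

theorem clock_nonneg (t : ℝ) : 0 ≤ clock x₂ s₂ t := availableTime_nonneg 0 t

theorem clock_of_nonpos {t : ℝ} (ht : t ≤ 0) : clock x₂ s₂ t = 0 := by
  refine le_antisymm ?_ (clock_nonneg t)
  unfold clock availableTime
  have : Set.Icc 0 t ⊆ {0} := fun u hu => le_antisymm (hu.2.trans ht) hu.1
  calc _ ≤ volume.real ({0} : Set ℝ) := measureReal_mono (Set.sdiff_subset.trans this) (by simp)
    _ = 0 := by simp [measureReal_def]

theorem clock_mono : Monotone (clock x₂ s₂) := by
  intro a b hab
  rcases le_total 0 a with ha | ha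
  · rw [← clock_add_availableTime ha hab]; linarith [availableTime_nonneg (x₂ := x₂) (s₂ := s₂) a b]
  · rw [clock_of_nonpos ha]; exact clock_nonneg b

theorem clock_sub_le {a b : ℝ} (hab : a ≤ b) : clock x₂ s₂ b - clock x₂ s₂ a ≤ b - a := by
  rcases le_total 0 a with ha | ha
  · rw [← clock_add_availableTime ha hab]
    linarith [availableTime_le (x₂ := x₂) (s₂ := s₂) hab]
  · rw [clock_of_nonpos ha]
    rcases le_total 0 b with hb | hb
    · have := availableTime_le (x₂ := x₂) (s₂ := s₂) hb
      unfold clock; linarith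
    · rw [clock_of_nonpos hb]; linarith

theorem continuous_clock : Continuous (clock x₂ s₂) := by
  have : LipschitzWith 1 (clock x₂ s₂) := by
    refine LipschitzWith.of_le_add_mul 1 fun a b => ?_
    rw [NNReal.coe_one, one_mul, Real.dist_eq]
    rcases le_total a b with h | h
    · linarith [clock_mono (x₂ := x₂) (s₂ := s₂) h, abs_nonneg (a - b)]
    · linarith [clock_sub_le (x₂ := x₂) (s₂ := s₂) h, le_abs_self (a - b)]
  exact this.continuous

theorem occupation_pos (hx₂ : ∀ n, 0 < x₂ n) (hs₂ : ∀ n, 0 < s₂ n) (k : ℕ) :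
    0 < occupation x₂ s₂ k := lt_min (hs₂ k) (hx₂ (k + 1))

theorem genTime_add_occupation_le (x₂ s₂ : ℕ → ℝ) (k : ℕ) :
    genTime x₂ k + occupation x₂ s₂ k ≤ genTime x₂ (k + 1) := by
  rw [genTime_succ]; exact add_le_add_right (min_le_right _ _) _

/-- The clock stands still while a priority packet is in service. -/
theorem clock_eq_of_mem_occupied {k : ℕ} {s t : ℝ} (hs0 : 0 ≤ s)
    (hs : genTime x₂ k ≤ s) (hst : s ≤ t) (ht : t ≤ genTime x₂ k + occupation x₂ s₂ k) :
    clock x₂ s₂ t = clock x₂ s₂ s := by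
  rw [← clock_add_availableTime hs0 hst]
  have : Set.Icc s t \ priorityBusy x₂ s₂ ⊆ {t} := by
    rintro u ⟨hu, hub⟩
    by_contra hne
    have hut : u < t := lt_of_le_of_ne hu.2 hne
    exact hub (by
      rw [priorityBusy_eq]
      exact Set.mem_iUnion.2 ⟨k, hs.trans hu.1, hut.trans_le ht⟩)
  have h0 : availableTime x₂ s₂ s t ≤ 0 := by
    calc _ ≤ volume.real ({t} : Set ℝ) := measureReal_mono this (by simp)
      _ = 0 := by simp [measureReal_def]
  linarith [availableTime_nonneg (x₂ := x₂) (s₂ := s₂) s t]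

/-- The part of `[0, t]` taken by the priority stream, packet by packet. -/
theorem clock_eq_sub_sum (hx₂ : ∀ n, 0 < x₂ n) (hs₂ : ∀ n, 0 < s₂ n) {t : ℝ} (ht : 0 ≤ t) {K : ℕ}
    (hK : t ≤ genTime x₂ K) :
    clock x₂ s₂ t = t - ∑ k ∈ Finset.range K,
      (min (genTime x₂ k + occupation x₂ s₂ k) t - min (genTime x₂ k) t) := by
  have hmono := (genTime_strictMono hx₂).monotone
  have hocc := occupation_pos hx₂ hs₂
  have h1 : clock x₂ s₂ t = volume.real (Set.Ico 0 t \ priorityBusy x₂ s₂) :=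
    measureReal_congr ((Ico_ae_eq_Icc (a := (0 : ℝ)) (b := t)).symm.diff (ae_eq_refl _))
  have h2 := measureReal_sdiff_add_inter (μ := volume) (s := Set.Ico 0 t)
    (measurableSet_priorityBusy x₂ s₂) (by simp)
  have h3 : Set.Ico 0 t ∩ priorityBusy x₂ s₂ = ⋃ k ∈ Finset.range K,
      Set.Ico (min (genTime x₂ k) t) (min (genTime x₂ k + occupation x₂ s₂ k) t) := by
    ext u
    simp only [priorityBusy_eq, Set.mem_inter_iff, Set.mem_Ico, Set.mem_iUnion, Finset.mem_range,
      min_le_iff, lt_min_iff, exists_prop]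
    constructor
    · rintro ⟨⟨h0, hut⟩, k, hk1, hk2⟩
      refine ⟨k, ?_, Or.inl hk1, hk2, hut⟩
      by_contra! hKk
      have := hmono hKk
      linarith
    · rintro ⟨k, -, h | h, hk2, hut⟩
      · exact ⟨⟨(genTime_pos hx₂ k).le.trans h, hut⟩, k, h, hk2⟩
      · linarith
  have h4 : volume.real (⋃ k ∈ Finset.range K,
      Set.Ico (min (genTime x₂ k) t) (min (genTime x₂ k + occupation x₂ s₂ k) t)) =
      ∑ k ∈ Finset.range K, volume.real
        (Set.Ico (min (genTime x₂ k) t) (min (genTime x₂ k + occupation x₂ s₂ k) t)) := by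
    refine measureReal_biUnion_finset ?_ (fun k _ => measurableSet_Ico) (fun k _ => by simp)
    intro i _ j _ hij
    have key : ∀ i j, i < j → Disjoint
        (Set.Ico (min (genTime x₂ i) t) (min (genTime x₂ i + occupation x₂ s₂ i) t))
        (Set.Ico (min (genTime x₂ j) t) (min (genTime x₂ j + occupation x₂ s₂ j) t)) := by
      intro i j hij
      rw [Set.Ico_disjoint_Ico]
      refine (min_le_left _ _).trans (le_trans ?_ (le_max_right _ _))
      exact min_le_min_right t ((genTime_add_occupation_le x₂ s₂ i).trans (hmono hij))
    rcases lt_or_gt_of_ne hij with h | h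
    · exact key i j h
    · exact (key j i h).symm
  have h5 : ∀ k, volume.real
        (Set.Ico (min (genTime x₂ k) t) (min (genTime x₂ k + occupation x₂ s₂ k) t)) =
      min (genTime x₂ k + occupation x₂ s₂ k) t - min (genTime x₂ k) t := by
    intro k
    rw [Real.volume_real_Ico_of_le]
    exact min_le_min_right t (by linarith [hocc k])
  rw [h3, h4] at h2
  simp_rw [h5] at h2
  rw [Real.volume_real_Ico_of_le ht, ← h1] at h2
  linarith

theorem clock_genTime (hx₂ : ∀ n, 0 < x₂ n) (hs₂ : ∀ n, 0 < s₂ n) (K : ℕ) :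
    clock x₂ s₂ (genTime x₂ K) = genTime x₂ K - ∑ k ∈ Finset.range K, occupation x₂ s₂ k := by
  rw [clock_eq_sub_sum hx₂ hs₂ (genTime_pos hx₂ K).le le_rfl]
  congr 1
  refine Finset.sum_congr rfl fun k hk => ?_
  have h1 := genTime_add_occupation_le x₂ s₂ k
  have h2 := (genTime_strictMono hx₂).monotone (Finset.mem_range.1 hk : k + 1 ≤ K)
  have h3 := occupation_pos hx₂ hs₂ k
  rw [min_eq_left (by linarith), min_eq_left (by linarith)]
  ring

end Clock

section Delivery

variable {x₁ s₁ x₂ s₂ : ℕ → ℝ}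

/-- The reading of the clock at which ordinary packet `n` is delivered, given by Lindley's recursion on
the axis of the clock. -/
noncomputable def deliveryLevel (x₁ s₁ x₂ s₂ : ℕ → ℝ) : ℕ → ℝ
  | 0 => clock x₂ s₂ (genTime x₁ 0) + s₁ 0
  | n + 1 => max (deliveryLevel x₁ s₁ x₂ s₂ n) (clock x₂ s₂ (genTime x₁ (n + 1))) + s₁ (n + 1)

/-- The regularity of the input sequences that holds almost surely: all entries are positive, both
streams have infinitely many packets, but only finitely many in bounded time, and the server is
free of priority packets for an infinite time. -/
structure Regular (x₁ s₁ x₂ s₂ : ℕ → ℝ) : Prop where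
  x₁_pos : ∀ n, 0 < x₁ n
  s₁_pos : ∀ n, 0 < s₁ n
  x₂_pos : ∀ n, 0 < x₂ n
  s₂_pos : ∀ n, 0 < s₂ n
  tendsto_genTime₁ : Tendsto (genTime x₁) atTop atTop
  tendsto_genTime₂ : Tendsto (genTime x₂) atTop atTop
  tendsto_clock : Tendsto (clock x₂ s₂) atTop atTop

theorem clock_genTime_lt_deliveryLevel (hs₁ : ∀ n, 0 < s₁ n) (n : ℕ) :
    clock x₂ s₂ (genTime x₁ n) < deliveryLevel x₁ s₁ x₂ s₂ n := by
  cases n with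
  | zero => simp only [deliveryLevel]; linarith [hs₁ 0]
  | succ n =>
    simp only [deliveryLevel]
    linarith [hs₁ (n + 1), le_max_right (deliveryLevel x₁ s₁ x₂ s₂ n)
      (clock x₂ s₂ (genTime x₁ (n + 1)))]

theorem deliveryLevel_strictMono (hs₁ : ∀ n, 0 < s₁ n) :
    StrictMono (deliveryLevel x₁ s₁ x₂ s₂) := by
  refine strictMono_nat_of_lt_succ fun n => ?_
  simp only [deliveryLevel]
  linarith [hs₁ (n + 1), le_max_left (deliveryLevel x₁ s₁ x₂ s₂ n)
      (clock x₂ s₂ (genTime x₁ (n + 1)))]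

theorem completionTime_spec (hclock : Tendsto (clock x₂ s₂) atTop atTop) {a s : ℝ} (ha : 0 ≤ a)
    (hs : 0 < s) :
    a ≤ completionTime x₂ s₂ a s ∧
    clock x₂ s₂ (completionTime x₂ s₂ a s) = clock x₂ s₂ a + s ∧
    ∀ t, completionTime x₂ s₂ a s ≤ t ↔ clock x₂ s₂ a + s ≤ clock x₂ s₂ t := by
  have hset : {d : ℝ | a ≤ d ∧ s ≤ availableTime x₂ s₂ a d} =
      {d : ℝ | clock x₂ s₂ a + s ≤ clock x₂ s₂ d} := by
    ext d
    simp only [Set.mem_ofPred_eq]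
    constructor
    · rintro ⟨h1, h2⟩
      rw [← clock_add_availableTime ha h1]; linarith
    · intro h
      have had : a ≤ d := by
        by_contra! h'
        linarith [clock_mono (x₂ := x₂) (s₂ := s₂) h'.le]
      refine ⟨had, ?_⟩
      rw [← clock_add_availableTime ha had] at h; linarith
  have hbdd : BddBelow {d : ℝ | clock x₂ s₂ a + s ≤ clock x₂ s₂ d} := by
    refine ⟨a, fun d hd => ?_⟩
    rw [← hset] at hd; exact hd.1
  have hne : {d : ℝ | clock x₂ s₂ a + s ≤ clock x₂ s₂ d}.Nonempty :=
    (hclock.eventually_ge_atTop _).exists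
  have hcl : IsClosed {d : ℝ | clock x₂ s₂ a + s ≤ clock x₂ s₂ d} :=
    isClosed_le continuous_const continuous_clock
  have hmem := hcl.csInf_mem hne hbdd
  have hdef : completionTime x₂ s₂ a s = sInf {d : ℝ | clock x₂ s₂ a + s ≤ clock x₂ s₂ d} := by
    rw [completionTime, hset]
  rw [← hdef] at hmem
  have hle : ∀ d, clock x₂ s₂ a + s ≤ clock x₂ s₂ d → completionTime x₂ s₂ a s ≤ d := by
    intro d hd
    rw [hdef]; exact csInf_le hbdd hd
  have haD : a ≤ completionTime x₂ s₂ a s := by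
    have := hmem
    rw [← hset] at this; exact this.1
  refine ⟨haD, le_antisymm ?_ hmem, fun t => ⟨fun h => ?_, hle t⟩⟩
  · obtain ⟨d, -, hd⟩ := intermediate_value_Icc haD continuous_clock.continuousOn
      (⟨by linarith, hmem⟩ : clock x₂ s₂ a + s ∈ Set.Icc (clock x₂ s₂ a)
        (clock x₂ s₂ (completionTime x₂ s₂ a s)))
    rw [← hd]
    exact clock_mono (hle d hd.ge)
  · exact le_trans hmem (clock_mono h)

/-- Packet `n` is delivered once the clock has reached its delivery level. -/
theorem deliveryTime_spec (h : Regular x₁ s₁ x₂ s₂) (n : ℕ) :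
    genTime x₁ n ≤ deliveryTime x₁ s₁ x₂ s₂ n ∧
    clock x₂ s₂ (deliveryTime x₁ s₁ x₂ s₂ n) = deliveryLevel x₁ s₁ x₂ s₂ n ∧
    ∀ t, deliveryTime x₁ s₁ x₂ s₂ n ≤ t ↔ deliveryLevel x₁ s₁ x₂ s₂ n ≤ clock x₂ s₂ t := by
  induction n with
  | zero =>
    exact completionTime_spec h.tendsto_clock (genTime_pos h.x₁_pos 0).le (h.s₁_pos 0)
  | succ n ih =>
    have h0 : 0 ≤ max (deliveryTime x₁ s₁ x₂ s₂ n) (genTime x₁ (n + 1)) :=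
      (genTime_pos h.x₁_pos (n + 1)).le.trans (le_max_right _ _)
    have := completionTime_spec h.tendsto_clock h0 (h.s₁_pos (n + 1))
    rw [clock_mono.map_max, ih.2.1] at this
    exact ⟨(le_max_right _ _).trans this.1, this.2⟩

theorem deliveryTime_strictMono (h : Regular x₁ s₁ x₂ s₂) :
    StrictMono (deliveryTime x₁ s₁ x₂ s₂) := by
  intro i j hij
  by_contra! hle
  have := ((deliveryTime_spec h j).2.2 _).1 hle
  rw [(deliveryTime_spec h i).2.1] at this
  exact absurd (deliveryLevel_strictMono h.s₁_pos hij) (not_lt.2 this)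

/-- The sojourn time of packet `n`. -/
noncomputable def sojourn (x₁ s₁ x₂ s₂ : ℕ → ℝ) (n : ℕ) : ℝ :=
  deliveryTime x₁ s₁ x₂ s₂ n - genTime x₁ n

theorem sojourn_nonneg (h : Regular x₁ s₁ x₂ s₂) (n : ℕ) : 0 ≤ sojourn x₁ s₁ x₂ s₂ n :=
  sub_nonneg.2 (deliveryTime_spec h n).1

theorem peakAge_zero (h : Regular x₁ s₁ x₂ s₂) {Δ₀ : ℝ} :
    peakAge Δ₀ x₁ s₁ x₂ s₂ 0 = sojourn x₁ s₁ x₂ s₂ 0 + x₁ 0 + Δ₀ := by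
  have : {j | deliveryTime x₁ s₁ x₂ s₂ j < deliveryTime x₁ s₁ x₂ s₂ 0} = ∅ := by
    ext j; simp [(deliveryTime_strictMono h).lt_iff_lt]
  simp only [peakAge, age, lastReceivedGenTime, this, Set.image_empty, insert_empty_eq,
    csSup_singleton, sojourn, genTime_zero]
  ring

theorem peakAge_succ (h : Regular x₁ s₁ x₂ s₂) {Δ₀ : ℝ} (hΔ₀ : 0 ≤ Δ₀) (j : ℕ) :
    peakAge Δ₀ x₁ s₁ x₂ s₂ (j + 1) = sojourn x₁ s₁ x₂ s₂ (j + 1) + x₁ (j + 1) := by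
  have hset : {i | deliveryTime x₁ s₁ x₂ s₂ i < deliveryTime x₁ s₁ x₂ s₂ (j + 1)} = Set.Iic j := by
    ext i; simp [(deliveryTime_strictMono h).lt_iff_lt]
  have hgreat : IsGreatest (insert (-Δ₀) (genTime x₁ '' Set.Iic j)) (genTime x₁ j) := by
    refine ⟨Or.inr ⟨j, Set.mem_Iic.2 le_rfl, rfl⟩, ?_⟩
    rintro t (rfl | ⟨i, hi, rfl⟩)
    · linarith [genTime_pos h.x₁_pos j]
    · exact (genTime_strictMono h.x₁_pos).monotone hi
  simp only [peakAge, age, lastReceivedGenTime, hset, hgreat.csSup_eq, sojourn, genTime_succ]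
  ring

end Delivery

/-! ### Queue lengths and sojourn times path by path -/

section Counting

variable {x₁ s₁ x₂ s₂ : ℕ → ℝ}

/-- The number of ordinary packets among `0, …, n` that are not yet delivered when the clock
shows `a`. -/
noncomputable def undelivered (x₁ s₁ x₂ s₂ : ℕ → ℝ) (n : ℕ) (a : ℝ) : ℝ :=
  ∑ i ∈ Finset.range (n + 1), if a < deliveryLevel x₁ s₁ x₂ s₂ i then 1 else 0

/-- The left-continuous version of `undelivered`: at its own delivery a packet still counts, as it must
for a departing packet to sample the queue that precedes its departure. -/
noncomputable def undeliveredLeft (x₁ s₁ x₂ s₂ : ℕ → ℝ) (n : ℕ) (a : ℝ) : ℝ :=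
  ∑ i ∈ Finset.range (n + 1), if a ≤ deliveryLevel x₁ s₁ x₂ s₂ i then 1 else 0

/-- The number of ordinary packets in the system just after the arrival of packet `n`. -/
noncomputable def queue (x₁ s₁ x₂ s₂ : ℕ → ℝ) (n : ℕ) : ℝ :=
  undelivered x₁ s₁ x₂ s₂ n (clock x₂ s₂ (genTime x₁ n))

theorem undelivered_nonneg (n : ℕ) (a : ℝ) : 0 ≤ undelivered x₁ s₁ x₂ s₂ n a :=
  Finset.sum_nonneg fun i _ => by split_ifs <;> norm_num

theorem undeliveredLeft_nonneg (n : ℕ) (a : ℝ) : 0 ≤ undeliveredLeft x₁ s₁ x₂ s₂ n a :=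
  Finset.sum_nonneg fun i _ => by split_ifs <;> norm_num

theorem undelivered_anti (n : ℕ) : Antitone (undelivered x₁ s₁ x₂ s₂ n) := by
  intro a b hab
  refine Finset.sum_le_sum fun i _ => ?_
  split_ifs with h1 h2
  · exact le_rfl
  · exact absurd (hab.trans_lt h1) h2
  · norm_num
  · exact le_rfl

theorem undeliveredLeft_le {n : ℕ} {a b : ℝ} (hab : a < b) :
    undeliveredLeft x₁ s₁ x₂ s₂ n b ≤ undelivered x₁ s₁ x₂ s₂ n a := by
  refine Finset.sum_le_sum fun i _ => ?_
  split_ifs with h1 h2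
  · exact le_rfl
  · exact absurd (hab.trans_le h1) h2
  · norm_num
  · exact le_rfl

theorem queue_nonneg (n : ℕ) : 0 ≤ queue x₁ s₁ x₂ s₂ n := undelivered_nonneg n _

theorem queue_zero (hs₁ : ∀ n, 0 < s₁ n) : queue x₁ s₁ x₂ s₂ 0 = 1 := by
  rw [queue, undelivered, Finset.sum_range_one, if_pos (clock_genTime_lt_deliveryLevel hs₁ 0)]

theorem queue_succ (hs₁ : ∀ n, 0 < s₁ n) (n : ℕ) : queue x₁ s₁ x₂ s₂ (n + 1) =
    undelivered x₁ s₁ x₂ s₂ n (clock x₂ s₂ (genTime x₁ (n + 1))) + 1 := by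
  rw [queue, undelivered, Finset.sum_range_succ, if_pos (clock_genTime_lt_deliveryLevel hs₁ _)]
  rfl

theorem queue_succ_le (hx₁ : ∀ n, 0 < x₁ n) (hs₁ : ∀ n, 0 < s₁ n) (n : ℕ) :
    queue x₁ s₁ x₂ s₂ (n + 1) ≤ queue x₁ s₁ x₂ s₂ n + 1 := by
  rw [queue_succ hs₁]
  have := undelivered_anti (x₁ := x₁) (s₁ := s₁) (x₂ := x₂) (s₂ := s₂) n
    (clock_mono (x₂ := x₂) (s₂ := s₂) ((genTime_strictMono hx₁).monotone n.le_succ))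
  unfold queue; linarith

end Counting

section Sums

/-- Packets `i` enter at `g i` and leave at `e i ≥ g i`: summing over the intervals between entrances
the time spent by the packets present gives the total time spent by the packets, cut at the last
entrance. -/
theorem sum_sum_min_sub_min {g e : ℕ → ℝ} (hge : ∀ i, g i ≤ e i) (N : ℕ) :
    ∑ n ∈ Finset.range N, ∑ i ∈ Finset.range (n + 1), (min (e i) (g (n + 1)) - min (e i) (g n)) =
      ∑ i ∈ Finset.range N, (min (e i) (g N) - g i) := by
  induction N with
  | zero => simp
  | succ N ih =>
    rw [Finset.sum_range_succ, ih, Finset.sum_range_succ, Finset.sum_range_succ,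
      min_eq_right (hge N), ← add_assoc, ← Finset.sum_add_distrib]
    congr 1
    exact Finset.sum_congr rfl fun i _ => by ring

theorem sum_sum_Ico_comm {c : ℕ → ℕ} (hc : Monotone c) (F : ℕ → ℕ → ℝ) (N : ℕ) :
    ∑ n ∈ Finset.range N, ∑ k ∈ Finset.Ico (c n) (c (n + 1)), ∑ i ∈ Finset.range (n + 1), F i k =
      ∑ i ∈ Finset.range N, ∑ k ∈ Finset.Ico (c i) (c N), F i k := by
  induction N with
  | zero => simp
  | succ N ih =>
    rw [Finset.sum_range_succ, ih, Finset.sum_comm (s := Finset.Ico _ _), Finset.sum_range_succ,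
      Finset.sum_range_succ, ← add_assoc, ← Finset.sum_add_distrib]
    congr 1
    refine Finset.sum_congr rfl fun i hi => ?_
    rw [Finset.sum_Ico_consecutive _ (hc (Finset.mem_range.1 hi).le) (hc N.le_succ)]

theorem setIntegral_indicator_lt_eq {a b e : ℝ} (hab : a ≤ b) :
    ∫ t in Set.Ioc a b, (if t < e then (1 : ℝ) else 0) = min e b - min e a := by
  have h1 : (fun t : ℝ => if t < e then (1 : ℝ) else 0) = (Set.Iio e).indicator 1 := by
    ext t; simp [Set.indicator]
  rw [h1, setIntegral_indicator measurableSet_Iio]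
  have h2 : (Set.Ioc a b ∩ Set.Iio e : Set ℝ) =ᵐ[volume] (Set.Ioc (min e a) (min e b) : Set ℝ) := by
    have h3 : (Set.Iio e : Set ℝ) =ᵐ[volume] Set.Iic e := Iio_ae_eq_Iic
    have h4 : Set.Ioc a b ∩ Set.Iic e = Set.Ioc (min e a) (min e b) := ?_
    · rw [← h4]; exact (ae_eq_refl _).inter h3
    ext t
    simp only [Set.mem_inter_iff, Set.mem_Ioc, Set.mem_Iic, min_lt_iff, le_min_iff]
    constructor
    · rintro ⟨⟨h1, h2⟩, h3⟩; exact ⟨Or.inr h1, h3, h2⟩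
    · rintro ⟨h1 | h1, h2, h3⟩
      · linarith
      · exact ⟨⟨h1, h3⟩, h2⟩
  rw [Measure.restrict_congr_set h2]
  simp [min_le_min_left e hab]

theorem setIntegral_indicator_le_eq {a b e : ℝ} (hab : a ≤ b) :
    ∫ t in Set.Ioc a b, (if t ≤ e then (1 : ℝ) else 0) = min e b - min e a := by
  rw [← setIntegral_indicator_lt_eq hab]
  refine integral_congr_ae (ae_restrict_of_ae ?_)
  have : ∀ᵐ t : ℝ, t ≠ e := by simp [ae_iff]
  filter_upwards [this] with t ht
  simp only [le_iff_lt_or_eq, ht, or_false]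

end Sums

section Accounting

variable {x₁ s₁ x₂ s₂ : ℕ → ℝ}

theorem integrableOn_ite_lt (a b e : ℝ) :
    IntegrableOn (fun t : ℝ => if t < e then (1 : ℝ) else 0) (Set.Ioc a b) := by
  refine Measure.integrableOn_of_bounded (M := 1) (by simp)
    (Measurable.ite measurableSet_Iio measurable_const measurable_const).aestronglyMeasurable ?_
  exact ae_of_all _ fun t => by split_ifs <;> simp

theorem integrableOn_ite_le (a b e : ℝ) :
    IntegrableOn (fun t : ℝ => if t ≤ e then (1 : ℝ) else 0) (Set.Ioc a b) := by
  refine Measure.integrableOn_of_bounded (M := 1) (by simp)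
    (Measurable.ite measurableSet_Iic measurable_const measurable_const).aestronglyMeasurable ?_
  exact ae_of_all _ fun t => by split_ifs <;> simp

theorem clock_lt_deliveryLevel_iff (h : Regular x₁ s₁ x₂ s₂) (i : ℕ) (t : ℝ) :
    clock x₂ s₂ t < deliveryLevel x₁ s₁ x₂ s₂ i ↔ t < deliveryTime x₁ s₁ x₂ s₂ i := by
  rw [← not_le, ← not_le, (deliveryTime_spec h i).2.2]

/-- The queue length integrated between two ordinary arrivals. -/
noncomputable def queueArea (x₁ s₁ x₂ s₂ : ℕ → ℝ) (n : ℕ) : ℝ :=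
  ∫ t in Set.Ioc (genTime x₁ n) (genTime x₁ (n + 1)), undelivered x₁ s₁ x₂ s₂ n (clock x₂ s₂ t)

/-- The queue length integrated between two ordinary arrivals against the clock. -/
noncomputable def queueWork (x₁ s₁ x₂ s₂ : ℕ → ℝ) (n : ℕ) : ℝ :=
  ∫ a in Set.Ioc (clock x₂ s₂ (genTime x₁ n)) (clock x₂ s₂ (genTime x₁ (n + 1))),
    undeliveredLeft x₁ s₁ x₂ s₂ n a

theorem queueArea_eq (h : Regular x₁ s₁ x₂ s₂) (n : ℕ) :
    queueArea x₁ s₁ x₂ s₂ n = ∑ i ∈ Finset.range (n + 1),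
      (min (deliveryTime x₁ s₁ x₂ s₂ i) (genTime x₁ (n + 1)) -
        min (deliveryTime x₁ s₁ x₂ s₂ i) (genTime x₁ n)) := by
  simp only [queueArea, undelivered, clock_lt_deliveryLevel_iff h]
  rw [integral_finsetSum _ fun i _ => integrableOn_ite_lt _ _ _]
  exact Finset.sum_congr rfl fun i _ =>
    setIntegral_indicator_lt_eq ((genTime_strictMono h.x₁_pos).monotone n.le_succ)

theorem queueWork_eq (hx₁ : ∀ n, 0 < x₁ n) (n : ℕ) :
    queueWork x₁ s₁ x₂ s₂ n = ∑ i ∈ Finset.range (n + 1),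
      (min (deliveryLevel x₁ s₁ x₂ s₂ i) (clock x₂ s₂ (genTime x₁ (n + 1))) -
        min (deliveryLevel x₁ s₁ x₂ s₂ i) (clock x₂ s₂ (genTime x₁ n))) := by
  simp only [queueWork, undeliveredLeft]
  rw [integral_finsetSum _ fun i _ => integrableOn_ite_le _ _ _]
  exact Finset.sum_congr rfl fun i _ =>
    setIntegral_indicator_le_eq (clock_mono ((genTime_strictMono hx₁).monotone n.le_succ))

/-- Ordinary packet `N` finds no other ordinary packet in the system. -/
def FindsEmpty (x₁ s₁ x₂ s₂ : ℕ → ℝ) (N : ℕ) : Prop :=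
  ∀ i < N, deliveryLevel x₁ s₁ x₂ s₂ i ≤ clock x₂ s₂ (genTime x₁ N)

theorem sum_queueArea (h : Regular x₁ s₁ x₂ s₂) {N : ℕ} (hN : FindsEmpty x₁ s₁ x₂ s₂ N) :
    ∑ n ∈ Finset.range N, queueArea x₁ s₁ x₂ s₂ n =
      ∑ i ∈ Finset.range N, sojourn x₁ s₁ x₂ s₂ i := by
  simp_rw [queueArea_eq h]
  rw [sum_sum_min_sub_min fun i => (deliveryTime_spec h i).1]
  refine Finset.sum_congr rfl fun i hi => ?_
  rw [min_eq_left, sojourn]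
  exact ((deliveryTime_spec h i).2.2 _).2 (hN i (Finset.mem_range.1 hi))

theorem sum_queueWork (hx₁ : ∀ n, 0 < x₁ n) (hs₁ : ∀ n, 0 < s₁ n) {N : ℕ}
    (hN : FindsEmpty x₁ s₁ x₂ s₂ N) :
    ∑ n ∈ Finset.range N, queueWork x₁ s₁ x₂ s₂ n = ∑ i ∈ Finset.range N,
      (deliveryLevel x₁ s₁ x₂ s₂ i - clock x₂ s₂ (genTime x₁ i)) := by
  simp_rw [queueWork_eq hx₁]
  rw [sum_sum_min_sub_min (g := fun n => clock x₂ s₂ (genTime x₁ n))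
    fun i => (clock_genTime_lt_deliveryLevel hs₁ i).le]
  refine Finset.sum_congr rfl fun i hi => ?_
  rw [min_eq_left (hN i (Finset.mem_range.1 hi))]

/-- The time until the priority packet in service leaves the server, zero if there is none. At the
instant of its generation a priority packet is in service. -/
noncomputable def residual (x₂ s₂ : ℕ → ℝ) (t : ℝ) : ℝ :=
  ∑' k, (Set.Ico (genTime x₂ k) (genTime x₂ (k + 1))).indicator
    (fun t => max (genTime x₂ k + occupation x₂ s₂ k - t) 0) t

theorem residual_eq (hx₂ : ∀ n, 0 < x₂ n) {k : ℕ} {t : ℝ}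
    (ht : t ∈ Set.Ico (genTime x₂ k) (genTime x₂ (k + 1))) :
    residual x₂ s₂ t = max (genTime x₂ k + occupation x₂ s₂ k - t) 0 := by
  rw [residual, tsum_eq_single k, Set.indicator_of_mem ht]
  intro j hj
  refine Set.indicator_of_notMem (fun hj' => ?_) _
  have hmono := (genTime_strictMono hx₂).monotone
  rcases lt_or_gt_of_ne hj with h | h
  · have := hmono (show j + 1 ≤ k from h)
    linarith [hj'.2, ht.1]
  · have := hmono (show k + 1 ≤ j from h)
    linarith [hj'.1, ht.2]

theorem residual_of_lt (hx₂ : ∀ n, 0 < x₂ n) {t : ℝ} (ht : t < genTime x₂ 0) :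
    residual x₂ s₂ t = 0 := by
  rw [residual]
  convert tsum_zero with k
  refine Set.indicator_of_notMem (fun h => ?_) _
  linarith [h.1, (genTime_strictMono hx₂).monotone (Nat.zero_le k)]

/-- The sojourn time of a packet consists of the work that it finds and brings, the residual time of
the priority packet that it finds in service, and the time for which priority packets generated
during its sojourn occupy the server. -/
theorem sojourn_eq (h : Regular x₁ s₁ x₂ s₂) (i : ℕ) {K : ℕ}
    (hK : deliveryTime x₁ s₁ x₂ s₂ i < genTime x₂ K) :
    sojourn x₁ s₁ x₂ s₂ i =
      (deliveryLevel x₁ s₁ x₂ s₂ i - clock x₂ s₂ (genTime x₁ i)) + residual x₂ s₂ (genTime x₁ i) +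
      ∑ k ∈ Finset.Ico (countUpTo (genTime x₂) (genTime x₁ i)) K, occupation x₂ s₂ k *
        (if clock x₂ s₂ (genTime x₂ k) < deliveryLevel x₁ s₁ x₂ s₂ i then 1 else 0) := by
  obtain ⟨hGD, hcD, hD⟩ := deliveryTime_spec h i
  have hG0 := (genTime_pos h.x₁_pos i).le
  have hP := genTime_strictMono h.x₂_pos
  have hocc := occupation_pos h.x₂_pos h.s₂_pos
  have hsep := genTime_add_occupation_le x₂ s₂
  have hlt := clock_lt_deliveryLevel_iff h i
  have hcnt := @lt_countUpTo_iff (genTime x₂) hP.monotone h.tendsto_genTime₂ (genTime x₁ i)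
  set G := genTime x₁ i
  set D := deliveryTime x₁ s₁ x₂ s₂ i
  set c := countUpTo (genTime x₂) G
  have hGltD : G < D := (hlt G).1 (clock_genTime_lt_deliveryLevel h.s₁_pos i)
  have hcK : c ≤ K := by
    by_contra! hlt'
    linarith [hcnt.1 hlt']
  have e1 := clock_eq_sub_sum h.x₂_pos h.s₂_pos hG0 (hGD.trans hK.le)
  have e2 := clock_eq_sub_sum h.x₂_pos h.s₂_pos (hG0.trans hGD) hK.le
  -- an occupied interval that starts before the delivery ends before the delivery
  have hend : ∀ k, genTime x₂ k < D → genTime x₂ k + occupation x₂ s₂ k < D := by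
    intro k hk
    rw [← hlt, clock_eq_of_mem_occupied (genTime_pos h.x₂_pos k).le le_rfl
      (by linarith [hocc k]) le_rfl, hlt]
    exact hk
  have hsplit : ∀ f : ℕ → ℝ, ∑ k ∈ Finset.range K, f k =
      ∑ k ∈ Finset.range c, f k + ∑ k ∈ Finset.Ico c K, f k := fun f =>
    (Finset.sum_range_add_sum_Ico f hcK).symm
  have hlate : ∀ k ∈ Finset.Ico c K,
      (min (genTime x₂ k + occupation x₂ s₂ k) D - min (genTime x₂ k) D) -
      (min (genTime x₂ k + occupation x₂ s₂ k) G - min (genTime x₂ k) G) =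
      occupation x₂ s₂ k *
        (if clock x₂ s₂ (genTime x₂ k) < deliveryLevel x₁ s₁ x₂ s₂ i then 1 else 0) := by
    intro k hk
    have hGk : G < genTime x₂ k := by
      by_contra! h'
      exact absurd (hcnt.2 h') (not_lt.2 (Finset.mem_Ico.1 hk).1)
    have := hocc k
    rw [min_eq_right (by linarith : G ≤ genTime x₂ k + occupation x₂ s₂ k), min_eq_right hGk.le]
    by_cases hkD : genTime x₂ k < D
    · rw [if_pos ((hlt _).2 hkD), min_eq_left (hend k hkD).le, min_eq_left hkD.le]; ring
    · rw [if_neg (fun h' => hkD ((hlt _).1 h')), min_eq_right (by linarith),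
        min_eq_right (by linarith)]
      ring
  have hearly : ∑ k ∈ Finset.range c,
      ((min (genTime x₂ k + occupation x₂ s₂ k) D - min (genTime x₂ k) D) -
      (min (genTime x₂ k + occupation x₂ s₂ k) G - min (genTime x₂ k) G)) = residual x₂ s₂ G := by
    have hterm : ∀ k < c, (min (genTime x₂ k + occupation x₂ s₂ k) D - min (genTime x₂ k) D) -
      (min (genTime x₂ k + occupation x₂ s₂ k) G - min (genTime x₂ k) G) =
        max (genTime x₂ k + occupation x₂ s₂ k - G) 0 := by
      intro k hk
      have hkG : genTime x₂ k ≤ G := hcnt.1 hk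
      rw [min_eq_left (hend k (hkG.trans_lt hGltD)).le, min_eq_left (hkG.trans hGD),
        min_eq_left hkG]
      rcases le_total (genTime x₂ k + occupation x₂ s₂ k) G with h' | h'
      · rw [min_eq_left h', max_eq_right (by linarith)]; ring
      · rw [min_eq_right h', max_eq_left (by linarith)]; ring
    rw [Finset.sum_congr rfl fun k hk => hterm k (Finset.mem_range.1 hk)]
    rcases Nat.eq_zero_or_pos c with hc0 | hc0
    · rw [residual_of_lt h.x₂_pos, hc0, Finset.sum_range_zero]
      by_contra! h'
      exact absurd (hcnt.2 h') (by omega)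
    · obtain ⟨m, hm⟩ : ∃ m, c = m + 1 := ⟨c - 1, by omega⟩
      have hmem : G ∈ Set.Ico (genTime x₂ m) (genTime x₂ (m + 1)) := by
        refine ⟨hcnt.1 (by omega), ?_⟩
        by_contra! h'
        exact absurd (hcnt.2 h') (by omega)
      rw [residual_eq h.x₂_pos hmem, hm, Finset.sum_range_succ, Finset.sum_eq_zero, zero_add]
      intro k hk
      refine max_eq_right ?_
      have := hP.monotone (show k + 1 ≤ m from Finset.mem_range.1 hk)
      linarith [hsep k, hmem.1]
  have hsum := Finset.sum_congr rfl hlate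
  have hdist := Finset.sum_sub_distrib (s := Finset.range K)
    (fun k => min (genTime x₂ k + occupation x₂ s₂ k) D - min (genTime x₂ k) D)
    (fun k => min (genTime x₂ k + occupation x₂ s₂ k) G - min (genTime x₂ k) G)
  rw [← hsum, ← hearly, ← hcD, e1, e2, add_assoc, ← hsplit, hdist]
  change D - G = _
  ring

/-- The number of ordinary packets present at priority generation times between two ordinary
arrivals, weighted with `y`. -/
noncomputable def prioritySum (x₁ s₁ x₂ s₂ : ℕ → ℝ) (y : ℕ → ℝ) (n : ℕ) : ℝ :=
  ∑ k ∈ Finset.Ico (countUpTo (genTime x₂) (genTime x₁ n))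
    (countUpTo (genTime x₂) (genTime x₁ (n + 1))),
    y k * undelivered x₁ s₁ x₂ s₂ n (clock x₂ s₂ (genTime x₂ k))

/-- Total sojourn time of the packets that precede an arrival to an empty queue. -/
theorem sum_sojourn_eq (h : Regular x₁ s₁ x₂ s₂) {N : ℕ} (hN : FindsEmpty x₁ s₁ x₂ s₂ N) :
    ∑ i ∈ Finset.range N, sojourn x₁ s₁ x₂ s₂ i =
      ∑ n ∈ Finset.range N, queueWork x₁ s₁ x₂ s₂ n +
      ∑ i ∈ Finset.range N, residual x₂ s₂ (genTime x₁ i) +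
      ∑ n ∈ Finset.range N, prioritySum x₁ s₁ x₂ s₂ (occupation x₂ s₂) n := by
  have hP := genTime_strictMono h.x₂_pos
  have hc := countUpTo_mono hP.monotone h.tendsto_genTime₂
  have hG := genTime_strictMono h.x₁_pos
  simp only [prioritySum, undelivered, Finset.mul_sum]
  rw [sum_queueWork h.x₁_pos h.s₁_pos hN,
    sum_sum_Ico_comm (c := fun n => countUpTo (genTime x₂) (genTime x₁ n))
      (hc.comp hG.monotone), ← Finset.sum_add_distrib, ← Finset.sum_add_distrib]
  refine Finset.sum_congr rfl fun i hi => ?_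
  refine sojourn_eq h i ?_
  have h1 : deliveryTime x₁ s₁ x₂ s₂ i ≤ genTime x₁ N :=
    ((deliveryTime_spec h i).2.2 _).2 (hN i (Finset.mem_range.1 hi))
  refine h1.trans_lt ?_
  by_contra! h'
  exact lt_irrefl _ ((lt_countUpTo_iff hP.monotone h.tendsto_genTime₂).2 h')

/-- The deliveries between two ordinary arrivals, each weighted with the number of ordinary packets
then present. -/
noncomputable def deliverySum (x₁ s₁ x₂ s₂ : ℕ → ℝ) (n : ℕ) : ℝ :=
  ∑ i ∈ Finset.Ico (countUpTo (deliveryLevel x₁ s₁ x₂ s₂) (clock x₂ s₂ (genTime x₁ n)))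
    (countUpTo (deliveryLevel x₁ s₁ x₂ s₂) (clock x₂ s₂ (genTime x₁ (n + 1)))),
    undeliveredLeft x₁ s₁ x₂ s₂ n (deliveryLevel x₁ s₁ x₂ s₂ i)

theorem tendsto_deliveryLevel (h : Regular x₁ s₁ x₂ s₂) :
    Tendsto (deliveryLevel x₁ s₁ x₂ s₂) atTop atTop :=
  tendsto_atTop_mono (fun n => (clock_genTime_lt_deliveryLevel h.s₁_pos n).le)
    (h.tendsto_clock.comp h.tendsto_genTime₁)

/-- Before an arrival to an empty queue, the queue lengths seen by the departing packets add up to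
the queue lengths right after the arrivals. -/
theorem sum_deliverySum (h : Regular x₁ s₁ x₂ s₂) {N : ℕ} (hN : FindsEmpty x₁ s₁ x₂ s₂ N) :
    ∑ n ∈ Finset.range N, deliverySum x₁ s₁ x₂ s₂ n =
      ∑ n ∈ Finset.range N, queue x₁ s₁ x₂ s₂ n := by
  have hE := deliveryLevel_strictMono (x₁ := x₁) (s₁ := s₁) (x₂ := x₂) (s₂ := s₂) h.s₁_pos
  have hEt := tendsto_deliveryLevel h
  set E := deliveryLevel x₁ s₁ x₂ s₂
  set g : ℕ → ℝ := fun n => clock x₂ s₂ (genTime x₁ n) with hg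
  have hgm : Monotone g := clock_mono.comp (genTime_strictMono h.x₁_pos).monotone
  have hcm : Monotone fun n => countUpTo E (g n) := (countUpTo_mono hE.monotone hEt).comp hgm
  have hcle : ∀ n, countUpTo E (g n) ≤ n := by
    intro n
    by_contra! hlt
    have := (lt_countUpTo_iff hE.monotone hEt).1 hlt
    exact absurd (clock_genTime_lt_deliveryLevel h.s₁_pos n) (not_lt.2 this)
  -- exchange the roles of the departing packet `k` and of the packets `i ≥ k` that it leaves behind
  have e1 : ∀ n, deliverySum x₁ s₁ x₂ s₂ n = ∑ k ∈ Finset.Ico (countUpTo E (g n))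
      (countUpTo E (g (n + 1))), ∑ i ∈ Finset.range (n + 1), if k ≤ i then (1 : ℝ) else 0 := by
    intro n
    refine Finset.sum_congr rfl fun k _ => Finset.sum_congr rfl fun i _ => ?_
    simp only [E, hE.le_iff_le]
  have e2 : ∀ n, queue x₁ s₁ x₂ s₂ n = ∑ i ∈ Finset.range (n + 1),
      if countUpTo E (g n) ≤ i then (1 : ℝ) else 0 := by
    intro n
    rw [queue, undelivered]
    refine Finset.sum_congr rfl fun i _ => ?_
    congr 1
    rw [eq_iff_iff, ← not_lt (b := countUpTo E (g n)), lt_countUpTo_iff hE.monotone hEt, not_le]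
  have hcN : countUpTo E (g N) = N := by
    refine le_antisymm (hcle N) ?_
    by_contra! hlt
    exact lt_irrefl _ ((lt_countUpTo_iff hE.monotone hEt).2 (hN _ hlt))
  simp_rw [e1, e2]
  rw [sum_sum_Ico_comm hcm (fun i k => if k ≤ i then (1 : ℝ) else 0), hcN]
  have e3 : ∀ i ∈ Finset.range N, ∑ k ∈ Finset.Ico (countUpTo E (g i)) N,
      (if k ≤ i then (1 : ℝ) else 0) = ((i : ℝ) + 1) - countUpTo E (g i) := by
    intro i hi
    have hiN := Finset.mem_range.1 hi
    have := hcle i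
    rw [Finset.sum_boole]
    have : (Finset.Ico (countUpTo E (g i)) N).filter (· ≤ i) =
        Finset.Ico (countUpTo E (g i)) (i + 1) := by
      ext k; simp only [Finset.mem_filter, Finset.mem_Ico]; omega
    rw [this, Nat.card_Ico, Nat.cast_sub (by omega)]
    push_cast; ring
  rw [Finset.sum_congr rfl e3]
  refine Finset.sum_congr rfl fun n _ => ?_
  have := hcle n
  rw [Finset.sum_boole]
  have : (Finset.range (n + 1)).filter (countUpTo E (g n) ≤ ·) =
      Finset.Ico (countUpTo E (g n)) (n + 1) := by
    ext k; simp only [Finset.mem_filter, Finset.mem_Ico, Finset.mem_range]; omega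
  rw [this, Nat.card_Ico, Nat.cast_sub (by omega)]
  push_cast; ring

end Accounting

/-! ### Sampling at Poisson arrivals -/

section GridDensity

/-- The function that equals `φ n / b n` on the interval `(t n, t (n + 1)]`, and zero outside these
intervals. The intervals are open on the left, so that the value at an arrival time does not depend on
this arrival. -/
noncomputable def gridDensity (t b : ℕ → ℝ) (φ : ℕ → ℝ → ℝ) (u : ℝ) : ℝ :=
  ∑' n, (Set.Ioc (t n) (t (n + 1))).indicator (fun u => φ n u / b n) u

variable {t b : ℕ → ℝ} {φ : ℕ → ℝ → ℝ}

theorem gridDensity_eq (ht : Monotone t) {n : ℕ} {u : ℝ} (hu : u ∈ Set.Ioc (t n) (t (n + 1))) :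
    gridDensity t b φ u = φ n u / b n := by
  rw [gridDensity, tsum_eq_single n, Set.indicator_of_mem hu]
  intro j hj
  refine Set.indicator_of_notMem (fun hj' => ?_) _
  rcases lt_or_gt_of_ne hj with h | h
  · have := ht (show j + 1 ≤ n from h)
    linarith [hj'.2, hu.1]
  · have := ht (show n + 1 ≤ j from h)
    linarith [hj'.1, hu.2]

theorem gridDensity_eq_zero {u : ℝ} (hu : ∀ n, u ∉ Set.Ioc (t n) (t (n + 1))) :
    gridDensity t b φ u = 0 := by
  rw [gridDensity]
  convert tsum_zero with n
  exact Set.indicator_of_notMem (hu n) _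

theorem gridDensity_of_le (ht : Monotone t) {u : ℝ} (hu : u ≤ t 0) : gridDensity t b φ u = 0 :=
  gridDensity_eq_zero fun n h => by linarith [h.1, ht (Nat.zero_le n)]

theorem gridDensity_mem_Icc (ht : Monotone t) {c : ℕ → ℝ}
    (hφ : ∀ n u, u ∈ Set.Ioc (t n) (t (n + 1)) → φ n u / b n ∈ Set.Icc 0 (c n)) {C : ℝ}
    (hC : 0 ≤ C) (hcC : ∀ n, c n ≤ C) (u : ℝ) : gridDensity t b φ u ∈ Set.Icc 0 C := by
  by_cases hu : ∃ n, u ∈ Set.Ioc (t n) (t (n + 1))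
  · obtain ⟨n, hn⟩ := hu
    rw [gridDensity_eq ht hn]
    exact ⟨(hφ n u hn).1, (hφ n u hn).2.trans (hcC n)⟩
  · push Not at hu
    rw [gridDensity_eq_zero hu]
    exact ⟨le_rfl, hC⟩

theorem gridDensity_congr {t' b' : ℕ → ℝ} {φ' : ℕ → ℝ → ℝ} {u : ℝ}
    (hmem : ∀ n, u ∈ Set.Ioc (t n) (t (n + 1)) ↔ u ∈ Set.Ioc (t' n) (t' (n + 1)))
    (hφ : ∀ n, u ∈ Set.Ioc (t n) (t (n + 1)) → φ n u / b n = φ' n u / b' n) :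
    gridDensity t b φ u = gridDensity t' b' φ' u := by
  refine tsum_congr fun n => ?_
  by_cases hu : u ∈ Set.Ioc (t n) (t (n + 1))
  · rw [Set.indicator_of_mem hu, Set.indicator_of_mem ((hmem n).1 hu), hφ n hu]
  · rw [Set.indicator_of_notMem hu, Set.indicator_of_notMem fun h => hu ((hmem n).2 h)]

theorem measurable_gridDensity {α : Type*} [MeasurableSpace α] {t b : α → ℕ → ℝ}
    {φ : α → ℕ → ℝ → ℝ} {u : α → ℝ} (ht : ∀ n, Measurable fun a => t a n)
    (hb : ∀ n, Measurable fun a => b a n) (hφ : ∀ n, Measurable fun a => φ a n (u a))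
    (hu : Measurable u) : Measurable fun a => gridDensity (t a) (b a) (φ a) (u a) := by
  refine Measurable.tsum fun n => ?_
  have : (fun a => (Set.Ioc (t a n) (t a (n + 1))).indicator (fun u => φ a n u / b a n) (u a)) =
      {a | t a n < u a ∧ u a ≤ t a (n + 1)}.indicator fun a => φ a n (u a) / b a n := by
    ext a; rfl
  rw [this]
  exact ((hφ n).div (hb n)).indicator
    ((measurableSet_lt (ht n) hu).inter (measurableSet_le hu (ht (n + 1))))

theorem lintegral_sq_gridDensity_le (ht : Monotone t) {c : ℕ → ℝ}
    (hφ : ∀ n u, u ∈ Set.Ioc (t n) (t (n + 1)) → φ n u / b n ∈ Set.Icc 0 (c n)) :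
    ∫⁻ u, ENNReal.ofReal (gridDensity t b φ u ^ 2) ≤
      ∑' n, ENNReal.ofReal (c n ^ 2) * ENNReal.ofReal (t (n + 1) - t n) := by
  have hle : ∀ u, ENNReal.ofReal (gridDensity t b φ u ^ 2) ≤
      ∑' n, (Set.Ioc (t n) (t (n + 1))).indicator (fun _ => ENNReal.ofReal (c n ^ 2)) u := by
    intro u
    by_cases hu : ∃ n, u ∈ Set.Ioc (t n) (t (n + 1))
    · obtain ⟨n, hn⟩ := hu
      rw [gridDensity_eq ht hn]
      refine le_trans ?_ (ENNReal.le_tsum n)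
      rw [Set.indicator_of_mem hn]
      exact ENNReal.ofReal_le_ofReal (pow_le_pow_left₀ (hφ n u hn).1 (hφ n u hn).2 2)
    · push Not at hu
      rw [gridDensity_eq_zero hu]
      simp
  refine (lintegral_mono hle).trans (le_of_eq ?_)
  rw [lintegral_tsum fun n => (measurable_const.indicator measurableSet_Ioc).aemeasurable]
  refine tsum_congr fun n => ?_
  rw [lintegral_indicator measurableSet_Ioc, setLIntegral_const, Real.volume_Ioc]

/-- From convergence of the compensated sums of `φ n / b n` to a law of large numbers for the
compensated sums of `φ n`, normalised by `b`. -/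
theorem tendsto_sum_grid_div {p : ℕ → ℝ} (hp : Monotone p) (hpt : Tendsto p atTop atTop)
    (ht : Monotone t) (htt : Tendsto t atTop atTop) (ht0 : 0 ≤ t 0)
    (hb : Monotone b) (hb0 : ∀ n, 0 < b n) (hbt : Tendsto b atTop atTop)
    (h0 : ∀ u, 0 ≤ gridDensity t b φ u)
    (hint : ∀ T, IntegrableOn (gridDensity t b φ) (Set.Ioc 0 T)) {r : ℝ} (hr : 0 ≤ r) {l : ℝ}
    (hconv : Tendsto (fun n => ∑ k ∈ Finset.range (n + 1), gridDensity t b φ (p k) -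
      r * ∫ u in Set.Ioc 0 (p n), gridDensity t b φ u) atTop (𝓝 l))
    (hzero : Tendsto (fun n => gridDensity t b φ (p n)) atTop (𝓝 0)) :
    Tendsto (fun N => (∑ n ∈ Finset.range N,
      (∑ k ∈ Finset.Ico (countUpTo p (t n)) (countUpTo p (t (n + 1))), φ n (p k) -
        r * ∫ u in Set.Ioc (t n) (t (n + 1)), φ n u)) / b N) atTop (𝓝 0) := by
  set h := gridDensity t b φ with hh
  have hm := tendsto_sum_countUpTo_sub_integral hp hpt h0 hint hr hconv hzero htt
  set m : ℕ → ℝ := fun n => ∑ k ∈ Finset.range (countUpTo p (t n)), h (p k) -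
      r * ∫ u in Set.Ioc 0 (t n), h u with hmdef
  have hsum : ∀ N, ∑ n ∈ Finset.range N, (m (n + 1) - m n) = m N - m 0 :=
    fun N => Finset.sum_range_sub m N
  have hconv' : Tendsto (fun N => ∑ n ∈ Finset.range N, (m (n + 1) - m n)) atTop
      (𝓝 (l - m 0)) := by
    simp_rw [hsum]; exact hm.sub_const _
  refine (tendsto_sum_mul_div_atTop_zero hb hbt hconv').congr fun N => ?_
  congr 1
  refine Finset.sum_congr rfl fun n _ => ?_
  have hφh : ∀ u ∈ Set.Ioc (t n) (t (n + 1)), φ n u = b n * h u := by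
    intro u hu
    rw [hh, gridDensity_eq ht hu, mul_div_cancel₀ _ (hb0 n).ne']
  have hc := countUpTo_mono hp hpt (ht n.le_succ)
  have e1 : ∑ k ∈ Finset.Ico (countUpTo p (t n)) (countUpTo p (t (n + 1))), φ n (p k) =
      b n * ∑ k ∈ Finset.Ico (countUpTo p (t n)) (countUpTo p (t (n + 1))), h (p k) := by
    rw [Finset.mul_sum]
    refine Finset.sum_congr rfl fun k hk => hφh _ ⟨?_, ?_⟩
    · by_contra! h'
      exact absurd ((lt_countUpTo_iff hp hpt).2 h') (not_lt.2 (Finset.mem_Ico.1 hk).1)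
    · exact (lt_countUpTo_iff hp hpt).1 (Finset.mem_Ico.1 hk).2
  have e2 : ∫ u in Set.Ioc (t n) (t (n + 1)), φ n u =
      b n * ∫ u in Set.Ioc (t n) (t (n + 1)), h u := by
    rw [← integral_const_mul]
    exact setIntegral_congr_fun measurableSet_Ioc hφh
  have htn : 0 ≤ t n := ht0.trans (ht (Nat.zero_le n))
  have e3 : ∫ u in Set.Ioc 0 (t (n + 1)), h u =
      (∫ u in Set.Ioc 0 (t n), h u) + ∫ u in Set.Ioc (t n) (t (n + 1)), h u := by
    rw [← Set.Ioc_union_Ioc_eq_Ioc htn (ht n.le_succ)]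
    refine setIntegral_union (Set.Ioc_disjoint_Ioc_of_le le_rfl) measurableSet_Ioc (hint _) ?_
    exact (hint (t (n + 1))).mono_set (Set.Ioc_subset_Ioc_left htn)
  rw [e1, e2]
  simp only [hmdef, e3]
  rw [← Finset.sum_range_add_sum_Ico _ hc]
  ring

/-- The analogue of `tendsto_sum_grid_div` for centred factors `y` instead of compensators. -/
theorem tendsto_sum_grid_mul_div {p y : ℕ → ℝ} (hp : Monotone p) (hpt : Tendsto p atTop atTop)
    (ht : Monotone t) (htt : Tendsto t atTop atTop)
    (hb : Monotone b) (hb0 : ∀ n, 0 < b n) (hbt : Tendsto b atTop atTop) {l : ℝ}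
    (hconv : Tendsto (fun n => ∑ k ∈ Finset.range n, gridDensity t b φ (p k) * y k)
      atTop (𝓝 l)) :
    Tendsto (fun N => (∑ n ∈ Finset.range N,
      ∑ k ∈ Finset.Ico (countUpTo p (t n)) (countUpTo p (t (n + 1))), y k * φ n (p k)) / b N)
      atTop (𝓝 0) := by
  have hm := hconv.comp ((tendsto_countUpTo hp hpt).comp htt)
  set m : ℕ → ℝ := fun n => ∑ k ∈ Finset.range (countUpTo p (t n)), gridDensity t b φ (p k) * y k
    with hmdef
  have hsum : ∀ N, ∑ n ∈ Finset.range N, (m (n + 1) - m n) = m N - m 0 :=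
    fun N => Finset.sum_range_sub m N
  have hconv' : Tendsto (fun N => ∑ n ∈ Finset.range N, (m (n + 1) - m n)) atTop
      (𝓝 (l - m 0)) := by
    simp_rw [hsum]; exact hm.sub_const _
  refine (tendsto_sum_mul_div_atTop_zero hb hbt hconv').congr fun N => ?_
  congr 1
  refine Finset.sum_congr rfl fun n _ => ?_
  have hc := countUpTo_mono hp hpt (ht n.le_succ)
  simp only [hmdef]
  rw [← Finset.sum_range_add_sum_Ico _ hc, add_sub_cancel_left, Finset.mul_sum]
  refine Finset.sum_congr rfl fun k hk => ?_
  rw [gridDensity_eq (n := n) ht]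
  · field_simp [(hb0 n).ne']
  constructor
  · by_contra! h'
    exact absurd ((lt_countUpTo_iff hp hpt).2 h') (not_lt.2 (Finset.mem_Ico.1 hk).1)
  · exact (lt_countUpTo_iff hp hpt).1 (Finset.mem_Ico.1 hk).2

end GridDensity

section PoissonArrivals

variable {ι : Type*} [Countable ι] (ν : ι → Measure ℝ) [∀ i, IsProbabilityMeasure (ν i)]

open Classical in
/-- The squared integrand at the points of a Poisson stream, summed over the points, has an
expectation bounded by that of its time integral: the intervals that end at the points and have the
lengths `v (idx n)` are disjoint. -/
theorem tsum_lintegral_sq_le {idx : ℕ → ι} (hpos : ∀ i, ∀ᵐ x ∂(ν i), 0 < x)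
    {h : (ι → ℝ) → ℝ → ℝ} {p : (ι → ℝ) → ℕ → ℝ}
    (hKm : ∀ n, Measurable fun v => h v (p v n))
    (hupd : ∀ n v, (∀ i, 0 < v i) → ∀ u ∈ Set.Ioc 0 (v (idx n)),
      h (Function.update v (idx n) u) (p (Function.update v (idx n) u) n) =
        h v (p v n - v (idx n) + u))
    (hps : ∀ n v, (∀ i, 0 < v i) → p v n ≤ p v (n + 1) - v (idx (n + 1))) :
    ∑' n, ∫⁻ v, (∫⁻ u in Set.Ioc 0 (v (idx n)), ENNReal.ofReal
      (h (Function.update v (idx n) u) (p (Function.update v (idx n) u) n) ^ 2))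
        ∂(Measure.infinitePi ν) ≤
      ∫⁻ v, (∫⁻ u, ENNReal.ofReal (h v u ^ 2)) ∂(Measure.infinitePi ν) := by
  have hP : ∀ᵐ v ∂(Measure.infinitePi ν), ∀ i, 0 < v i := ae_forall_pos ν hpos
  have hm : ∀ n, Measurable fun v : ι → ℝ => ∫⁻ u in Set.Ioc 0 (v (idx n)),
      ENNReal.ofReal (h (Function.update v (idx n) u) (p (Function.update v (idx n) u) n) ^ 2) :=
    fun n => measurable_setLIntegral_update (idx n)
      (K := fun v => ENNReal.ofReal (h v (p v n) ^ 2)) ((hKm n).pow_const 2).ennreal_ofReal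
  rw [← lintegral_tsum fun n => (hm n).aemeasurable]
  refine lintegral_mono_ae ?_
  filter_upwards [hP] with v hvpos
  have e1 : ∀ j, ∫⁻ u in Set.Ioc 0 (v (idx j)), ENNReal.ofReal (h (Function.update v (idx j) u)
      (p (Function.update v (idx j) u) j) ^ 2) =
      ∫⁻ u in Set.Ioc (p v j - v (idx j)) (p v j), ENNReal.ofReal (h v u ^ 2) := by
    intro j
    rw [setLIntegral_congr_fun measurableSet_Ioc
      (g := fun u => ENNReal.ofReal (h v (p v j - v (idx j) + u) ^ 2))
      fun u hu => by simp only [hupd j v hvpos u hu]]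
    rw [← lintegral_indicator measurableSet_Ioc, ← lintegral_indicator measurableSet_Ioc]
    conv_rhs => rw [← lintegral_add_left_eq_self _ (p v j - v (idx j))]
    refine lintegral_congr fun u => ?_
    simp only [Set.indicator, Set.mem_Ioc]
    congr 1
    rw [eq_iff_iff]
    constructor <;> rintro ⟨h1, h2⟩ <;> constructor <;> linarith
  simp only [e1]
  have hmonop : Monotone (p v) := monotone_nat_of_le_succ fun n => by
    linarith [hps n v hvpos, hvpos (idx (n + 1))]
  have hdisj : Pairwise (Function.onFun Disjoint
      fun j => Set.Ioc (p v j - v (idx j)) (p v j)) := by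
    have key : ∀ i j, i < j → Disjoint (Set.Ioc (p v i - v (idx i)) (p v i))
        (Set.Ioc (p v j - v (idx j)) (p v j)) := by
      intro i j hij
      refine Set.Ioc_disjoint_Ioc_of_le ?_
      obtain ⟨m, rfl⟩ : ∃ m, j = m + 1 := ⟨j - 1, by omega⟩
      exact (hmonop (by omega : i ≤ m)).trans (hps m v hvpos)
    intro i j hij
    rcases lt_or_gt_of_ne hij with h' | h'
    · exact key i j h'
    · exact (key j i h').symm
  rw [← lintegral_iUnion (fun _ => measurableSet_Ioc) hdisj]
  exact setLIntegral_le_lintegral _ _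

open Classical in
/-- **Poisson arrivals see time averages**, in the form of a convergent compensated sum. The points
`p v n` are such that the time from `p v n - v (idx n)` to `p v n` is the exponential coordinate
`idx n`; the integrand `h v` is determined by what precedes, and vanishes on the remaining parts of
the time axis. -/
theorem ae_tendsto_sum_sub_integral {S : ℕ → Set ι} (hS : Monotone S) {idx : ℕ → ι}
    (hidx : ∀ n, idx n ∉ S n) (hidx' : ∀ n, idx n ∈ S (n + 1)) {r : ℝ} (hr : 0 < r)
    (hν : ∀ n, ν (idx n) = expMeasure r) (hpos : ∀ i, ∀ᵐ x ∂(ν i), 0 < x)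
    {h : (ι → ℝ) → ℝ → ℝ} {p : (ι → ℝ) → ℕ → ℝ}
    (hKm : ∀ n, Measurable fun v => h v (p v n))
    (hhm : ∀ v, Measurable (h v))
    (hh : ∀ v, (∀ i, 0 < v i) → ∀ u, h v u ∈ Set.Icc 0 1)
    (hdep : ∀ n v, (∀ i, 0 < v i) → h ((S (n + 1)).piecewise v (fun _ => (1 : ℝ)))
      (p ((S (n + 1)).piecewise v (fun _ => (1 : ℝ))) n) = h v (p v n))
    (hupd : ∀ n v, (∀ i, 0 < v i) → ∀ u ∈ Set.Ioc 0 (v (idx n)),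
      h (Function.update v (idx n) u) (p (Function.update v (idx n) u) n) =
        h v (p v n - v (idx n) + u))
    (hp0 : ∀ v, (∀ i, 0 < v i) → 0 ≤ p v 0 - v (idx 0) ∧
      ∀ u ∈ Set.Ioc 0 (p v 0 - v (idx 0)), h v u = 0)
    (hps : ∀ n v, (∀ i, 0 < v i) → p v n ≤ p v (n + 1) - v (idx (n + 1)) ∧
      ∀ u ∈ Set.Ioc (p v n) (p v (n + 1) - v (idx (n + 1))), h v u = 0)
    (hL2 : ∫⁻ v, (∫⁻ u, ENNReal.ofReal (h v u ^ 2)) ∂(Measure.infinitePi ν) ≠ ⊤) :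
    ∀ᵐ v ∂(Measure.infinitePi ν),
      (∃ l : ℝ, Tendsto (fun n => ∑ k ∈ Finset.range (n + 1), h v (p v k) -
        r * ∫ u in Set.Ioc 0 (p v n), h v u) atTop (𝓝 l)) ∧
      Tendsto (fun n => h v (p v n)) atTop (𝓝 0) := by
  have hP : ∀ᵐ v ∂(Measure.infinitePi ν), ∀ i, 0 < v i := ae_forall_pos ν hpos
  have hint : ∀ v, (∀ i, 0 < v i) → ∀ a b, IntegrableOn (h v) (Set.Ioc a b) := by
    intro v hv a b
    refine Measure.integrableOn_of_bounded (M := 1) (by simp) (hhm v).aestronglyMeasurable ?_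
    exact ae_of_all _ fun u => by rw [Real.norm_of_nonneg (hh v hv u).1]; exact (hh v hv u).2
  have hB := ae_tendsto_sum_compensated ν hS hidx hidx' hr hν hpos
    (K := fun n v => h v (p v n)) hKm (fun n v hv => (hh v hv _).1) (C := 1)
    (fun n v hv => (hh v hv _).2) hdep ?_
  · filter_upwards [hB, hP] with v hv hvpos
    refine ⟨?_, hv.2⟩
    obtain ⟨l, hl⟩ := hv.1
    refine ⟨l, ((tendsto_add_atTop_iff_nat 1).2 hl).congr fun n => ?_⟩
    have e1 : ∀ j, ∫ u in Set.Ioc 0 (v (idx j)), h (Function.update v (idx j) u)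
        (p (Function.update v (idx j) u) j) = ∫ u in Set.Ioc (p v j - v (idx j)) (p v j), h v u := by
      intro j
      rw [setIntegral_congr_fun measurableSet_Ioc (hupd j v hvpos),
        ← intervalIntegral.integral_of_le (hvpos _).le,
        intervalIntegral.integral_comp_add_left (fun u => h v u) (p v j - v (idx j)),
        ← intervalIntegral.integral_of_le (by linarith [hvpos (idx j)])]
      simp
    simp only [e1]
    induction n with
    | zero =>
      have h1 := (hp0 v hvpos).1
      have h2 : p v 0 - v (idx 0) ≤ p v 0 := by linarith [hvpos (idx 0)]
      have e2 : ∫ u in Set.Ioc 0 (p v 0), h v u =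
          ∫ u in Set.Ioc (p v 0 - v (idx 0)) (p v 0), h v u := by
        rw [← Set.Ioc_union_Ioc_eq_Ioc h1 h2, setIntegral_union
          (Set.Ioc_disjoint_Ioc_of_le le_rfl) measurableSet_Ioc (hint v hvpos _ _)
          (hint v hvpos _ _), setIntegral_eq_zero_of_forall_eq_zero (hp0 v hvpos).2, zero_add]
      simp [e2]
    | succ n ih =>
      have h1 := (hps n v hvpos).1
      have h2 : p v (n + 1) - v (idx (n + 1)) ≤ p v (n + 1) := by linarith [hvpos (idx (n + 1))]
      have h0 : 0 ≤ p v n := by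
        clear ih
        induction n with
        | zero => linarith [(hp0 v hvpos).1, hvpos (idx 0)]
        | succ n ih =>
          have := (hps n v hvpos).1
          have h3 := hvpos (idx (n + 1))
          have := ih this (by linarith)
          linarith
      have e2 : ∫ u in Set.Ioc 0 (p v (n + 1)), h v u = (∫ u in Set.Ioc 0 (p v n), h v u) +
          ∫ u in Set.Ioc (p v (n + 1) - v (idx (n + 1))) (p v (n + 1)), h v u := by
        rw [← Set.Ioc_union_Ioc_eq_Ioc h0 (h1.trans h2), setIntegral_union
          (Set.Ioc_disjoint_Ioc_of_le le_rfl) measurableSet_Ioc (hint v hvpos _ _)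
          (hint v hvpos _ _), ← Set.Ioc_union_Ioc_eq_Ioc h1 h2, setIntegral_union
          (Set.Ioc_disjoint_Ioc_of_le le_rfl) measurableSet_Ioc (hint v hvpos _ _)
          (hint v hvpos _ _), setIntegral_eq_zero_of_forall_eq_zero (hps n v hvpos).2, zero_add]
      rw [Finset.sum_range_succ, ih, Finset.sum_range_succ _ (n + 1), e2]
      ring
  · exact ne_top_of_le_ne_top hL2
      (tsum_lintegral_sq_le ν hpos hKm hupd fun n v hv => (hps n v hv).1)

end PoissonArrivals

/-! ### The sampled densities -/

section Densities

/-- The queue length at time `t`, scaled down by the weight of the queue lengths so far. -/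
noncomputable def queueDensity (x₁ s₁ x₂ s₂ : ℕ → ℝ) : ℝ → ℝ :=
  gridDensity (genTime x₁) (weight (queue x₁ s₁ x₂ s₂))
    (fun n t => undelivered x₁ s₁ x₂ s₂ n (clock x₂ s₂ t))

/-- The scaled queue length as a function of the reading of the clock. -/
noncomputable def workDensity (x₁ s₁ x₂ s₂ : ℕ → ℝ) : ℝ → ℝ :=
  gridDensity (fun n => clock x₂ s₂ (genTime x₁ n)) (weight (queue x₁ s₁ x₂ s₂))
    (undeliveredLeft x₁ s₁ x₂ s₂)

/-- The residual time of the priority packet in service, scaled down by the weight of the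
occupation times so far. -/
noncomputable def residualDensity (x₂ s₂ : ℕ → ℝ) : ℝ → ℝ :=
  gridDensity (genTime x₂) (weight (occupation x₂ s₂))
    (fun k t => max (genTime x₂ k + occupation x₂ s₂ k - t) 0)

variable {x₁ s₁ x₂ s₂ : ℕ → ℝ}

theorem queueDensity_bound (n : ℕ) (u : ℝ)
    (hu : u ∈ Set.Ioc (genTime x₁ n) (genTime x₁ (n + 1))) :
    undelivered x₁ s₁ x₂ s₂ n (clock x₂ s₂ u) / weight (queue x₁ s₁ x₂ s₂) n ∈
      Set.Icc 0 (queue x₁ s₁ x₂ s₂ n / weight (queue x₁ s₁ x₂ s₂) n) := by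
  have hw := weight_pos (queue_nonneg (x₁ := x₁) (s₁ := s₁) (x₂ := x₂) (s₂ := s₂)) n
  exact ⟨div_nonneg (undelivered_nonneg _ _) hw.le,
    div_le_div_of_nonneg_right (undelivered_anti n (clock_mono hu.1.le)) hw.le⟩

theorem workDensity_bound (n : ℕ) (u : ℝ)
    (hu : u ∈ Set.Ioc (clock x₂ s₂ (genTime x₁ n)) (clock x₂ s₂ (genTime x₁ (n + 1)))) :
    undeliveredLeft x₁ s₁ x₂ s₂ n u / weight (queue x₁ s₁ x₂ s₂) n ∈
      Set.Icc 0 (queue x₁ s₁ x₂ s₂ n / weight (queue x₁ s₁ x₂ s₂) n) := by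
  have hw := weight_pos (queue_nonneg (x₁ := x₁) (s₁ := s₁) (x₂ := x₂) (s₂ := s₂)) n
  exact ⟨div_nonneg (undeliveredLeft_nonneg _ _) hw.le,
    div_le_div_of_nonneg_right (undeliveredLeft_le hu.1) hw.le⟩

theorem residualDensity_bound (hx₂ : ∀ n, 0 < x₂ n) (hs₂ : ∀ n, 0 < s₂ n) (k : ℕ) (u : ℝ)
    (hu : u ∈ Set.Ioc (genTime x₂ k) (genTime x₂ (k + 1))) :
    max (genTime x₂ k + occupation x₂ s₂ k - u) 0 / weight (occupation x₂ s₂) k ∈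
      Set.Icc 0 (occupation x₂ s₂ k / weight (occupation x₂ s₂) k) := by
  have hw := weight_pos (fun n => (occupation_pos hx₂ hs₂ n).le) k
  exact ⟨div_nonneg (le_max_right _ _) hw.le, div_le_div_of_nonneg_right
    (max_le (by linarith [hu.1]) (occupation_pos hx₂ hs₂ k).le) hw.le⟩

theorem div_weight_le_one {Q : ℕ → ℝ} (hQ : ∀ n, 0 ≤ Q n) (n : ℕ) : Q n / weight Q n ≤ 1 :=
  div_le_one_of_le₀ (le_weight' hQ n) (weight_pos hQ n).le

theorem queueDensity_mem (hx₁ : ∀ n, 0 < x₁ n) (u : ℝ) :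
    queueDensity x₁ s₁ x₂ s₂ u ∈ Set.Icc 0 1 :=
  gridDensity_mem_Icc (genTime_strictMono hx₁).monotone queueDensity_bound zero_le_one
    (div_weight_le_one queue_nonneg) u

theorem clock_genTime_mono (hx₁ : ∀ n, 0 < x₁ n) :
    Monotone fun n => clock x₂ s₂ (genTime x₁ n) :=
  clock_mono.comp (genTime_strictMono hx₁).monotone

theorem workDensity_mem (hx₁ : ∀ n, 0 < x₁ n) (u : ℝ) :
    workDensity x₁ s₁ x₂ s₂ u ∈ Set.Icc 0 1 :=
  gridDensity_mem_Icc (clock_genTime_mono hx₁) workDensity_bound zero_le_one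
    (div_weight_le_one queue_nonneg) u

theorem residualDensity_mem (hx₂ : ∀ n, 0 < x₂ n) (hs₂ : ∀ n, 0 < s₂ n) (u : ℝ) :
    residualDensity x₂ s₂ u ∈ Set.Icc 0 1 :=
  gridDensity_mem_Icc (genTime_strictMono hx₂).monotone (residualDensity_bound hx₂ hs₂)
    zero_le_one (div_weight_le_one fun n => (occupation_pos hx₂ hs₂ n).le) u

theorem lintegral_sq_queueDensity_le (hx₁ : ∀ n, 0 < x₁ n) :
    ∫⁻ u, ENNReal.ofReal (queueDensity x₁ s₁ x₂ s₂ u ^ 2) ≤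
      ∑' n, ENNReal.ofReal ((queue x₁ s₁ x₂ s₂ n / weight (queue x₁ s₁ x₂ s₂) n) ^ 2) *
        ENNReal.ofReal (x₁ (n + 1)) := by
  refine (lintegral_sq_gridDensity_le (genTime_strictMono hx₁).monotone
    queueDensity_bound).trans (le_of_eq ?_)
  simp [genTime_succ]

theorem lintegral_sq_workDensity_le (hx₁ : ∀ n, 0 < x₁ n) :
    ∫⁻ u, ENNReal.ofReal (workDensity x₁ s₁ x₂ s₂ u ^ 2) ≤
      ∑' n, ENNReal.ofReal ((queue x₁ s₁ x₂ s₂ n / weight (queue x₁ s₁ x₂ s₂) n) ^ 2) *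
        ENNReal.ofReal (x₁ (n + 1)) := by
  refine (lintegral_sq_gridDensity_le (clock_genTime_mono hx₁) workDensity_bound).trans ?_
  gcongr with n
  have := clock_sub_le (x₂ := x₂) (s₂ := s₂) ((genTime_strictMono hx₁).monotone n.le_succ)
  rw [Nat.succ_eq_add_one] at this
  rw [genTime_succ] at this ⊢
  linarith

theorem lintegral_sq_residualDensity_le (hx₂ : ∀ n, 0 < x₂ n) (hs₂ : ∀ n, 0 < s₂ n) :
    ∫⁻ u, ENNReal.ofReal (residualDensity x₂ s₂ u ^ 2) ≤
      ∑' n : ℕ, ENNReal.ofReal (1 / ((n : ℝ) + 1) ^ 2) * ENNReal.ofReal (x₂ (n + 1) ^ 3) := by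
  refine (lintegral_sq_gridDensity_le (genTime_strictMono hx₂).monotone
    (residualDensity_bound hx₂ hs₂)).trans ?_
  refine ENNReal.tsum_le_tsum fun n => ?_
  have hn : (0 : ℝ) < (n : ℝ) + 1 := by positivity
  have hM := occupation_pos hx₂ hs₂
  have hw := le_weight (fun n => (hM n).le) n
  rw [genTime_succ, add_sub_cancel_left, ← ENNReal.ofReal_mul (by positivity),
    ← ENNReal.ofReal_mul (by positivity)]
  refine ENNReal.ofReal_le_ofReal ?_
  have h1 : occupation x₂ s₂ n / weight (occupation x₂ s₂) n ≤ x₂ (n + 1) / ((n : ℝ) + 1) :=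
    div_le_div₀ (hx₂ _).le (min_le_right _ _) hn (by linarith)
  have h0 : 0 ≤ occupation x₂ s₂ n / weight (occupation x₂ s₂) n :=
    div_nonneg (hM n).le (by linarith)
  calc (occupation x₂ s₂ n / weight (occupation x₂ s₂) n) ^ 2 * x₂ (n + 1) ≤
      (x₂ (n + 1) / ((n : ℝ) + 1)) ^ 2 * x₂ (n + 1) :=
        mul_le_mul_of_nonneg_right (pow_le_pow_left₀ h0 h1 2) (hx₂ _).le
    _ = _ := by field_simp

end Densities

section Causality

variable {x₁ s₁ x₂ s₂ x₁' s₁' x₂' s₂' : ℕ → ℝ}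

theorem genTime_congr {x x' : ℕ → ℝ} {n : ℕ} (h : ∀ m ≤ n, x m = x' m) :
    genTime x n = genTime x' n :=
  Finset.sum_congr rfl fun i hi => h i (Nat.lt_succ_iff.1 (Finset.mem_range.1 hi))

theorem genTime_update (x : ℕ → ℝ) (n : ℕ) (u : ℝ) :
    genTime (Function.update x n u) n = genTime x n - x n + u := by
  have h : ∑ i ∈ Finset.range n, Function.update x n u i = ∑ i ∈ Finset.range n, x i :=
    Finset.sum_congr rfl fun i hi => Function.update_of_ne (Finset.mem_range.1 hi).ne _ _
  simp [genTime, Finset.sum_range_succ, h]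

/-- Up to the generation of priority packet `k`, the clock depends on earlier priority packets
only. -/
theorem clock_congr (hx₂ : ∀ n, 0 < x₂ n) (hx₂' : ∀ n, 0 < x₂' n) {k : ℕ}
    (hx : ∀ j < k, x₂ j = x₂' j) (hs : ∀ j < k, s₂ j = s₂' j) {t : ℝ}
    (ht : t ≤ genTime x₂ k) (ht' : t ≤ genTime x₂' k) : clock x₂ s₂ t = clock x₂' s₂' t := by
  have key : ∀ {x s x' s' : ℕ → ℝ}, (∀ n, 0 < x n) → (∀ n, 0 < x' n) →
      (∀ j < k, x j = x' j) → (∀ j < k, s j = s' j) → t ≤ genTime x k → t ≤ genTime x' k →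
      ∀ u < t, u ∈ priorityBusy x s → u ∈ priorityBusy x' s' := by
    rintro x s x' s' hx hx' hxx hss ht ht' u hu ⟨j, h1, h2, h3⟩
    have hjk : j < k := by
      by_contra! h
      linarith [(genTime_strictMono hx).monotone h]
    have hj : genTime x j = genTime x' j := genTime_congr fun m hm => hxx m (hm.trans_lt hjk)
    refine ⟨j, hj ▸ h1, ?_, ?_⟩
    · rw [← hj, ← hss j hjk]; exact h2
    · rcases Nat.lt_or_ge (j + 1) k with h | h
      · rw [← genTime_congr (x := x) fun m hm => hxx m (hm.trans_lt h)]; exact h3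
      · rw [show j + 1 = k by omega]; linarith
  have h1 : ∀ x s : ℕ → ℝ, clock x s t = volume.real (Set.Ico 0 t \ priorityBusy x s) := fun x s =>
    measureReal_congr ((Ico_ae_eq_Icc (a := (0 : ℝ)) (b := t)).symm.diff (ae_eq_refl _))
  rw [h1, h1]
  congr 1
  ext u
  simp only [Set.mem_sdiff, Set.mem_Ico]
  refine and_congr_right fun hu => not_congr ⟨?_, ?_⟩
  · exact key hx₂ hx₂' hx hs ht ht' u hu.2
  · exact key hx₂' hx₂ (fun j hj => (hx j hj).symm) (fun j hj => (hs j hj).symm) ht' ht u hu.2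

theorem deliveryLevel_congr {n : ℕ}
    (hc : ∀ j ≤ n, clock x₂ s₂ (genTime x₁ j) = clock x₂' s₂' (genTime x₁' j))
    (hs : ∀ j ≤ n, s₁ j = s₁' j) :
    deliveryLevel x₁ s₁ x₂ s₂ n = deliveryLevel x₁' s₁' x₂' s₂' n := by
  induction n with
  | zero => simp only [deliveryLevel, hc 0 le_rfl, hs 0 le_rfl]
  | succ n ih =>
    simp only [deliveryLevel, hc (n + 1) le_rfl, hs (n + 1) le_rfl,
      ih (fun j hj => hc j (hj.trans n.le_succ)) fun j hj => hs j (hj.trans n.le_succ)]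

theorem weight_congr {Q Q' : ℕ → ℝ} {n : ℕ} (h : ∀ j ≤ n, Q j = Q' j) : weight Q n = weight Q' n := by
  rw [weight, weight]
  congr 1
  exact Finset.sum_congr rfl fun j hj => by rw [h j (Nat.lt_succ_iff.1 (Finset.mem_range.1 hj))]

theorem queue_congr {n : ℕ}
    (hc : ∀ j ≤ n, clock x₂ s₂ (genTime x₁ j) = clock x₂' s₂' (genTime x₁' j))
    (hs : ∀ j ≤ n, s₁ j = s₁' j) : queue x₁ s₁ x₂ s₂ n = queue x₁' s₁' x₂' s₂' n := by
  rw [queue, queue, undelivered, undelivered]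
  refine Finset.sum_congr rfl fun i hi => ?_
  have hin := Nat.lt_succ_iff.1 (Finset.mem_range.1 hi)
  rw [hc n le_rfl, deliveryLevel_congr (fun j hj => hc j (hj.trans hin))
    fun j hj => hs j (hj.trans hin)]

/-- The scaled queue length at time `u` does not depend on ordinary packets generated after `u`. -/
theorem queueDensity_congr_ordinary (hx₁ : ∀ n, 0 < x₁ n) (hx₁' : ∀ n, 0 < x₁' n) {n : ℕ}
    (hx : ∀ j < n, x₁ j = x₁' j) {u : ℝ} (hu : u ≤ genTime x₁ n) (hu' : u ≤ genTime x₁' n) :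
    queueDensity x₁ s₁ x₂ s₂ u = queueDensity x₁' s₁ x₂ s₂ u := by
  have hG : ∀ j < n, genTime x₁ j = genTime x₁' j := fun j hj =>
    genTime_congr fun m hm => hx m (hm.trans_lt hj)
  have hlt : ∀ {x : ℕ → ℝ}, (∀ n, 0 < x n) → u ≤ genTime x n → ∀ m,
      u ∈ Set.Ioc (genTime x m) (genTime x (m + 1)) → m < n := by
    intro x hx hun m hm
    by_contra! h
    linarith [hm.1, (genTime_strictMono hx).monotone h]
  have hright : ∀ m < n, u ≤ genTime x₁ (m + 1) ↔ u ≤ genTime x₁' (m + 1) := by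
    intro m hm
    rcases Nat.lt_or_ge (m + 1) n with h | h
    · rw [hG _ h]
    · rw [show m + 1 = n by omega]; exact ⟨fun _ => hu', fun _ => hu⟩
  refine gridDensity_congr (fun m => ⟨fun h => ?_, fun h => ?_⟩) fun m h => ?_
  · have hm := hlt hx₁ hu m h
    exact ⟨hG m hm ▸ h.1, (hright m hm).1 h.2⟩
  · have hm := hlt hx₁' hu' m h
    exact ⟨hG m hm ▸ h.1, (hright m hm).2 h.2⟩
  · have hm := hlt hx₁ hu m h
    have hc : ∀ j ≤ m, clock x₂ s₂ (genTime x₁ j) = clock x₂ s₂ (genTime x₁' j) := fun j hj => by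
      rw [hG j (hj.trans_lt hm)]
    congr 1
    · refine Finset.sum_congr rfl fun i hi => ?_
      rw [deliveryLevel_congr (fun j hj => hc j
        (hj.trans (Nat.lt_succ_iff.1 (Finset.mem_range.1 hi)))) fun j _ => rfl]
    · exact weight_congr fun j hj => queue_congr (fun i hi => hc i (hi.trans hj)) fun i _ => rfl

/-- The scaled queue length at time `u` does not depend on priority packets generated after `u`. -/
theorem queueDensity_congr_priority (hx₁ : ∀ n, 0 < x₁ n) (hx₂ : ∀ n, 0 < x₂ n)
    (hx₂' : ∀ n, 0 < x₂' n) {k : ℕ} (hx : ∀ j < k, x₂ j = x₂' j) (hs : ∀ j < k, s₂ j = s₂' j)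
    {u : ℝ} (hu : u ≤ genTime x₂ k) (hu' : u ≤ genTime x₂' k) :
    queueDensity x₁ s₁ x₂ s₂ u = queueDensity x₁ s₁ x₂' s₂' u := by
  refine gridDensity_congr (fun m => Iff.rfl) fun m h => ?_
  have hc : ∀ t ≤ u, clock x₂ s₂ t = clock x₂' s₂' t := fun t ht =>
    clock_congr hx₂ hx₂' hx hs (ht.trans hu) (ht.trans hu')
  have hc' : ∀ j ≤ m, clock x₂ s₂ (genTime x₁ j) = clock x₂' s₂' (genTime x₁ j) := fun j hj =>
    hc _ (((genTime_strictMono hx₁).monotone hj).trans h.1.le)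
  congr 1
  · refine Finset.sum_congr rfl fun i hi => ?_
    rw [hc u le_rfl, deliveryLevel_congr (fun j hj => hc' j
      (hj.trans (Nat.lt_succ_iff.1 (Finset.mem_range.1 hi)))) fun j _ => rfl]
  · exact weight_congr fun j hj => queue_congr (fun i hi => hc' i (hi.trans hj)) fun i _ => rfl

/-- The scaled queue length before the delivery of packet `i` does not depend on the service times of
this packet and its successors. -/
theorem workDensity_congr_service (hs₁ : ∀ n, 0 < s₁ n) (hs₁' : ∀ n, 0 < s₁' n)
    (hx₁ : ∀ n, 0 < x₁ n) {i : ℕ} (hs : ∀ j < i, s₁ j = s₁' j) {a : ℝ}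
    (ha : a ≤ deliveryLevel x₁ s₁ x₂ s₂ i) (ha' : a ≤ deliveryLevel x₁ s₁' x₂ s₂ i) :
    workDensity x₁ s₁ x₂ s₂ a = workDensity x₁ s₁' x₂ s₂ a := by
  have hE : ∀ l < i, deliveryLevel x₁ s₁ x₂ s₂ l = deliveryLevel x₁ s₁' x₂ s₂ l := fun l hl =>
    deliveryLevel_congr (fun _ _ => rfl) fun j hj => hs j (hj.trans_lt hl)
  have hle : ∀ {s : ℕ → ℝ}, (∀ n, 0 < s n) → a ≤ deliveryLevel x₁ s x₂ s₂ i → ∀ l, i ≤ l →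
      a ≤ deliveryLevel x₁ s x₂ s₂ l := fun hs h l hl =>
    h.trans ((deliveryLevel_strictMono hs).monotone hl)
  refine gridDensity_congr (fun m => Iff.rfl) fun m h => ?_
  congr 1
  · refine Finset.sum_congr rfl fun l _ => ?_
    rcases Nat.lt_or_ge l i with hl | hl
    · rw [hE l hl]
    · rw [if_pos (hle hs₁ ha l hl), if_pos (hle hs₁' ha' l hl)]
  · refine weight_congr fun j hj => ?_
    rw [queue, queue, undelivered, undelivered]
    refine Finset.sum_congr rfl fun l _ => ?_
    have hja : clock x₂ s₂ (genTime x₁ j) < a := (clock_genTime_mono hx₁ hj).trans_lt h.1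
    rcases Nat.lt_or_ge l i with hl | hl
    · rw [hE l hl]
    · rw [if_pos (hja.trans_le (hle hs₁ ha l hl)), if_pos (hja.trans_le (hle hs₁' ha' l hl))]

end Causality

section Measurability

variable {α : Type*} [MeasurableSpace α] {x₁ s₁ x₂ s₂ : α → ℕ → ℝ}

theorem measurable_genTime {x : α → ℕ → ℝ} (hx : ∀ n, Measurable fun a => x a n) (n : ℕ) :
    Measurable fun a => genTime (x a) n :=
  Finset.measurable_fun_sum _ fun i _ => hx i

theorem measurable_occupation (hx₂ : ∀ n, Measurable fun a => x₂ a n)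
    (hs₂ : ∀ n, Measurable fun a => s₂ a n) (k : ℕ) :
    Measurable fun a => occupation (x₂ a) (s₂ a) k := (hs₂ k).min (hx₂ (k + 1))

theorem measurable_clock (hx₂ : ∀ n, Measurable fun a => x₂ a n)
    (hs₂ : ∀ n, Measurable fun a => s₂ a n) {t : α → ℝ} (ht : Measurable t) :
    Measurable fun a => clock (x₂ a) (s₂ a) (t a) := by
  have hset : MeasurableSet {p : α × ℝ | (0 ≤ p.2 ∧ p.2 ≤ t p.1) ∧
      ¬ ∃ k, genTime (x₂ p.1) k ≤ p.2 ∧ p.2 < genTime (x₂ p.1) k + occupation (x₂ p.1) (s₂ p.1) k} := by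
    refine ((measurableSet_le measurable_const measurable_snd).inter
      (measurableSet_le measurable_snd (ht.comp measurable_fst))).inter (MeasurableSet.compl ?_)
    have : {p : α × ℝ | ∃ k, genTime (x₂ p.1) k ≤ p.2 ∧
        p.2 < genTime (x₂ p.1) k + occupation (x₂ p.1) (s₂ p.1) k} =
        ⋃ k, {p : α × ℝ | genTime (x₂ p.1) k ≤ p.2 ∧
          p.2 < genTime (x₂ p.1) k + occupation (x₂ p.1) (s₂ p.1) k} := by
      ext p; simp
    change MeasurableSet {p : α × ℝ | ∃ k, genTime (x₂ p.1) k ≤ p.2 ∧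
        p.2 < genTime (x₂ p.1) k + occupation (x₂ p.1) (s₂ p.1) k}
    rw [this]
    refine MeasurableSet.iUnion fun k => ?_
    have hg : Measurable fun p : α × ℝ => genTime (x₂ p.1) k :=
      (measurable_genTime hx₂ k).comp measurable_fst
    have ho : Measurable fun p : α × ℝ => occupation (x₂ p.1) (s₂ p.1) k :=
      (measurable_occupation hx₂ hs₂ k).comp measurable_fst
    exact (measurableSet_le hg measurable_snd).inter (measurableSet_lt measurable_snd (hg.add ho))
  have := (measurable_measure_prodMk_left (ν := (volume : Measure ℝ)) hset).ennreal_toReal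
  convert this using 1
  ext a
  rw [clock, availableTime, measureReal_def]
  congr 2
  ext u
  simp [priorityBusy_eq]

theorem measurable_deliveryLevel (hx₁ : ∀ n, Measurable fun a => x₁ a n)
    (hs₁ : ∀ n, Measurable fun a => s₁ a n) (hx₂ : ∀ n, Measurable fun a => x₂ a n)
    (hs₂ : ∀ n, Measurable fun a => s₂ a n) (n : ℕ) :
    Measurable fun a => deliveryLevel (x₁ a) (s₁ a) (x₂ a) (s₂ a) n := by
  have hc := fun n => measurable_clock hx₂ hs₂ (measurable_genTime hx₁ n)
  induction n with
  | zero => exact (hc 0).add (hs₁ 0)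
  | succ n ih => exact (ih.max (hc (n + 1))).add (hs₁ (n + 1))

theorem measurable_undelivered (hx₁ : ∀ n, Measurable fun a => x₁ a n)
    (hs₁ : ∀ n, Measurable fun a => s₁ a n) (hx₂ : ∀ n, Measurable fun a => x₂ a n)
    (hs₂ : ∀ n, Measurable fun a => s₂ a n) (n : ℕ) {u : α → ℝ} (hu : Measurable u) :
    Measurable fun a => undelivered (x₁ a) (s₁ a) (x₂ a) (s₂ a) n (u a) :=
  Finset.measurable_fun_sum _ fun i _ => Measurable.ite
    (measurableSet_lt hu (measurable_deliveryLevel hx₁ hs₁ hx₂ hs₂ i))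
    measurable_const measurable_const

theorem measurable_undeliveredLeft (hx₁ : ∀ n, Measurable fun a => x₁ a n)
    (hs₁ : ∀ n, Measurable fun a => s₁ a n) (hx₂ : ∀ n, Measurable fun a => x₂ a n)
    (hs₂ : ∀ n, Measurable fun a => s₂ a n) (n : ℕ) {u : α → ℝ} (hu : Measurable u) :
    Measurable fun a => undeliveredLeft (x₁ a) (s₁ a) (x₂ a) (s₂ a) n (u a) :=
  Finset.measurable_fun_sum _ fun i _ => Measurable.ite
    (measurableSet_le hu (measurable_deliveryLevel hx₁ hs₁ hx₂ hs₂ i))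
    measurable_const measurable_const

theorem measurable_queue (hx₁ : ∀ n, Measurable fun a => x₁ a n)
    (hs₁ : ∀ n, Measurable fun a => s₁ a n) (hx₂ : ∀ n, Measurable fun a => x₂ a n)
    (hs₂ : ∀ n, Measurable fun a => s₂ a n) (n : ℕ) :
    Measurable fun a => queue (x₁ a) (s₁ a) (x₂ a) (s₂ a) n :=
  measurable_undelivered hx₁ hs₁ hx₂ hs₂ n (measurable_clock hx₂ hs₂ (measurable_genTime hx₁ n))

theorem measurable_weight {Q : α → ℕ → ℝ} (hQ : ∀ n, Measurable fun a => Q a n) (n : ℕ) :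
    Measurable fun a => weight (Q a) n :=
  (Finset.measurable_fun_sum _ fun i _ => (hQ i).const_add 1).const_add 1

theorem measurable_queueDensity (hx₁ : ∀ n, Measurable fun a => x₁ a n)
    (hs₁ : ∀ n, Measurable fun a => s₁ a n) (hx₂ : ∀ n, Measurable fun a => x₂ a n)
    (hs₂ : ∀ n, Measurable fun a => s₂ a n) {u : α → ℝ} (hu : Measurable u) :
    Measurable fun a => queueDensity (x₁ a) (s₁ a) (x₂ a) (s₂ a) (u a) :=
  measurable_gridDensity (measurable_genTime hx₁)
    (measurable_weight (measurable_queue hx₁ hs₁ hx₂ hs₂))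
    (fun n => measurable_undelivered hx₁ hs₁ hx₂ hs₂ n (measurable_clock hx₂ hs₂ hu)) hu

theorem measurable_workDensity (hx₁ : ∀ n, Measurable fun a => x₁ a n)
    (hs₁ : ∀ n, Measurable fun a => s₁ a n) (hx₂ : ∀ n, Measurable fun a => x₂ a n)
    (hs₂ : ∀ n, Measurable fun a => s₂ a n) {u : α → ℝ} (hu : Measurable u) :
    Measurable fun a => workDensity (x₁ a) (s₁ a) (x₂ a) (s₂ a) (u a) :=
  measurable_gridDensity (fun n => measurable_clock hx₂ hs₂ (measurable_genTime hx₁ n))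
    (measurable_weight (measurable_queue hx₁ hs₁ hx₂ hs₂))
    (fun n => measurable_undeliveredLeft hx₁ hs₁ hx₂ hs₂ n hu) hu

theorem measurable_residualDensity (hx₂ : ∀ n, Measurable fun a => x₂ a n)
    (hs₂ : ∀ n, Measurable fun a => s₂ a n) {u : α → ℝ} (hu : Measurable u) :
    Measurable fun a => residualDensity (x₂ a) (s₂ a) (u a) :=
  measurable_gridDensity (measurable_genTime hx₂)
    (measurable_weight (measurable_occupation hx₂ hs₂))
    (fun n => (((measurable_genTime hx₂ n).add (measurable_occupation hx₂ hs₂ n)).sub hu).max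
      measurable_const) hu

end Measurability

/-! ### Linear rates along subsequences -/

section Renewal

/-- A monotone function with a linear rate along a sequence of linear growth has a linear rate. -/
theorem tendsto_div_of_tendsto_comp_div {F : ℝ → ℝ} (hF : Monotone F) (hF0 : ∀ t, 0 ≤ F t)
    {p : ℕ → ℝ} (hp : Monotone p) {a c : ℝ} (ha : 0 < a)
    (hpa : Tendsto (fun k : ℕ => p k / k) atTop (𝓝 a))
    (hFc : Tendsto (fun k : ℕ => F (p k) / k) atTop (𝓝 c)) :
    Tendsto (fun t => F t / t) atTop (𝓝 (c / a)) := by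
  have hone : Tendsto (fun k : ℕ => ((k + 1 : ℕ) : ℝ) / k) atTop (𝓝 1) := by
    have h := (tendsto_const_nhds (x := (1 : ℝ))).add
      (tendsto_inv_atTop_zero.comp (tendsto_natCast_atTop_atTop (R := ℝ)))
    rw [add_zero] at h
    refine h.congr' ?_
    filter_upwards [eventually_gt_atTop 0] with k hk
    have : (k : ℝ) ≠ 0 := by positivity
    simp only [Function.comp]; push_cast; field_simp
  have hpt : Tendsto p atTop atTop := by
    refine Tendsto.congr' ?_ (hpa.pos_mul_atTop ha (tendsto_natCast_atTop_atTop (R := ℝ)))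
    filter_upwards [eventually_gt_atTop 0] with k hk
    have : (k : ℝ) ≠ 0 := by positivity
    field_simp
  have hpos : ∀ᶠ k in atTop, 0 < p k := hpt.eventually_gt_atTop 0
  have hpa1 := hpa.comp (tendsto_add_atTop_nat 1)
  have hFc1 := hFc.comp (tendsto_add_atTop_nat 1)
  have hlow : Tendsto (fun k : ℕ => F (p k) / p (k + 1)) atTop (𝓝 (c / a)) := by
    have := hFc.div (hpa1.mul hone) (by simpa using ha.ne')
    rw [mul_one] at this
    refine this.congr' ?_
    filter_upwards [eventually_gt_atTop 0] with k hk
    have : (k : ℝ) ≠ 0 := by positivity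
    have : ((k + 1 : ℕ) : ℝ) ≠ 0 := by positivity
    simp only [Pi.div_apply, Function.comp]
    field_simp
  have hup : Tendsto (fun k : ℕ => F (p (k + 1)) / p k) atTop (𝓝 (c / a)) := by
    have := (hFc1.mul hone).div hpa ha.ne'
    rw [mul_one] at this
    refine this.congr' ?_
    filter_upwards [eventually_gt_atTop 0] with k hk
    have : (k : ℝ) ≠ 0 := by positivity
    have : ((k + 1 : ℕ) : ℝ) ≠ 0 := by positivity
    simp only [Pi.div_apply, Function.comp]
    field_simp
  have hidx : Tendsto (fun t => countUpTo p t - 1) atTop atTop :=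
    (tendsto_sub_atTop_nat 1).comp (tendsto_countUpTo hp hpt)
  have hev : ∀ᶠ t in atTop, 0 < p (countUpTo p t - 1) ∧ p (countUpTo p t - 1) ≤ t ∧
      t < p (countUpTo p t - 1 + 1) := by
    filter_upwards [hidx.eventually hpos,
      (tendsto_countUpTo hp hpt).eventually_ge_atTop 1] with t h1 h2
    refine ⟨h1, (lt_countUpTo_iff hp hpt).1 (by omega), ?_⟩
    by_contra! h
    have := (lt_countUpTo_iff hp hpt).2 h
    omega
  refine tendsto_of_tendsto_of_tendsto_of_le_of_le' (hlow.comp hidx) (hup.comp hidx) ?_ ?_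
  · filter_upwards [hev] with t ⟨h0, h1, h2⟩
    exact div_le_div₀ (hF0 t) (hF h1) (h0.trans_le h1) h2.le
  · filter_upwards [hev] with t ⟨h0, h1, h2⟩
    exact div_le_div₀ (hF0 _) (hF h2.le) h0 h1

end Renewal

section EmptyTimes

/-- The last index up to `N` that belongs to `A`. -/
noncomputable def lastIndex (A : Set ℕ) (N : ℕ) : ℕ := sSup {n | n ≤ N ∧ n ∈ A}

variable {A : Set ℕ}

theorem lastIndex_spec (h0 : 0 ∈ A) (N : ℕ) :
    lastIndex A N ≤ N ∧ lastIndex A N ∈ A ∧ ∀ n ∈ A, n ≤ N → n ≤ lastIndex A N := by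
  have hb : BddAbove {n | n ≤ N ∧ n ∈ A} := ⟨N, fun n hn => hn.1⟩
  have hm := Nat.sSup_mem (s := {n | n ≤ N ∧ n ∈ A}) ⟨0, Nat.zero_le N, h0⟩ hb
  exact ⟨hm.1, hm.2, fun n hn hN => le_csSup hb ⟨hN, hn⟩⟩

/-- If a sequence of positive linear rate is not larger at `N` than at the last index `lastIndex A N`,
then the indices in `A` have gaps of sublinear size. -/
theorem tendsto_lastIndex_div (h0 : 0 ∈ A) {Y : ℕ → ℝ} {c : ℝ} (hc : 0 < c)
    (hY : Tendsto (fun n : ℕ => Y n / n) atTop (𝓝 c)) (hYA : ∀ N, Y N ≤ Y (lastIndex A N)) :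
    Tendsto (lastIndex A) atTop atTop ∧
      Tendsto (fun N : ℕ => (lastIndex A N : ℝ) / N) atTop (𝓝 1) := by
  have hYt : Tendsto Y atTop atTop := by
    refine Tendsto.congr' ?_ (hY.pos_mul_atTop hc (tendsto_natCast_atTop_atTop (R := ℝ)))
    filter_upwards [eventually_gt_atTop 0] with k hk
    have : (k : ℝ) ≠ 0 := by positivity
    field_simp
  have hlast : Tendsto (lastIndex A) atTop atTop := by
    refine tendsto_atTop.2 fun m => ?_
    filter_upwards [hYt.eventually_gt_atTop (∑ i ∈ Finset.range m, |Y i|)] with N hN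
    by_contra! h
    have h1 := Finset.single_le_sum (f := fun i => |Y i|) (fun i _ => abs_nonneg _)
      (Finset.mem_range.2 h)
    linarith [hYA N, le_abs_self (Y (lastIndex A N))]
  refine ⟨hlast, ?_⟩
  have hY' := hY.comp hlast
  have hq := hY.div hY' hc.ne'
  rw [div_self hc.ne'] at hq
  refine tendsto_of_tendsto_of_tendsto_of_le_of_le' hq tendsto_const_nhds ?_ ?_
  · filter_upwards [eventually_gt_atTop 0, hlast.eventually_gt_atTop 0,
      (hYt.comp hlast).eventually_gt_atTop 0] with N hN hl hp
    have hN' : (0 : ℝ) < N := by exact_mod_cast hN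
    have hl' : (0 : ℝ) < lastIndex A N := by exact_mod_cast hl
    simp only [Function.comp] at hp
    simp only [Pi.div_apply, Function.comp]
    rw [div_div_eq_mul_div, div_le_iff₀ hp]
    have := hYA N
    calc Y N / N * lastIndex A N = (lastIndex A N / N) * Y N := by ring
      _ ≤ _ := mul_le_mul_of_nonneg_left this (by positivity)
  · refine Eventually.of_forall fun N => div_le_one_of_le₀ ?_ (Nat.cast_nonneg N)
    exact_mod_cast (lastIndex_spec h0 N).1

/-- For a monotone sequence it suffices to know the linear rate along indices with gaps of sublinear
size. -/
theorem tendsto_div_of_lastIndex (h0 : 0 ∈ A) (hlast : Tendsto (lastIndex A) atTop atTop)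
    (hdiv : Tendsto (fun N : ℕ => (lastIndex A N : ℝ) / N) atTop (𝓝 1))
    {F : ℕ → ℝ} (hF : Monotone F) {L : ℝ}
    (hL : Tendsto (fun N : ℕ => F N / N) (atTop ⊓ 𝓟 A) (𝓝 L)) :
    Tendsto (fun N : ℕ => F N / N) atTop (𝓝 L) := by
  have hnext : ∀ N, ∃ n, n ∈ A ∧ N ≤ n := fun N => by
    obtain ⟨M, hM⟩ := (hlast.eventually_ge_atTop N).exists
    exact ⟨_, (lastIndex_spec h0 M).2.1, hM⟩
  classical
  let nx : ℕ → ℕ := fun N => Nat.find (hnext N)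
  have hnx : ∀ N, nx N ∈ A ∧ N ≤ nx N := fun N => Nat.find_spec (hnext N)
  have hnxt : Tendsto nx atTop atTop := tendsto_atTop_mono (fun N => (hnx N).2) tendsto_id
  have hnl : ∀ N, lastIndex A (nx N - 1) ≤ N := by
    intro N
    obtain ⟨h1, h2, -⟩ := lastIndex_spec h0 (nx N - 1)
    by_contra! h
    have := Nat.find_min' (hnext N) ⟨h2, h.le⟩
    change nx N ≤ _ at this
    omega
  have hnd : Tendsto (fun N : ℕ => (nx N : ℝ) / N) atTop (𝓝 1) := by
    have hm : Tendsto (fun N => nx N - 1) atTop atTop := (tendsto_sub_atTop_nat 1).comp hnxt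
    have hone : Tendsto (fun m : ℕ => (m : ℝ) / (m + 1)) atTop (𝓝 1) :=
      tendsto_natCast_div_add_atTop 1
    have h1 := (hdiv.mul hone).comp hm
    rw [one_mul] at h1
    have h2 : Tendsto (fun N : ℕ => (N : ℝ) / nx N) atTop (𝓝 1) := by
      refine tendsto_of_tendsto_of_tendsto_of_le_of_le' h1 tendsto_const_nhds ?_ ?_
      · filter_upwards [hnxt.eventually_gt_atTop 1] with N hN
        have e : ((nx N - 1 : ℕ) : ℝ) + 1 = nx N := by
          rw [Nat.cast_sub (by omega)]; simp
        have hne : ((nx N - 1 : ℕ) : ℝ) ≠ 0 := by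
          have : 0 < nx N - 1 := by omega
          positivity
        simp only [Function.comp, e]
        rw [div_mul_div_cancel₀ hne]
        gcongr
        exact hnl N
      · refine Eventually.of_forall fun N => div_le_one_of_le₀ ?_ (Nat.cast_nonneg _)
        exact_mod_cast (hnx N).2
    have h3 := h2.inv₀ one_ne_zero
    simpa using h3
  have hA1 : Tendsto (lastIndex A) atTop (atTop ⊓ 𝓟 A) :=
    tendsto_inf.2 ⟨hlast, tendsto_principal.2 (Eventually.of_forall fun N =>
      (lastIndex_spec h0 N).2.1)⟩
  have hA2 : Tendsto nx atTop (atTop ⊓ 𝓟 A) :=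
    tendsto_inf.2 ⟨hnxt, tendsto_principal.2 (Eventually.of_forall fun N => (hnx N).1)⟩
  have hl := (hL.comp hA1).mul hdiv
  have hu := (hL.comp hA2).mul hnd
  rw [mul_one] at hl hu
  refine tendsto_of_tendsto_of_tendsto_of_le_of_le' hl hu ?_ ?_
  · filter_upwards [hlast.eventually_gt_atTop 0] with N hN
    have : (lastIndex A N : ℝ) ≠ 0 := by positivity
    simp only [Function.comp]
    rw [div_mul_div_cancel₀ this]
    exact div_le_div_of_nonneg_right (hF (lastIndex_spec h0 N).1) (Nat.cast_nonneg N)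
  · filter_upwards [hnxt.eventually_gt_atTop 0] with N hN
    have : (nx N : ℝ) ≠ 0 := by positivity
    simp only [Function.comp]
    rw [div_mul_div_cancel₀ this]
    exact div_le_div_of_nonneg_right (hF (hnx N).2) (Nat.cast_nonneg N)

end EmptyTimes

section LimitAlgebra

/-- The linear equations satisfied, up to errors that are small compared with `u + q`, by the mean
queue length `q`, the mean sojourn time `i`, the mean work `w`, the mean residual time `r` and the
mean priority time `d` determine the limit of `i`. -/
theorem tendsto_of_balance_equations {l : Filter ℕ} {q i w r d u ea eb ed : ℕ → ℝ} {la mu th ρ : ℝ}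
    (hmu : 0 < mu) (hκ : 0 < 1 - th - la / mu)
    (hea : Tendsto ea l (𝓝 0)) (heb : Tendsto eb l (𝓝 0)) (hed : Tendsto ed l (𝓝 0))
    (hu : Tendsto u l (𝓝 1)) (hr : Tendsto r l (𝓝 ρ))
    (h1 : ∀ᶠ n in l, q n - 1 - la * i n = ea n * (u n + q n))
    (h2 : ∀ᶠ n in l, q n - mu * w n = eb n * (u n + q n))
    (h3 : ∀ᶠ n in l, d n - th * i n = ed n * (u n + q n))
    (h4 : ∀ᶠ n in l, i n = w n + r n + d n) :
    Tendsto i l (𝓝 ((1 / mu + ρ) / (1 - th - la / mu))) := by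
  have h1a : Tendsto (fun n => 1 - ea n) l (𝓝 1) := by simpa using hea.const_sub 1
  -- the total error in the equation for `i`
  have he : Tendsto (fun n => (ea n - eb n) / mu + ed n) l (𝓝 0) := by
    simpa using ((hea.sub heb).div_const mu).add hed
  have hden : Tendsto (fun n => 1 - th - la / mu - ((ea n - eb n) / mu + ed n) * la / (1 - ea n)) l
      (𝓝 (1 - th - la / mu)) := by
    simpa using ((he.mul_const la).div h1a one_ne_zero).const_sub (1 - th - la / mu)
  have hnum : Tendsto (fun n => 1 / mu + r n + ((ea n - eb n) / mu + ed n) *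
      (u n + (1 + ea n * u n) / (1 - ea n))) l (𝓝 (1 / mu + ρ)) := by
    have := (hr.const_add (1 / mu)).add
      (he.mul (hu.add (((hea.mul hu).const_add 1).div h1a one_ne_zero)))
    simpa using this
  refine (hnum.div hden hκ.ne').congr' ?_
  filter_upwards [h1, h2, h3, h4, h1a.eventually_ne one_ne_zero, hden.eventually_ne hκ.ne'] with
    n e1 e2 e3 e4 hne hne'
  simp only [Pi.div_apply]
  rw [div_eq_iff hne']
  have hq : q n = (1 + la * i n + ea n * u n) / (1 - ea n) := by
    rw [eq_div_iff hne]; linear_combination e1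
  have hqu : u n + (1 + ea n * u n) / (1 - ea n) = u n + q n - la * i n / (1 - ea n) := by
    rw [hq]; field_simp; ring
  have hw : w n = (q n - eb n * (u n + q n)) / mu := by
    rw [eq_div_iff hmu.ne']; linear_combination -e2
  rw [hqu]
  have hd : d n = th * i n + ed n * (u n + q n) := by linear_combination e3
  have hq' : q n = 1 + la * i n + ea n * (u n + q n) := by linear_combination e1
  have : i n = (1 + la * i n + ea n * (u n + q n) - eb n * (u n + q n)) / mu + r n +
      (th * i n + ed n * (u n + q n)) := by
    rw [← hq', ← hd, ← hw]; exact e4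
  linear_combination -this

end LimitAlgebra

/-! ### Laws of large numbers and sampling along a stream -/

section Averages

variable {ι : Type*} (ν : ι → Measure ℝ) [∀ i, IsProbabilityMeasure (ν i)]

theorem integral_exp_id {r : ℝ} (hr : 0 < r) : ∫ x, x ∂(expMeasure r) = 1 / r := by
  simpa using integral_pow_expMeasure hr 1

/-- The law of large numbers for exponential coordinates. -/
theorem ae_tendsto_average {e : ℕ → ι} (he : Function.Injective e) {r : ℝ} (hr : 0 < r)
    (hν : ∀ n, ν (e n) = expMeasure r) :
    ∀ᵐ v ∂(Measure.infinitePi ν),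
      Tendsto (fun n : ℕ => (∑ i ∈ Finset.range n, v (e i)) / (n : ℝ)) atTop (𝓝 (1 / r)) := by
  have hmap : ∀ n, (Measure.infinitePi ν).map (fun v => v (e n)) = expMeasure r := fun n => by
    rw [← hν n]; exact Measure.infinitePi_map_eval ν (e n)
  have hev : ∀ n, AEMeasurable (fun v : ι → ℝ => v (e n)) (Measure.infinitePi ν) := fun n =>
    (measurable_pi_apply (e n)).aemeasurable
  have hint : Integrable (fun x : ℝ => x) (expMeasure r) := by
    simpa using integrable_pow_expMeasure hr 1
  have := strong_law_ae_real (μ := Measure.infinitePi ν) (fun n v => v (e n))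
    ?_ ?_ fun n => ⟨hev n, hev 0, by rw [hmap, hmap]⟩
  · convert this using 4
    rw [← integral_exp_id hr, ← hmap 0, integral_map (hev 0) (by fun_prop)]
  · rw [← hmap 0] at hint
    exact (integrable_map_measure (by fun_prop) (hev 0)).1 hint
  · intro i j hij
    exact (iIndepFun_infinitePi (P := ν) (X := fun _ x => x) (by fun_prop)).indepFun (he.ne hij)

/-- The minimum of two independent exponential variables is exponential. -/
theorem map_min_infinitePi {i j : ι} (hij : i ≠ j) {r r' : ℝ} (hr : 0 < r) (hr' : 0 < r')
    (hi : ν i = expMeasure r) (hj : ν j = expMeasure r') :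
    (Measure.infinitePi ν).map (fun v => min (v i) (v j)) = expMeasure (r + r') := by
  have hm : Measurable fun v : ι → ℝ => min (v i) (v j) := by fun_prop
  have := isProbabilityMeasure_expMeasure hr
  have := isProbabilityMeasure_expMeasure hr'
  have := isProbabilityMeasure_expMeasure (add_pos hr hr')
  have : IsProbabilityMeasure ((Measure.infinitePi ν).map fun v => min (v i) (v j)) :=
    Measure.isProbabilityMeasure_map hm.aemeasurable
  have hcdf : ∀ u, (Measure.infinitePi ν).map (fun v => min (v i) (v j)) (Set.Ici u) =
      expMeasure r (Set.Ici u) * expMeasure r' (Set.Ici u) := by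
    intro u
    have h1 : (fun v : ι → ℝ => min (v i) (v j)) ⁻¹' Set.Ici u =
        (fun v => (v i, v j)) ⁻¹' (Set.Ici u ×ˢ Set.Ici u) := by
      ext v; simp
    rw [Measure.map_apply hm measurableSet_Ici, h1, ← Measure.map_apply (by fun_prop)
      (measurableSet_Ici.prod measurableSet_Ici), Measure.infinitePi_map_eval_prod hij,
      Measure.prod_prod, hi, hj]
  refine Measure.ext_of_Ici _ _ fun u => ?_
  rw [hcdf]
  rcases le_total 0 u with hu | hu
  · rw [expMeasure_Ici hr hu, expMeasure_Ici hr' hu, expMeasure_Ici (add_pos hr hr') hu,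
      ← ENNReal.ofReal_mul (Real.exp_pos _).le, ← Real.exp_add]
    congr 2; ring
  · have h1 : ∀ {q : ℝ}, 0 < q → expMeasure q (Set.Ici u) = 1 := by
      intro q hq
      have := isProbabilityMeasure_expMeasure hq
      refine (prob_compl_eq_zero_iff measurableSet_Ici).1 ?_
      have := ae_pos_expMeasure (r := q)
      rw [ae_iff] at this
      refine measure_mono_null (fun x hx => ?_) this
      simp only [Set.mem_compl_iff, Set.mem_Ici, not_le] at hx
      simp only [Set.mem_ofPred_eq, not_lt]
      linarith
    rw [h1 hr, h1 hr', h1 (add_pos hr hr'), one_mul]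

/-- The law of large numbers for powers of minima of exponential coordinates. -/
theorem ae_tendsto_average_min {e e' : ℕ → ι} (he : Function.Injective e)
    (he' : Function.Injective e') (hee : ∀ m n, e m ≠ e' n) {r r' : ℝ} (hr : 0 < r) (hr' : 0 < r')
    (hν : ∀ n, ν (e n) = expMeasure r) (hν' : ∀ n, ν (e' n) = expMeasure r') (d : ℕ) :
    ∀ᵐ v ∂(Measure.infinitePi ν),
      Tendsto (fun n : ℕ => (∑ i ∈ Finset.range n, min (v (e i)) (v (e' i)) ^ d) / (n : ℝ)) atTop
        (𝓝 ((d.factorial : ℝ) / (r + r') ^ d)) := by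
  have hmap : ∀ n, (Measure.infinitePi ν).map (fun v => min (v (e n)) (v (e' n)) ^ d) =
      (expMeasure (r + r')).map (fun x => x ^ d) := fun n => by
    rw [← map_min_infinitePi ν (hee n n) hr hr' (hν n) (hν' n), Measure.map_map (by fun_prop)
      (by fun_prop)]
    rfl
  have hint := integrable_pow_expMeasure (add_pos hr hr') d
  have h0 := map_min_infinitePi ν (hee 0 0) hr hr' (hν 0) (hν' 0)
  have := strong_law_ae_real (μ := Measure.infinitePi ν)
    (fun n v => min (v (e n)) (v (e' n)) ^ d)
    ?_ ?_ fun n => ⟨by fun_prop, by fun_prop, by rw [hmap, hmap]⟩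
  · convert this using 4
    rw [← integral_pow_expMeasure (add_pos hr hr') d, ← h0,
      integral_map (by fun_prop) (continuous_pow d).aestronglyMeasurable]
  · rw [← h0] at hint
    exact (integrable_map_measure (continuous_pow d).aestronglyMeasurable (by fun_prop)).1 hint
  · intro i j hij
    have := (iIndepFun_infinitePi (P := ν) (X := fun _ x => x) (by fun_prop)).indepFun_prodMk_prodMk
      (fun i => measurable_pi_apply i) (e i) (e' i) (e j) (e' j) (he.ne hij) (hee i j)
      (hee j i).symm (he'.ne hij)
    exact this.comp (φ := fun p : ℝ × ℝ => min p.1 p.2 ^ d) (ψ := fun p : ℝ × ℝ => min p.1 p.2 ^ d)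
      (by fun_prop) (by fun_prop)

end Averages

section Streams

variable {ι : Type*} (ν : ι → Measure ℝ) [∀ i, IsProbabilityMeasure (ν i)]

/-- The coordinates that are not of the form `e m` with `m ≥ n`. -/
def coordsBefore (e : ℕ → ι) (n : ℕ) : Set ι := {c | ∀ m, c = e m → m < n}

theorem coordsBefore_mono (e : ℕ → ι) : Monotone (coordsBefore e) :=
  fun _ _ hij _ hc m hm => (hc m hm).trans_le hij

theorem notMem_coordsBefore (e : ℕ → ι) (n : ℕ) : e n ∉ coordsBefore e n :=
  fun h => lt_irrefl n (h n rfl)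

theorem mem_coordsBefore {e : ℕ → ι} (he : Function.Injective e) {m n : ℕ} :
    e m ∈ coordsBefore e n ↔ m < n :=
  ⟨fun h => h m rfl, fun h _ hk => he hk ▸ h⟩

theorem mem_coordsBefore_of_ne {e : ℕ → ι} {c : ι} (hc : ∀ m, c ≠ e m) (n : ℕ) :
    c ∈ coordsBefore e n := fun m hm => absurd hm (hc m)

open Classical in
theorem piecewise_one_pos {v : ι → ℝ} (hv : ∀ i, 0 < v i) (S : Set ι) (i : ι) :
    0 < S.piecewise v (fun _ => (1 : ℝ)) i := by
  by_cases hi : i ∈ S <;> simp [hi, hv i]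

open Classical in
/-- Poisson arrivals see time averages, for the stream with interarrival times `e 0, e 1, …` and an
integrand whose value at time `u` does not depend on the points of this stream after time `u`. -/
theorem ae_tendsto_sum_genTime [Countable ι] {e : ℕ → ι} (he : Function.Injective e) {r : ℝ}
    (hr : 0 < r) (hν : ∀ n, ν (e n) = expMeasure r) (hpos : ∀ i, ∀ᵐ x ∂(ν i), 0 < x)
    {h : (ι → ℝ) → ℝ → ℝ}
    (hm : Measurable fun p : (ι → ℝ) × ℝ => h p.1 p.2)
    (hh : ∀ v, (∀ i, 0 < v i) → ∀ u, h v u ∈ Set.Icc 0 1)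
    (hcausal : ∀ n v v', (∀ i, 0 < v i) → (∀ i, 0 < v' i) →
      (∀ c ∈ coordsBefore e n, v c = v' c) → ∀ u, u ≤ genTime (fun m => v (e m)) n →
      u ≤ genTime (fun m => v' (e m)) n → h v u = h v' u)
    (hL2 : ∫⁻ v, (∫⁻ u, ENNReal.ofReal (h v u ^ 2)) ∂(Measure.infinitePi ν) ≠ ⊤) :
    (∀ᵐ v ∂(Measure.infinitePi ν),
      (∃ l : ℝ, Tendsto (fun n => ∑ k ∈ Finset.range (n + 1), h v (genTime (fun m => v (e m)) k) -
        r * ∫ u in Set.Ioc 0 (genTime (fun m => v (e m)) n), h v u) atTop (𝓝 l)) ∧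
      Tendsto (fun n => h v (genTime (fun m => v (e m)) n)) atTop (𝓝 0)) ∧
    ∑' n, ∫⁻ v, ENNReal.ofReal (h v (genTime (fun m => v (e m)) n) ^ 2)
      ∂(Measure.infinitePi ν) ≠ ⊤ := by
  have hgm : ∀ n, Measurable fun v : ι → ℝ => genTime (fun m => v (e m)) n := fun n =>
    measurable_genTime (fun m => measurable_pi_apply (e m)) n
  have hKm : ∀ n, Measurable fun v : ι → ℝ => h v (genTime (fun m => v (e m)) n) := fun n =>
    hm.comp (measurable_id.prodMk (hgm n))
  have hge : ∀ (v : ι → ℝ) n u, genTime (fun m => Function.update v (e n) u (e m)) n =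
      genTime (fun m => v (e m)) n - v (e n) + u := by
    intro v n u
    rw [← genTime_update]
    refine genTime_congr fun m _ => ?_
    by_cases hmn : m = n
    · subst hmn; simp
    · rw [Function.update_of_ne hmn, Function.update_of_ne (he.ne hmn)]
  have hupd : ∀ n (v : ι → ℝ), (∀ i, 0 < v i) → ∀ u ∈ Set.Ioc 0 (v (e n)),
      h (Function.update v (e n) u) (genTime (fun m => Function.update v (e n) u (e m)) n) =
        h v (genTime (fun m => v (e m)) n - v (e n) + u) := by
    intro n v hv u hu
    rw [hge]
    refine hcausal n _ _ (update_pos hv hu.1) hv (fun c hc => ?_) _ (hge v n u).ge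
      (by linarith [hu.2])
    exact Function.update_of_ne (fun hcn => notMem_coordsBefore e n (by rw [← hcn]; exact hc)) _ _
  have hps : ∀ n (v : ι → ℝ), (∀ i, 0 < v i) →
      genTime (fun m => v (e m)) n ≤ genTime (fun m => v (e m)) (n + 1) - v (e (n + 1)) := by
    intro n v _
    rw [genTime_succ, add_sub_cancel_right]
  refine ⟨?_, ?_⟩
  · refine ae_tendsto_sum_sub_integral ν (coordsBefore_mono e) (notMem_coordsBefore e)
      (fun n => (mem_coordsBefore he).2 n.lt_succ_self) hr hν hpos hKm
      (fun v => hm.comp (measurable_const.prodMk measurable_id)) hh ?_ hupd ?_ ?_ hL2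
    · intro n v hv
      have hg : genTime (fun m => (coordsBefore e (n + 1)).piecewise v (fun _ => (1 : ℝ)) (e m)) n =
          genTime (fun m => v (e m)) n := genTime_congr fun m hmn =>
        Set.piecewise_eq_of_mem _ _ _ ((mem_coordsBefore he).2 (Nat.lt_succ_of_le hmn))
      rw [hg]
      refine hcausal n _ _ (piecewise_one_pos hv _) hv (fun c hc => ?_) _ hg.ge le_rfl
      exact Set.piecewise_eq_of_mem _ _ _ (coordsBefore_mono e n.le_succ hc)
    · intro v _
      rw [genTime_zero, sub_self]
      exact ⟨le_rfl, by simp⟩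
    · intro n v hv
      refine ⟨hps n v hv, ?_⟩
      rw [genTime_succ, add_sub_cancel_right]
      simp
  · have h1 := tsum_lintegral_sq_le ν (idx := e) hpos hKm hupd hps
    have h2 : ∀ n, ∫⁻ v, ENNReal.ofReal (h v (genTime (fun m => v (e m)) n) ^ 2)
        ∂(Measure.infinitePi ν) = ENNReal.ofReal r * ∫⁻ v, (∫⁻ u in Set.Ioc 0 (v (e n)),
          ENNReal.ofReal (h (Function.update v (e n) u)
            (genTime (fun m => Function.update v (e n) u (e m)) n) ^ 2))
              ∂(Measure.infinitePi ν) := fun n =>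
      lintegral_eq_lintegral_Ioc_update ν hr (hν n) ((hKm n).pow_const 2).ennreal_ofReal
    simp_rw [h2]
    rw [ENNReal.tsum_mul_left]
    exact ENNReal.mul_ne_top ENNReal.ofReal_ne_top (ne_top_of_le_ne_top hL2 h1)

/-- A generation time is almost surely different from any function of the other coordinates. -/
theorem ae_genTime_ne {e : ℕ → ι} (he : Function.Injective e) {r : ℝ}
    (hν : ∀ n, ν (e n) = expMeasure r) (n : ℕ) {g : (ι → ℝ) → ℝ} (hg : Measurable g)
    (hgu : ∀ v w, (∀ c, c ≠ e n → v c = w c) → g v = g w) :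
    ∀ᵐ v ∂(Measure.infinitePi ν), genTime (fun m => v (e m)) n ≠ g v := by
  classical
  have hgm : Measurable fun v : ι → ℝ => genTime (fun m => v (e m)) n :=
    measurable_genTime (fun m => measurable_pi_apply (e m)) n
  have hset : MeasurableSet {v : ι → ℝ | genTime (fun m => v (e m)) n = g v} :=
    measurableSet_eq_fun hgm hg
  rw [ae_iff]
  simp only [not_not]
  rw [← lintegral_indicator_one hset, lintegral_resample ν (e n) (measurable_one.indicator hset)]
  refine lintegral_eq_zero_of_ae_eq_zero (ae_of_all _ fun v => ?_)
  have hge : ∀ x, genTime (fun m => Function.update v (e n) x (e m)) n =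
      genTime (fun m => v (e m)) n - v (e n) + x := by
    intro x
    rw [← genTime_update]
    refine genTime_congr fun m _ => ?_
    by_cases hmn : m = n
    · subst hmn; simp
    · rw [Function.update_of_ne hmn, Function.update_of_ne (he.ne hmn)]
  have hgu' : ∀ x, g (Function.update v (e n) x) = g v := fun x =>
    hgu _ _ fun c hc => Function.update_of_ne hc _ _
  have : ∀ x, ({v : ι → ℝ | genTime (fun m => v (e m)) n = g v}).indicator (1 : (ι → ℝ) → ENNReal)
      (Function.update v (e n) x) =
      ({g v - (genTime (fun m => v (e m)) n - v (e n))} : Set ℝ).indicator 1 x := by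
    intro x
    simp only [Set.indicator, Set.mem_ofPred_eq, Set.mem_singleton_iff, hge, hgu', Pi.one_apply]
    congr 1
    rw [eq_iff_iff]
    constructor <;> intro h <;> linarith
  simp_rw [this]
  rw [lintegral_indicator_one (measurableSet_singleton _), hν n]
  have hac : expMeasure r ≪ volume := by
    unfold expMeasure gammaMeasure
    exact withDensity_absolutelyContinuous _ _
  exact hac (by simp)

end Streams

/-! ### The input on its canonical space -/

section Input

/-- The index set of the input: the interarrival and service times of the ordinary stream, then
those of the priority stream. -/
abbrev Coord : Type := (ℕ ⊕ ℕ) ⊕ (ℕ ⊕ ℕ)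

/-- The coordinates of the ordinary interarrival times. -/
abbrev coordX₁ (n : ℕ) : Coord := Sum.inl (Sum.inl n)

/-- The coordinates of the ordinary service times. -/
abbrev coordS₁ (n : ℕ) : Coord := Sum.inl (Sum.inr n)

/-- The coordinates of the priority interarrival times. -/
abbrev coordX₂ (n : ℕ) : Coord := Sum.inr (Sum.inl n)

/-- The coordinates of the priority service times. -/
abbrev coordS₂ (n : ℕ) : Coord := Sum.inr (Sum.inr n)

theorem coordX₁_injective : Function.Injective coordX₁ := fun _ _ h => by simpa using h
theorem coordS₁_injective : Function.Injective coordS₁ := fun _ _ h => by simpa using h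
theorem coordX₂_injective : Function.Injective coordX₂ := fun _ _ h => by simpa using h
theorem coordS₂_injective : Function.Injective coordS₂ := fun _ _ h => by simpa using h

/-- The marginal laws of the input. -/
structure IsInputLaw (ν : Coord → Measure ℝ) (lam₁ lam₂ mu₁ mu₂ : ℝ) : Prop where
  lam₁_pos : 0 < lam₁
  lam₂_pos : 0 < lam₂
  mu₁_pos : 0 < mu₁
  mu₂_pos : 0 < mu₂
  law_X₁ : ∀ n, ν (coordX₁ n) = expMeasure lam₁
  law_S₁ : ∀ n, ν (coordS₁ n) = expMeasure mu₁
  law_X₂ : ∀ n, ν (coordX₂ n) = expMeasure lam₂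
  law_S₂ : ∀ n, ν (coordS₂ n) = expMeasure mu₂

/-- The ordinary interarrival times. -/
abbrev inX₁ (v : Coord → ℝ) : ℕ → ℝ := fun n => v (coordX₁ n)

/-- The ordinary service times. -/
abbrev inS₁ (v : Coord → ℝ) : ℕ → ℝ := fun n => v (coordS₁ n)

/-- The priority interarrival times. -/
abbrev inX₂ (v : Coord → ℝ) : ℕ → ℝ := fun n => v (coordX₂ n)

/-- The priority service times. -/
abbrev inS₂ (v : Coord → ℝ) : ℕ → ℝ := fun n => v (coordS₂ n)

variable {ν : Coord → Measure ℝ} {lam₁ lam₂ mu₁ mu₂ : ℝ}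

theorem IsInputLaw.ae_pos (h : IsInputLaw ν lam₁ lam₂ mu₁ mu₂) (i : Coord) : ∀ᵐ x ∂(ν i), 0 < x := by
  rcases i with (n | n) | (n | n)
  · rw [h.law_X₁ n]; exact ae_pos_expMeasure
  · rw [h.law_S₁ n]; exact ae_pos_expMeasure
  · rw [h.law_X₂ n]; exact ae_pos_expMeasure
  · rw [h.law_S₂ n]; exact ae_pos_expMeasure

section Measurable

variable {α : Type*} [MeasurableSpace α] {f : α → Coord → ℝ} {u : α → ℝ}

theorem measurable_queueDensity_comp (hf : Measurable f) (hu : Measurable u) :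
    Measurable fun a => queueDensity (inX₁ (f a)) (inS₁ (f a)) (inX₂ (f a)) (inS₂ (f a)) (u a) :=
  have h := measurable_pi_iff.1 hf
  measurable_queueDensity (fun _ => h _) (fun _ => h _) (fun _ => h _) (fun _ => h _) hu

theorem measurable_workDensity_comp (hf : Measurable f) (hu : Measurable u) :
    Measurable fun a => workDensity (inX₁ (f a)) (inS₁ (f a)) (inX₂ (f a)) (inS₂ (f a)) (u a) :=
  have h := measurable_pi_iff.1 hf
  measurable_workDensity (fun _ => h _) (fun _ => h _) (fun _ => h _) (fun _ => h _) hu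

theorem measurable_residualDensity_comp (hf : Measurable f) (hu : Measurable u) :
    Measurable fun a => residualDensity (inX₂ (f a)) (inS₂ (f a)) (u a) :=
  have h := measurable_pi_iff.1 hf
  measurable_residualDensity (fun _ => h _) (fun _ => h _) hu

theorem measurable_queue_comp (hf : Measurable f) (n : ℕ) :
    Measurable fun a => queue (inX₁ (f a)) (inS₁ (f a)) (inX₂ (f a)) (inS₂ (f a)) n :=
  have h := measurable_pi_iff.1 hf
  measurable_queue (fun _ => h _) (fun _ => h _) (fun _ => h _) (fun _ => h _) n

end Measurable

variable [∀ i, IsProbabilityMeasure (ν i)]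

/-- The mean of the sum that bounds the squared densities is finite: the queue seen by packet `n` is
independent of the interarrival time that follows. -/
theorem lintegral_tsum_queue_ne_top (h : IsInputLaw ν lam₁ lam₂ mu₁ mu₂) :
    ∫⁻ v, (∑' n, ENNReal.ofReal ((queue (inX₁ v) (inS₁ v) (inX₂ v) (inS₂ v) n /
      weight (queue (inX₁ v) (inS₁ v) (inX₂ v) (inS₂ v)) n) ^ 2) *
        ENNReal.ofReal (v (coordX₁ (n + 1)))) ∂(Measure.infinitePi ν) ≠ ⊤ := by
  set g : ℕ → (Coord → ℝ) → ENNReal := fun n v =>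
    ENNReal.ofReal ((queue (inX₁ v) (inS₁ v) (inX₂ v) (inS₂ v) n /
      weight (queue (inX₁ v) (inS₁ v) (inX₂ v) (inS₂ v)) n) ^ 2) with hg
  have hgm : ∀ n, Measurable (g n) := fun n =>
    (((measurable_queue_comp measurable_id n).div
      (measurable_weight (measurable_queue_comp measurable_id) n)).pow_const 2).ennreal_ofReal
  have hupd : ∀ n v u, g n (Function.update v (coordX₁ (n + 1)) u) = g n v := by
    intro n v u
    have hx : ∀ j ≤ n, inX₁ (Function.update v (coordX₁ (n + 1)) u) j = inX₁ v j := fun j hj =>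
      Function.update_of_ne (by simp; omega) _ _
    have hs : inS₁ (Function.update v (coordX₁ (n + 1)) u) = inS₁ v := by ext; simp
    have hx₂ : inX₂ (Function.update v (coordX₁ (n + 1)) u) = inX₂ v := by ext; simp
    have hs₂ : inS₂ (Function.update v (coordX₁ (n + 1)) u) = inS₂ v := by ext; simp
    have hq : ∀ j ≤ n, queue (inX₁ (Function.update v (coordX₁ (n + 1)) u)) (inS₁ v) (inX₂ v)
        (inS₂ v) j = queue (inX₁ v) (inS₁ v) (inX₂ v) (inS₂ v) j := fun j hj =>
      queue_congr (fun i hi => by rw [genTime_congr fun m hm => hx m (hm.trans (hi.trans hj))])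
        fun _ _ => rfl
    simp only [hg, hs, hx₂, hs₂]
    rw [hq n le_rfl, weight_congr hq]
  have hterm : ∀ n, ENNReal.ofReal lam₁ * ∫⁻ v, g n v * ENNReal.ofReal (v (coordX₁ (n + 1)))
      ∂(Measure.infinitePi ν) = ∫⁻ v, g n v ∂(Measure.infinitePi ν) := by
    intro n
    rw [lintegral_eq_lintegral_Ioc_update ν h.lam₁_pos (h.law_X₁ (n + 1)) (hgm n)]
    simp only [hupd, setLIntegral_const, Real.volume_Ioc, sub_zero]
  have hmul : ENNReal.ofReal lam₁ * ∫⁻ v, (∑' n, g n v * ENNReal.ofReal (v (coordX₁ (n + 1))))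
      ∂(Measure.infinitePi ν) ≤ 4 := by
    rw [lintegral_tsum fun n => by fun_prop, ← ENNReal.tsum_mul_left]
    simp_rw [hterm]
    rw [← lintegral_tsum fun n => (hgm n).aemeasurable]
    refine (lintegral_mono_ae ?_).trans (by simp : ∫⁻ _, 4 ∂(Measure.infinitePi ν) ≤ 4)
    filter_upwards [ae_forall_pos ν h.ae_pos] with v hv
    exact tsum_sq_div_weight_le queue_nonneg (queue_zero fun _ => hv _).le
      (queue_succ_le (fun _ => hv _) fun _ => hv _)
  intro htop
  rw [htop, ENNReal.mul_top (by simpa using h.lam₁_pos)] at hmul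
  exact absurd hmul (by simp)

theorem lintegral_sq_queueDensity_ne_top (h : IsInputLaw ν lam₁ lam₂ mu₁ mu₂) :
    ∫⁻ v, (∫⁻ u, ENNReal.ofReal (queueDensity (inX₁ v) (inS₁ v) (inX₂ v) (inS₂ v) u ^ 2))
      ∂(Measure.infinitePi ν) ≠ ⊤ := by
  refine ne_top_of_le_ne_top (lintegral_tsum_queue_ne_top h) (lintegral_mono_ae ?_)
  filter_upwards [ae_forall_pos ν h.ae_pos] with v hv
  exact lintegral_sq_queueDensity_le fun _ => hv _

theorem lintegral_sq_workDensity_ne_top (h : IsInputLaw ν lam₁ lam₂ mu₁ mu₂) :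
    ∫⁻ v, (∫⁻ u, ENNReal.ofReal (workDensity (inX₁ v) (inS₁ v) (inX₂ v) (inS₂ v) u ^ 2))
      ∂(Measure.infinitePi ν) ≠ ⊤ := by
  refine ne_top_of_le_ne_top (lintegral_tsum_queue_ne_top h) (lintegral_mono_ae ?_)
  filter_upwards [ae_forall_pos ν h.ae_pos] with v hv
  exact lintegral_sq_workDensity_le fun _ => hv _

theorem lintegral_sq_residualDensity_ne_top (h : IsInputLaw ν lam₁ lam₂ mu₁ mu₂) :
    ∫⁻ v, (∫⁻ u, ENNReal.ofReal (residualDensity (inX₂ v) (inS₂ v) u ^ 2))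
      ∂(Measure.infinitePi ν) ≠ ⊤ := by
  have hle : ∫⁻ v, (∫⁻ u, ENNReal.ofReal (residualDensity (inX₂ v) (inS₂ v) u ^ 2))
      ∂(Measure.infinitePi ν) ≤ ∫⁻ v, (∑' n : ℕ, ENNReal.ofReal (1 / ((n : ℝ) + 1) ^ 2) *
        ENNReal.ofReal (v (coordX₂ (n + 1)) ^ 3)) ∂(Measure.infinitePi ν) := by
    refine lintegral_mono_ae ?_
    filter_upwards [ae_forall_pos ν h.ae_pos] with v hv
    exact lintegral_sq_residualDensity_le (fun _ => hv _) fun _ => hv _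
  refine ne_top_of_le_ne_top ?_ hle
  have hm : ∀ n : ℕ, Measurable fun v : Coord → ℝ => ENNReal.ofReal (v (coordX₂ (n + 1)) ^ 3) :=
    fun n => ((measurable_pi_apply _).pow_const 3).ennreal_ofReal
  rw [lintegral_tsum fun n => ((hm n).const_mul _).aemeasurable]
  have hterm : ∀ n : ℕ, ∫⁻ v, ENNReal.ofReal (1 / ((n : ℝ) + 1) ^ 2) *
      ENNReal.ofReal (v (coordX₂ (n + 1)) ^ 3) ∂(Measure.infinitePi ν) =
      ENNReal.ofReal (1 / ((n : ℝ) + 1) ^ 2) * ENNReal.ofReal (Nat.factorial 3 / lam₂ ^ 3) := by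
    intro n
    rw [lintegral_const_mul _ (hm n)]
    congr 1
    rw [← lintegral_pow_expMeasure h.lam₂_pos 3, ← h.law_X₂ (n + 1),
      ← Measure.infinitePi_map_eval ν (coordX₂ (n + 1)),
      lintegral_map (by fun_prop) (measurable_pi_apply _)]
  simp_rw [hterm]
  rw [ENNReal.tsum_mul_right]
  refine ENNReal.mul_ne_top ?_ ENNReal.ofReal_ne_top
  have hs : Summable fun n : ℕ => 1 / ((n : ℝ) + 1) ^ 2 := by
    have := (summable_nat_add_iff 1).2 (Real.summable_one_div_nat_pow.2 one_lt_two)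
    simpa using this
  rw [← ENNReal.ofReal_tsum_of_nonneg (fun n => by positivity) hs]
  exact ENNReal.ofReal_ne_top

/-- Two inputs that agree on `coordsBefore coordX₁ n` agree up to ordinary packet `n`. -/
theorem agree_of_coordsBefore_coordX₁ {v w : Coord → ℝ} {n : ℕ}
    (hvw : ∀ c ∈ coordsBefore coordX₁ n, v c = w c) : (∀ j < n, inX₁ v j = inX₁ w j) ∧
      inS₁ v = inS₁ w ∧ inX₂ v = inX₂ w ∧ inS₂ v = inS₂ w :=
  ⟨fun _ hj => hvw _ ((mem_coordsBefore coordX₁_injective).2 hj),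
    funext fun _ => hvw _ (mem_coordsBefore_of_ne (by simp) n),
    funext fun _ => hvw _ (mem_coordsBefore_of_ne (by simp) n),
    funext fun _ => hvw _ (mem_coordsBefore_of_ne (by simp) n)⟩

theorem agree_of_coordsBefore_coordX₂ {v w : Coord → ℝ} {n : ℕ}
    (hvw : ∀ c ∈ coordsBefore coordX₂ n, v c = w c) : inX₁ v = inX₁ w ∧
      inS₁ v = inS₁ w ∧ (∀ j < n, inX₂ v j = inX₂ w j) ∧ inS₂ v = inS₂ w :=
  ⟨funext fun _ => hvw _ (mem_coordsBefore_of_ne (by simp) n),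
    funext fun _ => hvw _ (mem_coordsBefore_of_ne (by simp) n),
    fun _ hj => hvw _ ((mem_coordsBefore coordX₂_injective).2 hj),
    funext fun _ => hvw _ (mem_coordsBefore_of_ne (by simp) n)⟩

theorem agree_of_coordsBefore_coordS₁ {v w : Coord → ℝ} {n : ℕ}
    (hvw : ∀ c ∈ coordsBefore coordS₁ n, v c = w c) : inX₁ v = inX₁ w ∧
      (∀ j < n, inS₁ v j = inS₁ w j) ∧ inX₂ v = inX₂ w ∧ inS₂ v = inS₂ w :=
  ⟨funext fun _ => hvw _ (mem_coordsBefore_of_ne (by simp) n),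
    fun _ hj => hvw _ ((mem_coordsBefore coordS₁_injective).2 hj),
    funext fun _ => hvw _ (mem_coordsBefore_of_ne (by simp) n),
    funext fun _ => hvw _ (mem_coordsBefore_of_ne (by simp) n)⟩

/-- Ordinary arrivals sample the queue length. -/
theorem ae_tendsto_queueDensity_ordinary (h : IsInputLaw ν lam₁ lam₂ mu₁ mu₂) :
    ∀ᵐ v ∂(Measure.infinitePi ν), (∃ l : ℝ, Tendsto (fun n => ∑ k ∈ Finset.range (n + 1),
        queueDensity (inX₁ v) (inS₁ v) (inX₂ v) (inS₂ v) (genTime (inX₁ v) k) -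
        lam₁ * ∫ u in Set.Ioc 0 (genTime (inX₁ v) n),
          queueDensity (inX₁ v) (inS₁ v) (inX₂ v) (inS₂ v) u) atTop (𝓝 l)) ∧
      Tendsto (fun n => queueDensity (inX₁ v) (inS₁ v) (inX₂ v) (inS₂ v) (genTime (inX₁ v) n))
        atTop (𝓝 0) := by
  refine (ae_tendsto_sum_genTime ν coordX₁_injective h.lam₁_pos h.law_X₁ h.ae_pos
    (h := fun v => queueDensity (inX₁ v) (inS₁ v) (inX₂ v) (inS₂ v))
    (measurable_queueDensity_comp measurable_fst measurable_snd)
    (fun v hv u => queueDensity_mem (fun _ => hv _) u) ?_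
    (lintegral_sq_queueDensity_ne_top h)).1
  intro n v w hv hw hvw u hu hu'
  obtain ⟨h1, h2, h3, h4⟩ := agree_of_coordsBefore_coordX₁ hvw
  simp only [h2, h3, h4]
  exact queueDensity_congr_ordinary (fun _ => hv _) (fun _ => hw _) h1 hu hu'

/-- Priority arrivals sample the queue length. -/
theorem ae_tendsto_queueDensity_priority (h : IsInputLaw ν lam₁ lam₂ mu₁ mu₂) :
    (∀ᵐ v ∂(Measure.infinitePi ν), (∃ l : ℝ, Tendsto (fun n => ∑ k ∈ Finset.range (n + 1),
        queueDensity (inX₁ v) (inS₁ v) (inX₂ v) (inS₂ v) (genTime (inX₂ v) k) -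
        lam₂ * ∫ u in Set.Ioc 0 (genTime (inX₂ v) n),
          queueDensity (inX₁ v) (inS₁ v) (inX₂ v) (inS₂ v) u) atTop (𝓝 l)) ∧
      Tendsto (fun n => queueDensity (inX₁ v) (inS₁ v) (inX₂ v) (inS₂ v) (genTime (inX₂ v) n))
        atTop (𝓝 0)) ∧
    ∑' n, ∫⁻ v, ENNReal.ofReal (queueDensity (inX₁ v) (inS₁ v) (inX₂ v) (inS₂ v)
      (genTime (inX₂ v) n) ^ 2) ∂(Measure.infinitePi ν) ≠ ⊤ := by
  refine ae_tendsto_sum_genTime ν coordX₂_injective h.lam₂_pos h.law_X₂ h.ae_pos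
    (h := fun v => queueDensity (inX₁ v) (inS₁ v) (inX₂ v) (inS₂ v))
    (measurable_queueDensity_comp measurable_fst measurable_snd)
    (fun v hv u => queueDensity_mem (fun _ => hv _) u) ?_ (lintegral_sq_queueDensity_ne_top h)
  intro n v w hv hw hvw u hu hu'
  obtain ⟨h1, h2, h3, h4⟩ := agree_of_coordsBefore_coordX₂ hvw
  simp only [h1, h2, h4]
  exact queueDensity_congr_priority (fun _ => hw _) (fun _ => hv _) (fun _ => hw _) h3
    (fun _ _ => rfl) hu hu'

/-- Ordinary arrivals sample the residual occupation of the server by the priority stream. -/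
theorem ae_tendsto_residualDensity (h : IsInputLaw ν lam₁ lam₂ mu₁ mu₂) :
    ∀ᵐ v ∂(Measure.infinitePi ν), (∃ l : ℝ, Tendsto (fun n => ∑ k ∈ Finset.range (n + 1),
        residualDensity (inX₂ v) (inS₂ v) (genTime (inX₁ v) k) -
        lam₁ * ∫ u in Set.Ioc 0 (genTime (inX₁ v) n),
          residualDensity (inX₂ v) (inS₂ v) u) atTop (𝓝 l)) ∧
      Tendsto (fun n => residualDensity (inX₂ v) (inS₂ v) (genTime (inX₁ v) n)) atTop (𝓝 0) := by
  refine (ae_tendsto_sum_genTime ν coordX₁_injective h.lam₁_pos h.law_X₁ h.ae_pos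
    (h := fun v => residualDensity (inX₂ v) (inS₂ v))
    (measurable_residualDensity_comp measurable_fst measurable_snd)
    (fun v hv u => residualDensity_mem (fun _ => hv _) (fun _ => hv _) u) ?_
    (lintegral_sq_residualDensity_ne_top h)).1
  intro n v w hv hw hvw u hu hu'
  obtain ⟨-, -, h3, h4⟩ := agree_of_coordsBefore_coordX₁ hvw
  simp only [h3, h4]

theorem deliveryLevel_sub_congr {x₁ s₁ s₁' x₂ s₂ : ℕ → ℝ} {n : ℕ} (hs : ∀ j < n, s₁ j = s₁' j) :
    deliveryLevel x₁ s₁ x₂ s₂ n - s₁ n = deliveryLevel x₁ s₁' x₂ s₂ n - s₁' n := by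
  cases n with
  | zero => simp [deliveryLevel]
  | succ n =>
    simp only [deliveryLevel, add_sub_cancel_right]
    rw [deliveryLevel_congr (fun _ _ => rfl) fun j hj => hs j (Nat.lt_succ_of_le hj)]

/-- Before the clock can be at work on packet `n + 1`, but after the delivery of packet `n`, the
queue is empty. -/
theorem workDensity_eq_zero {x₁ s₁ x₂ s₂ : ℕ → ℝ} (hx₁ : ∀ n, 0 < x₁ n) (hs₁ : ∀ n, 0 < s₁ n)
    {n : ℕ} {a : ℝ} (h1 : deliveryLevel x₁ s₁ x₂ s₂ n < a)
    (h2 : a ≤ clock x₂ s₂ (genTime x₁ (n + 1))) : workDensity x₁ s₁ x₂ s₂ a = 0 := by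
  by_cases ha : ∃ m, a ∈ Set.Ioc (clock x₂ s₂ (genTime x₁ m)) (clock x₂ s₂ (genTime x₁ (m + 1)))
  · obtain ⟨m, hm⟩ := ha
    have hmn : m < n + 1 := by
      by_contra! hlt
      have := clock_genTime_mono (x₂ := x₂) (s₂ := s₂) hx₁ hlt
      simp only at this
      linarith [hm.1]
    rw [workDensity, gridDensity_eq (clock_genTime_mono hx₁) hm, undeliveredLeft,
      Finset.sum_eq_zero, zero_div]
    intro l hl
    have hln : l ≤ n := by have := Finset.mem_range.1 hl; omega
    have := (deliveryLevel_strictMono (x₁ := x₁) (x₂ := x₂) (s₂ := s₂) hs₁).monotone hln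
    rw [if_neg (by linarith)]
  · push Not at ha
    exact gridDensity_eq_zero ha

/-- When packet `n` requires the service time `u` instead, the scaled queue length at its delivery is
the original one at the reading of the clock when it has received the service `u`. -/
theorem workDensity_update [inst : DecidableEq Coord] (n : ℕ) {v : Coord → ℝ} (hv : ∀ i, 0 < v i)
    {u : ℝ} (hu : u ∈ Set.Ioc 0 (v (coordS₁ n))) :
    workDensity (inX₁ (Function.update v (coordS₁ n) u)) (inS₁ (Function.update v (coordS₁ n) u))
      (inX₂ (Function.update v (coordS₁ n) u)) (inS₂ (Function.update v (coordS₁ n) u))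
      (deliveryLevel (inX₁ (Function.update v (coordS₁ n) u))
        (inS₁ (Function.update v (coordS₁ n) u)) (inX₂ (Function.update v (coordS₁ n) u))
        (inS₂ (Function.update v (coordS₁ n) u)) n) =
      workDensity (inX₁ v) (inS₁ v) (inX₂ v) (inS₂ v)
        (deliveryLevel (inX₁ v) (inS₁ v) (inX₂ v) (inS₂ v) n - v (coordS₁ n) + u) := by
  set w := Function.update v (coordS₁ n) u with hw
  have hwu : w (coordS₁ n) = u := Function.update_self _ _ _
  have hwpos : ∀ i, 0 < w i := update_pos hv hu.1
  obtain ⟨h1, h2, h3, h4⟩ := agree_of_coordsBefore_coordS₁ (n := n) (v := w) (w := v) fun c hc =>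
    Function.update_of_ne (fun hcn => notMem_coordsBefore coordS₁ n (by rw [← hcn]; exact hc)) _ _
  have hE := deliveryLevel_sub_congr (x₁ := inX₁ v) (x₂ := inX₂ v) (s₂ := inS₂ v) h2
  have hE' : deliveryLevel (inX₁ v) (inS₁ w) (inX₂ v) (inS₂ v) n =
      deliveryLevel (inX₁ v) (inS₁ v) (inX₂ v) (inS₂ v) n - v (coordS₁ n) + u := by
    linarith
  simp only [h1, h3, h4]
  rw [hE']
  exact workDensity_congr_service (i := n) (fun _ => hwpos _) (fun _ => hv _)
    (fun _ => hv _) h2 hE'.ge (by linarith [hu.2])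

/-- Deliveries sample the queue length along the clock. -/
theorem ae_tendsto_workDensity (h : IsInputLaw ν lam₁ lam₂ mu₁ mu₂) :
    ∀ᵐ v ∂(Measure.infinitePi ν), (∃ l : ℝ, Tendsto (fun n => ∑ k ∈ Finset.range (n + 1),
        workDensity (inX₁ v) (inS₁ v) (inX₂ v) (inS₂ v)
          (deliveryLevel (inX₁ v) (inS₁ v) (inX₂ v) (inS₂ v) k) -
        mu₁ * ∫ u in Set.Ioc 0 (deliveryLevel (inX₁ v) (inS₁ v) (inX₂ v) (inS₂ v) n),
          workDensity (inX₁ v) (inS₁ v) (inX₂ v) (inS₂ v) u) atTop (𝓝 l)) ∧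
      Tendsto (fun n => workDensity (inX₁ v) (inS₁ v) (inX₂ v) (inS₂ v)
        (deliveryLevel (inX₁ v) (inS₁ v) (inX₂ v) (inS₂ v) n)) atTop (𝓝 0) := by
  classical
  refine ae_tendsto_sum_sub_integral ν (coordsBefore_mono coordS₁) (idx := coordS₁)
    (notMem_coordsBefore coordS₁)
    (fun n => (mem_coordsBefore coordS₁_injective).2 n.lt_succ_self) h.mu₁_pos h.law_S₁ h.ae_pos
    (h := fun v => workDensity (inX₁ v) (inS₁ v) (inX₂ v) (inS₂ v))
    (p := fun v => deliveryLevel (inX₁ v) (inS₁ v) (inX₂ v) (inS₂ v))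
    (fun n => measurable_workDensity_comp measurable_id (measurable_deliveryLevel
      (fun _ => measurable_pi_apply _) (fun _ => measurable_pi_apply _)
      (fun _ => measurable_pi_apply _) (fun _ => measurable_pi_apply _) n))
    (fun v => measurable_workDensity_comp measurable_const measurable_id)
    (fun v hv u => workDensity_mem (fun _ => hv _) u) ?_ ?_ ?_ ?_
    (lintegral_sq_workDensity_ne_top h)
  · intro n v hv
    obtain ⟨h1, h2, h3, h4⟩ := agree_of_coordsBefore_coordS₁ (n := n + 1)
      (v := (coordsBefore coordS₁ (n + 1)).piecewise v (fun _ => (1 : ℝ))) (w := v)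
      fun c hc => Set.piecewise_eq_of_mem _ _ _ hc
    simp only [h1, h3, h4]
    have hE := deliveryLevel_congr (x₁ := inX₁ v) (x₂ := inX₂ v) (s₂ := inS₂ v)
      (fun _ _ => rfl) fun j hj => h2 j (Nat.lt_succ_of_le hj)
    rw [hE]
    exact workDensity_congr_service (i := n) (fun _ => piecewise_one_pos hv _ _) (fun _ => hv _)
      (fun _ => hv _) (fun j hj => h2 j (hj.trans n.lt_succ_self)) hE.ge le_rfl
  · exact fun n v hv u hu =>
      workDensity_update (inst := fun a b => Classical.propDecidable (a = b)) n hv hu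
  · intro v hv
    simp only [deliveryLevel, add_sub_cancel_right]
    exact ⟨clock_nonneg _, fun u hu => gridDensity_of_le (clock_genTime_mono fun _ => hv _) hu.2⟩
  · intro n v hv
    change _ ≤ max _ _ + v (coordS₁ (n + 1)) - _ ∧ ∀ u ∈ Set.Ioc _ (max _ _ + _ - _), _
    rw [add_sub_cancel_right]
    refine ⟨le_max_left _ _, fun u hu => ?_⟩
    rcases le_max_iff.1 hu.2 with h' | h'
    · exact absurd hu.1 (not_lt.2 h')
    · exact workDensity_eq_zero (fun _ => hv _) (fun _ => hv _) hu.1 h'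

end Input

/-! ### Occupation times and balance equations -/

section Occupation

variable {ν : Coord → Measure ℝ} [∀ i, IsProbabilityMeasure (ν i)] {lam₁ lam₂ mu₁ mu₂ : ℝ}

theorem memLp_occupation (h : IsInputLaw ν lam₁ lam₂ mu₁ mu₂) (k : ℕ) :
    MemLp (fun v => occupation (inX₂ v) (inS₂ v) k) 2 (Measure.infinitePi ν) := by
  have hm : Measurable fun v : Coord → ℝ => min (v (coordS₂ k)) (v (coordX₂ (k + 1))) := by fun_prop
  have hmap := map_min_infinitePi ν (i := coordS₂ k) (j := coordX₂ (k + 1)) (by simp) h.mu₂_pos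
    h.lam₂_pos (h.law_S₂ k) (h.law_X₂ (k + 1))
  have hint := integrable_pow_expMeasure (add_pos h.mu₂_pos h.lam₂_pos) 2
  rw [← hmap] at hint
  exact (memLp_two_iff_integrable_sq hm.aestronglyMeasurable).2
    ((integrable_map_measure (continuous_pow 2).aestronglyMeasurable hm.aemeasurable).1 hint)

theorem integral_occupation (h : IsInputLaw ν lam₁ lam₂ mu₁ mu₂) (k : ℕ) :
    ∫ v, occupation (inX₂ v) (inS₂ v) k ∂(Measure.infinitePi ν) = 1 / (mu₂ + lam₂) := by
  have hm : Measurable fun v : Coord → ℝ => min (v (coordS₂ k)) (v (coordX₂ (k + 1))) := by fun_prop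
  have hmap := map_min_infinitePi ν (i := coordS₂ k) (j := coordX₂ (k + 1)) (by simp) h.mu₂_pos
    h.lam₂_pos (h.law_S₂ k) (h.law_X₂ (k + 1))
  rw [← integral_exp_id (add_pos h.mu₂_pos h.lam₂_pos), ← hmap,
    integral_map hm.aemeasurable (by fun_prop)]
  rfl

open Classical in
/-- The queue lengths found by the priority packets, multiplied by the centred times for which these
packets occupy the server, are the increments of a martingale. -/
theorem ae_tendsto_queueDensity_mul_occupation (h : IsInputLaw ν lam₁ lam₂ mu₁ mu₂) :
    ∀ᵐ v ∂(Measure.infinitePi ν), ∃ l : ℝ, Tendsto (fun n => ∑ k ∈ Finset.range n,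
        queueDensity (inX₁ v) (inS₁ v) (inX₂ v) (inS₂ v) (genTime (inX₂ v) k) *
          (occupation (inX₂ v) (inS₂ v) k - 1 / (mu₂ + lam₂))) atTop (𝓝 l) := by
  set μ := Measure.infinitePi ν with hμ
  set H : ℕ → (Coord → ℝ) → ℝ := fun k v =>
    queueDensity (inX₁ v) (inS₁ v) (inX₂ v) (inS₂ v) (genTime (inX₂ v) k) with hH
  set M : ℕ → (Coord → ℝ) → ℝ := fun k v => occupation (inX₂ v) (inS₂ v) k - 1 / (mu₂ + lam₂) with hM
  obtain ⟨S, hSmem⟩ : ∃ S : ℕ → Set Coord, ∀ k c, c ∈ S k ↔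
      c ∈ coordsBefore coordX₂ (k + 1) ∧ c ∈ coordsBefore coordS₂ k :=
    ⟨fun k => coordsBefore coordX₂ (k + 1) ∩ coordsBefore coordS₂ k, fun _ _ => Iff.rfl⟩
  obtain ⟨T, hTmem⟩ : ∃ T : ℕ → Set Coord, ∀ k c, c ∈ T k ↔ c = coordS₂ k ∨ c = coordX₂ (k + 1) :=
    ⟨fun k => {coordS₂ k, coordX₂ (k + 1)}, fun _ _ => Iff.rfl⟩
  have hpos : ∀ᵐ v ∂μ, ∀ i, 0 < v i := ae_forall_pos ν h.ae_pos
  have hS : Monotone S := fun i j hij c hc => (hSmem j c).2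
    ⟨coordsBefore_mono _ (by omega : i + 1 ≤ j + 1) ((hSmem i c).1 hc).1,
      coordsBefore_mono _ hij ((hSmem i c).1 hc).2⟩
  have hST : ∀ k, Disjoint (S k) (T k) := by
    intro k
    rw [Set.disjoint_right]
    intro c hcT hc
    rcases (hTmem k c).1 hcT with rfl | rfl
    · exact notMem_coordsBefore coordS₂ k ((hSmem k _).1 hc).2
    · exact notMem_coordsBefore coordX₂ (k + 1) ((hSmem k _).1 hc).1
  have hHm : ∀ k, Measurable (H k) := fun k => measurable_queueDensity_comp measurable_id
    (measurable_genTime (fun _ => measurable_pi_apply _) k)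
  have hMm : ∀ k, Measurable (M k) := fun k =>
    (measurable_occupation (fun _ => measurable_pi_apply _) (fun _ => measurable_pi_apply _)
      k).sub_const _
  -- the queue found by packet `k` depends on the coordinates in `S k` only
  have hHS : ∀ k v w, (∀ i, 0 < v i) → (∀ i, 0 < w i) → (∀ c ∈ S k, v c = w c) →
      H k v = H k w := by
    intro k v w hv hw hvw
    have e1 : inX₁ v = inX₁ w := funext fun _ =>
      hvw _ <| (hSmem k _).2 ⟨mem_coordsBefore_of_ne (by simp) _, mem_coordsBefore_of_ne (by simp) _⟩
    have e2 : inS₁ v = inS₁ w := funext fun _ =>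
      hvw _ <| (hSmem k _).2 ⟨mem_coordsBefore_of_ne (by simp) _, mem_coordsBefore_of_ne (by simp) _⟩
    have e3 : ∀ j ≤ k, inX₂ v j = inX₂ w j := fun j hj =>
      hvw _ <| (hSmem k _).2 ⟨(mem_coordsBefore coordX₂_injective).2 (Nat.lt_succ_of_le hj),
        mem_coordsBefore_of_ne (by simp) _⟩
    have e4 : ∀ j < k, inS₂ v j = inS₂ w j := fun j hj =>
      hvw _ <| (hSmem k _).2 ⟨mem_coordsBefore_of_ne (by simp) _, (mem_coordsBefore coordS₂_injective).2 hj⟩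
    have e5 := genTime_congr e3
    simp only [hH]
    rw [e1, e2, e5]
    exact queueDensity_congr_priority (fun _ => hw _) (fun _ => hv _) (fun _ => hw _)
      (fun j hj => e3 j hj.le) e4 e5.ge le_rfl
  have hMT : ∀ k v w, M k ((T k).piecewise w v) = M k w := by
    intro k v w
    simp only [hM, occupation, inX₂, inS₂]
    rw [Set.piecewise_eq_of_mem _ _ _ ((hTmem _ _).2 (Or.inl rfl)), Set.piecewise_eq_of_mem _ _ _ ((hTmem _ _).2 (Or.inr rfl))]
  have hHT : ∀ k v w, (∀ i, 0 < v i) → (∀ i, 0 < w i) → H k ((T k).piecewise w v) = H k v := by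
    intro k v w hv hw
    refine hHS k _ _ (fun i => ?_) hv fun c hc =>
      Set.piecewise_eq_of_notMem _ _ _ (Set.disjoint_left.1 (hST k) hc)
    by_cases hi : i ∈ T k <;> simp [hi, hv i, hw i]
  have hMint : ∀ k, ∫ w, M k w ∂μ = 0 := by
    intro k
    simp only [hM]
    rw [integral_sub ((memLp_occupation h k).integrable one_le_two) (integrable_const _),
      integral_occupation h k]
    simp
  have hM2 : ∀ k, MemLp (M k) 2 μ := fun k => (memLp_occupation h k).sub (memLp_const _)
  have hH1 : ∀ k v, (∀ i, 0 < v i) → H k v ∈ Set.Icc 0 1 := fun k v hv =>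
    queueDensity_mem (fun _ => hv _) _
  -- the second moments of the centred occupation times do not depend on `k`
  have hMsq : ∀ k, ∫⁻ w, ENNReal.ofReal (M k w ^ 2) ∂μ = ∫⁻ x, ENNReal.ofReal
      ((x - 1 / (mu₂ + lam₂)) ^ 2) ∂(expMeasure (mu₂ + lam₂)) := by
    intro k
    rw [← map_min_infinitePi ν (i := coordS₂ k) (j := coordX₂ (k + 1)) (by simp) h.mu₂_pos
      h.lam₂_pos (h.law_S₂ k) (h.law_X₂ (k + 1)), lintegral_map (by fun_prop) (by fun_prop)]
    rfl
  have hMfin : ∫⁻ x, ENNReal.ofReal ((x - 1 / (mu₂ + lam₂)) ^ 2) ∂(expMeasure (mu₂ + lam₂)) ≠ ⊤ := by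
    rw [← hMsq 0, ← ofReal_integral_eq_lintegral_ofReal (hM2 0).integrable_sq
      (ae_of_all _ fun _ => sq_nonneg _)]
    exact ENNReal.ofReal_ne_top
  have hfsq : ∀ k, ∫⁻ v, ENNReal.ofReal ((H k v * M k v) ^ 2) ∂μ =
      (∫⁻ v, ENNReal.ofReal (H k v ^ 2) ∂μ) * ∫⁻ x, ENNReal.ofReal
        ((x - 1 / (mu₂ + lam₂)) ^ 2) ∂(expMeasure (mu₂ + lam₂)) := by
    intro k
    have hm : Measurable fun v => ENNReal.ofReal ((H k v * M k v) ^ 2) :=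
      (((hHm k).mul (hMm k)).pow_const 2).ennreal_ofReal
    have hm' : Measurable fun p : (Coord → ℝ) × (Coord → ℝ) => ENNReal.ofReal
        ((H k ((T k).piecewise p.2 p.1) * M k ((T k).piecewise p.2 p.1)) ^ 2) :=
      hm.comp (measurable_piecewise_pair (T k))
    conv_lhs => rw [hμ, ← map_piecewise_infinitePi ν (T k)]
    rw [lintegral_map hm (measurable_piecewise_pair (T k)),
      lintegral_prod _ hm'.aemeasurable,
      ← lintegral_mul_const _ ((hHm k).pow_const 2).ennreal_ofReal, ← hMsq k]
    refine lintegral_congr_ae ?_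
    filter_upwards [hpos] with v hv
    rw [← lintegral_const_mul _ ((hMm k).pow_const 2).ennreal_ofReal]
    refine lintegral_congr_ae ?_
    filter_upwards [hpos] with w hw
    rw [hHT k v w hv hw, hMT, mul_pow, ENNReal.ofReal_mul (sq_nonneg _)]
  have hf2 : ∀ k, MemLp (fun v => H k v * M k v) 2 μ := by
    intro k
    refine (hM2 k).mono ((hHm k).mul (hMm k)).aestronglyMeasurable ?_
    filter_upwards [hpos] with v hv
    rw [norm_mul, Real.norm_of_nonneg (hH1 k v hv).1]
    exact mul_le_of_le_one_left (norm_nonneg _) (hH1 k v hv).2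
  refine ae_exists_tendsto_sum_of_resample ν hS hST (f := fun k v => H k v * M k v)
    (fun k => (hHm k).mul (hMm k)) ?_ ?_ hf2 ?_
  · intro k
    filter_upwards [hpos] with v hv
    have h1 := hHS k _ _ (piecewise_one_pos hv (S (k + 1))) hv fun c hc =>
      Set.piecewise_eq_of_mem _ _ _ (hS k.le_succ hc)
    have h2 : M k ((S (k + 1)).piecewise v fun _ => 1) = M k v := by
      have m1 : coordS₂ k ∈ S (k + 1) := (hSmem _ _).2 ⟨mem_coordsBefore_of_ne (by simp) _,
        (mem_coordsBefore coordS₂_injective).2 k.lt_succ_self⟩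
      have m2 : coordX₂ (k + 1) ∈ S (k + 1) := (hSmem _ _).2
        ⟨(mem_coordsBefore coordX₂_injective).2 (k + 1).lt_succ_self,
          mem_coordsBefore_of_ne (by simp) _⟩
      simp only [hM, occupation, inX₂, inS₂]
      rw [Set.piecewise_eq_of_mem _ _ _ m1, Set.piecewise_eq_of_mem _ _ _ m2]
    simp only [h1, h2]
  · intro k
    filter_upwards [hpos] with v hv
    have : ∫ w, H k ((T k).piecewise w v) * M k ((T k).piecewise w v) ∂μ =
        ∫ w, H k v * M k w ∂μ := by
      refine integral_congr_ae ?_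
      filter_upwards [hpos] with w hw
      simp only [hHT k v w hv hw, hMT]
    exact this.trans (by rw [integral_const_mul, hMint, mul_zero])
  · have hfin : ∑' k, ∫⁻ v, ENNReal.ofReal ((H k v * M k v) ^ 2) ∂μ ≠ ⊤ := by
      simp_rw [hfsq]
      rw [ENNReal.tsum_mul_right]
      exact ENNReal.mul_ne_top (ae_tendsto_queueDensity_priority h).2 hMfin
    refine (ENNReal.summable_toReal hfin).congr fun k => ?_
    exact (integral_eq_lintegral_of_nonneg_ae (f := fun v => (H k v * M k v) ^ 2)
      (ae_of_all _ fun _ => sq_nonneg _)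
      (((hHm k).mul (hMm k)).pow_const 2).aestronglyMeasurable).symm

end Occupation

section Pathwise

theorem tendsto_genTime_div {x : ℕ → ℝ} {a : ℝ}
    (h : Tendsto (fun n : ℕ => (∑ i ∈ Finset.range n, x i) / (n : ℝ)) atTop (𝓝 a)) :
    Tendsto (fun n : ℕ => genTime x n / n) atTop (𝓝 a) := by
  have h1 := (h.comp (tendsto_add_atTop_nat 1)).mul
    ((tendsto_natCast_div_add_atTop (1 : ℝ)).inv₀ one_ne_zero)
  rw [inv_one, mul_one] at h1
  refine h1.congr' ?_
  filter_upwards [eventually_gt_atTop 0] with n hn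
  have : (n : ℝ) ≠ 0 := by positivity
  have : (n : ℝ) + 1 ≠ 0 := by positivity
  simp only [Function.comp, genTime]
  push_cast
  field_simp

theorem tendsto_atTop_of_div {f : ℕ → ℝ} {a : ℝ} (ha : 0 < a)
    (h : Tendsto (fun n : ℕ => f n / n) atTop (𝓝 a)) : Tendsto f atTop atTop := by
  refine Tendsto.congr' ?_ (h.pos_mul_atTop ha (tendsto_natCast_atTop_atTop (R := ℝ)))
  filter_upwards [eventually_gt_atTop 0] with k hk
  have : (k : ℝ) ≠ 0 := by positivity
  field_simp

theorem tendsto_clock_genTime_div {x₂ s₂ : ℕ → ℝ} (hx₂ : ∀ n, 0 < x₂ n) (hs₂ : ∀ n, 0 < s₂ n)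
    {a m : ℝ} (h : Tendsto (fun n : ℕ => (∑ i ∈ Finset.range n, x₂ i) / (n : ℝ)) atTop (𝓝 a))
    (hm : Tendsto (fun n : ℕ => (∑ i ∈ Finset.range n, occupation x₂ s₂ i) / (n : ℝ)) atTop (𝓝 m)) :
    Tendsto (fun n : ℕ => clock x₂ s₂ (genTime x₂ n) / n) atTop (𝓝 (a - m)) := by
  refine ((tendsto_genTime_div h).sub hm).congr fun n => ?_
  rw [clock_genTime hx₂ hs₂, sub_div]

variable {x₁ s₁ x₂ s₂ : ℕ → ℝ}

theorem integrableOn_queueDensity (hx₁ : ∀ n, 0 < x₁ n) (T : ℝ) :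
    IntegrableOn (queueDensity x₁ s₁ x₂ s₂) (Set.Ioc 0 T) := by
  refine Measure.integrableOn_of_bounded (M := 1) (by simp) (measurable_queueDensity
    (x₁ := fun _ => x₁) (s₁ := fun _ => s₁) (x₂ := fun _ => x₂) (s₂ := fun _ => s₂)
    (fun _ => measurable_const) (fun _ => measurable_const) (fun _ => measurable_const)
    (fun _ => measurable_const) measurable_id).aestronglyMeasurable ?_
  exact ae_of_all _ fun u => by
    rw [Real.norm_of_nonneg (queueDensity_mem hx₁ u).1]; exact (queueDensity_mem hx₁ u).2

theorem integrableOn_workDensity (hx₁ : ∀ n, 0 < x₁ n) (T : ℝ) :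
    IntegrableOn (workDensity x₁ s₁ x₂ s₂) (Set.Ioc 0 T) := by
  refine Measure.integrableOn_of_bounded (M := 1) (by simp) (measurable_workDensity
    (x₁ := fun _ => x₁) (s₁ := fun _ => s₁) (x₂ := fun _ => x₂) (s₂ := fun _ => s₂)
    (fun _ => measurable_const) (fun _ => measurable_const) (fun _ => measurable_const)
    (fun _ => measurable_const) measurable_id).aestronglyMeasurable ?_
  exact ae_of_all _ fun u => by
    rw [Real.norm_of_nonneg (workDensity_mem hx₁ u).1]; exact (workDensity_mem hx₁ u).2

theorem integrableOn_residualDensity (hx₂ : ∀ n, 0 < x₂ n) (hs₂ : ∀ n, 0 < s₂ n) (T : ℝ) :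
    IntegrableOn (residualDensity x₂ s₂) (Set.Ioc 0 T) := by
  refine Measure.integrableOn_of_bounded (M := 1) (by simp) (measurable_residualDensity
    (x₂ := fun _ => x₂) (s₂ := fun _ => s₂) (fun _ => measurable_const)
    (fun _ => measurable_const) measurable_id).aestronglyMeasurable ?_
  exact ae_of_all _ fun u => by
    rw [Real.norm_of_nonneg (residualDensity_mem hx₂ hs₂ u).1]
    exact (residualDensity_mem hx₂ hs₂ u).2

/-- From the convergence of compensated sums to the balance of ordinary arrivals. -/
theorem tendsto_arrival_balance (h : Regular x₁ s₁ x₂ s₂) {r l : ℝ} (hr : 0 ≤ r)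
    (hconv : Tendsto (fun n => ∑ k ∈ Finset.range (n + 1),
      queueDensity x₁ s₁ x₂ s₂ (genTime x₁ k) -
        r * ∫ u in Set.Ioc 0 (genTime x₁ n), queueDensity x₁ s₁ x₂ s₂ u) atTop (𝓝 l))
    (hzero : Tendsto (fun n => queueDensity x₁ s₁ x₂ s₂ (genTime x₁ n)) atTop (𝓝 0)) :
    Tendsto (fun N => (∑ n ∈ Finset.range N, (queue x₁ s₁ x₂ s₂ (n + 1) - 1 -
      r * queueArea x₁ s₁ x₂ s₂ n)) / weight (queue x₁ s₁ x₂ s₂) N) atTop (𝓝 0) := by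
  have hG := genTime_strictMono h.x₁_pos
  refine (tendsto_sum_grid_div hG.monotone h.tendsto_genTime₁ hG.monotone h.tendsto_genTime₁
    (genTime_pos h.x₁_pos 0).le (weight_mono queue_nonneg) (weight_pos queue_nonneg)
    (tendsto_weight queue_nonneg) (fun u => (queueDensity_mem h.x₁_pos u).1)
    (integrableOn_queueDensity h.x₁_pos) hr hconv hzero).congr fun N => ?_
  congr 1
  refine Finset.sum_congr rfl fun n _ => ?_
  have hc : ∀ n, countUpTo (genTime x₁) (genTime x₁ n) = n + 1 := fun n =>
    eq_of_forall_lt_iff fun k => by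
      rw [lt_countUpTo_iff hG.monotone h.tendsto_genTime₁, hG.le_iff_le, Nat.lt_succ_iff]
  rw [hc, hc, Nat.Ico_succ_singleton, Finset.sum_singleton, queue_succ h.s₁_pos n,
    add_sub_cancel_right]
  rfl

/-- From the convergence of compensated sums to the balance of deliveries. -/
theorem tendsto_delivery_balance (h : Regular x₁ s₁ x₂ s₂) {r l : ℝ} (hr : 0 ≤ r)
    (hconv : Tendsto (fun n => ∑ k ∈ Finset.range (n + 1),
      workDensity x₁ s₁ x₂ s₂ (deliveryLevel x₁ s₁ x₂ s₂ k) -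
        r * ∫ u in Set.Ioc 0 (deliveryLevel x₁ s₁ x₂ s₂ n), workDensity x₁ s₁ x₂ s₂ u)
          atTop (𝓝 l))
    (hzero : Tendsto (fun n => workDensity x₁ s₁ x₂ s₂ (deliveryLevel x₁ s₁ x₂ s₂ n))
      atTop (𝓝 0)) :
    Tendsto (fun N => (∑ n ∈ Finset.range N, (deliverySum x₁ s₁ x₂ s₂ n -
      r * queueWork x₁ s₁ x₂ s₂ n)) / weight (queue x₁ s₁ x₂ s₂) N) atTop (𝓝 0) :=
  tendsto_sum_grid_div (deliveryLevel_strictMono h.s₁_pos).monotone (tendsto_deliveryLevel h)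
    (clock_genTime_mono h.x₁_pos) (h.tendsto_clock.comp h.tendsto_genTime₁)
    (clock_nonneg _) (weight_mono queue_nonneg) (weight_pos queue_nonneg)
    (tendsto_weight queue_nonneg) (fun u => (workDensity_mem h.x₁_pos u).1)
    (integrableOn_workDensity h.x₁_pos) hr hconv hzero

/-- From the convergence of compensated sums to the balance of priority arrivals. -/
theorem tendsto_priority_balance (h : Regular x₁ s₁ x₂ s₂) {r l : ℝ} (hr : 0 ≤ r)
    (hconv : Tendsto (fun n => ∑ k ∈ Finset.range (n + 1),
      queueDensity x₁ s₁ x₂ s₂ (genTime x₂ k) -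
        r * ∫ u in Set.Ioc 0 (genTime x₂ n), queueDensity x₁ s₁ x₂ s₂ u) atTop (𝓝 l))
    (hzero : Tendsto (fun n => queueDensity x₁ s₁ x₂ s₂ (genTime x₂ n)) atTop (𝓝 0)) :
    Tendsto (fun N => (∑ n ∈ Finset.range N, (prioritySum x₁ s₁ x₂ s₂ (fun _ => 1) n -
      r * queueArea x₁ s₁ x₂ s₂ n)) / weight (queue x₁ s₁ x₂ s₂) N) atTop (𝓝 0) := by
  have hG := genTime_strictMono h.x₁_pos
  refine (tendsto_sum_grid_div (genTime_strictMono h.x₂_pos).monotone h.tendsto_genTime₂ hG.monotone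
    h.tendsto_genTime₁ (genTime_pos h.x₁_pos 0).le (weight_mono queue_nonneg)
    (weight_pos queue_nonneg) (tendsto_weight queue_nonneg)
    (fun u => (queueDensity_mem h.x₁_pos u).1) (integrableOn_queueDensity h.x₁_pos) hr hconv
    hzero).congr fun N => ?_
  simp only [prioritySum, one_mul]
  rfl

/-- From the convergence of the martingale with increments `y k` times the queue length found by
priority packet `k` to a law of large numbers. -/
theorem tendsto_occupation_balance (h : Regular x₁ s₁ x₂ s₂) {y : ℕ → ℝ} {l : ℝ}
    (hconv : Tendsto (fun n => ∑ k ∈ Finset.range n,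
      queueDensity x₁ s₁ x₂ s₂ (genTime x₂ k) * y k) atTop (𝓝 l)) :
    Tendsto (fun N => (∑ n ∈ Finset.range N, prioritySum x₁ s₁ x₂ s₂ y n) /
      weight (queue x₁ s₁ x₂ s₂) N) atTop (𝓝 0) :=
  tendsto_sum_grid_mul_div (t := genTime x₁) (b := weight (queue x₁ s₁ x₂ s₂))
    (φ := fun n t => undelivered x₁ s₁ x₂ s₂ n (clock x₂ s₂ t))
    (genTime_strictMono h.x₂_pos).monotone h.tendsto_genTime₂
    (genTime_strictMono h.x₁_pos).monotone h.tendsto_genTime₁ (weight_mono queue_nonneg)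
    (weight_pos queue_nonneg) (tendsto_weight queue_nonneg) hconv

theorem setIntegral_max_sub {a m b : ℝ} (hm : 0 ≤ m) (hb : a + m ≤ b) :
    ∫ u in Set.Ioc a b, max (a + m - u) 0 = m ^ 2 / 2 := by
  have hc : Continuous fun u : ℝ => max (a + m - u) 0 := by fun_prop
  rw [← intervalIntegral.integral_of_le (by linarith), ← intervalIntegral.integral_add_adjacent_intervals
    (hc.intervalIntegrable a (a + m)) (hc.intervalIntegrable (a + m) b)]
  have h1 : ∫ u in a..(a + m), max (a + m - u) 0 = ∫ u in a..(a + m), (a + m - u) := by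
    refine intervalIntegral.integral_congr fun u hu => ?_
    rw [Set.uIcc_of_le (by linarith)] at hu
    exact max_eq_left (by linarith [hu.2])
  have h2 : ∫ u in (a + m)..b, max (a + m - u) 0 = ∫ u in (a + m)..b, (0 : ℝ) := by
    refine intervalIntegral.integral_congr fun u hu => ?_
    rw [Set.uIcc_of_le hb] at hu
    exact max_eq_right (by linarith [hu.1])
  rw [h1, h2, intervalIntegral.integral_sub (by simp) (by simp), intervalIntegral.integral_const,
    integral_id]
  simp
  ring

/-- From the convergence of compensated sums to the balance of residual occupation times. Without
simultaneous arrivals, it does not matter at which end the intervals between priority arrivals are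
closed. -/
theorem tendsto_residual_balance (h : Regular x₁ s₁ x₂ s₂)
    (hne : ∀ i k, genTime x₁ i ≠ genTime x₂ k) {r l : ℝ} (hr : 0 ≤ r)
    (hconv : Tendsto (fun n => ∑ k ∈ Finset.range (n + 1), residualDensity x₂ s₂ (genTime x₁ k) -
        r * ∫ u in Set.Ioc 0 (genTime x₁ n), residualDensity x₂ s₂ u) atTop (𝓝 l))
    (hzero : Tendsto (fun n => residualDensity x₂ s₂ (genTime x₁ n)) atTop (𝓝 0)) :
    Tendsto (fun K => (∑ i ∈ Finset.range (countUpTo (genTime x₁) (genTime x₂ K)),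
      residual x₂ s₂ (genTime x₁ i) - r * ∑ k ∈ Finset.range K, occupation x₂ s₂ k ^ 2 / 2) /
        weight (occupation x₂ s₂) K) atTop (𝓝 0) := by
  have hG := genTime_strictMono h.x₁_pos
  have hP := genTime_strictMono h.x₂_pos
  have hM0 : ∀ n, 0 ≤ occupation x₂ s₂ n := fun n => (occupation_pos h.x₂_pos h.s₂_pos n).le
  refine (tendsto_sum_grid_div hG.monotone h.tendsto_genTime₁ hP.monotone h.tendsto_genTime₂
    (genTime_pos h.x₂_pos 0).le (weight_mono hM0) (weight_pos hM0) (tendsto_weight hM0)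
    (fun u => (residualDensity_mem h.x₂_pos h.s₂_pos u).1)
    (integrableOn_residualDensity h.x₂_pos h.s₂_pos) hr hconv hzero).congr fun K => ?_
  congr 1
  have hcm := countUpTo_mono hG.monotone h.tendsto_genTime₁
  induction K with
  | zero =>
    have : ∀ i ∈ Finset.range (countUpTo (genTime x₁) (genTime x₂ 0)),
        residual x₂ s₂ (genTime x₁ i) = 0 := fun i hi => residual_of_lt h.x₂_pos
      (lt_of_le_of_ne ((lt_countUpTo_iff hG.monotone h.tendsto_genTime₁).1 (Finset.mem_range.1 hi))
        (hne i 0))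
    simp [Finset.sum_eq_zero this]
  | succ K ih =>
    rw [Finset.sum_range_succ, ih, Finset.sum_range_succ _ K,
      ← Finset.sum_range_add_sum_Ico (fun i => residual x₂ s₂ (genTime x₁ i))
        (hcm (hP.monotone K.le_succ)),
      setIntegral_max_sub (hM0 K) (genTime_add_occupation_le x₂ s₂ K)]
    have : ∑ i ∈ Finset.Ico (countUpTo (genTime x₁) (genTime x₂ K))
        (countUpTo (genTime x₁) (genTime x₂ (K + 1))), residual x₂ s₂ (genTime x₁ i) =
        ∑ i ∈ Finset.Ico (countUpTo (genTime x₁) (genTime x₂ K))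
        (countUpTo (genTime x₁) (genTime x₂ (K + 1))),
          max (genTime x₂ K + occupation x₂ s₂ K - genTime x₁ i) 0 := by
      refine Finset.sum_congr rfl fun i hi => residual_eq h.x₂_pos ⟨?_, ?_⟩
      · by_contra! h'
        exact absurd ((lt_countUpTo_iff hG.monotone h.tendsto_genTime₁).2 h'.le)
          (not_lt.2 (Finset.mem_Ico.1 hi).1)
      · exact lt_of_le_of_ne ((lt_countUpTo_iff hG.monotone h.tendsto_genTime₁).1
          (Finset.mem_Ico.1 hi).2) (hne i _)
    rw [this]
    ring

end Pathwise

/-! ### The average peak age -/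

section Typical

/-- The properties of the input sequences that determine the average peak age: averages of the
entries, and balance equations that hold up to errors small compared with the weights. -/
structure Typical (lam₁ lam₂ mu₁ mu₂ : ℝ) (x₁ s₁ x₂ s₂ : ℕ → ℝ) : Prop where
  regular : Regular x₁ s₁ x₂ s₂
  average_x₁ : Tendsto (fun n : ℕ => (∑ i ∈ Finset.range n, x₁ i) / (n : ℝ)) atTop (𝓝 (1 / lam₁))
  average_s₁ : Tendsto (fun n : ℕ => (∑ i ∈ Finset.range n, s₁ i) / (n : ℝ)) atTop (𝓝 (1 / mu₁))
  average_x₂ : Tendsto (fun n : ℕ => (∑ i ∈ Finset.range n, x₂ i) / (n : ℝ)) atTop (𝓝 (1 / lam₂))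
  average_occupation : Tendsto (fun n : ℕ => (∑ i ∈ Finset.range n, occupation x₂ s₂ i) / (n : ℝ))
    atTop (𝓝 (1 / (mu₂ + lam₂)))
  average_occupation_sq : Tendsto
    (fun n : ℕ => (∑ i ∈ Finset.range n, occupation x₂ s₂ i ^ 2) / (n : ℝ))
    atTop (𝓝 (2 / (mu₂ + lam₂) ^ 2))
  arrival_balance : Tendsto (fun N => (∑ n ∈ Finset.range N, (queue x₁ s₁ x₂ s₂ (n + 1) - 1 -
      lam₁ * queueArea x₁ s₁ x₂ s₂ n)) / weight (queue x₁ s₁ x₂ s₂) N) atTop (𝓝 0)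
  delivery_balance : Tendsto (fun N => (∑ n ∈ Finset.range N, (deliverySum x₁ s₁ x₂ s₂ n -
      mu₁ * queueWork x₁ s₁ x₂ s₂ n)) / weight (queue x₁ s₁ x₂ s₂) N) atTop (𝓝 0)
  priority_balance : Tendsto (fun N => (∑ n ∈ Finset.range N,
      (prioritySum x₁ s₁ x₂ s₂ (fun _ => 1) n - lam₂ * queueArea x₁ s₁ x₂ s₂ n)) /
        weight (queue x₁ s₁ x₂ s₂) N) atTop (𝓝 0)
  occupation_balance : Tendsto (fun N => (∑ n ∈ Finset.range N, prioritySum x₁ s₁ x₂ s₂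
      (fun k => occupation x₂ s₂ k - 1 / (mu₂ + lam₂)) n) / weight (queue x₁ s₁ x₂ s₂) N)
        atTop (𝓝 0)
  residual_balance : Tendsto (fun K =>
      (∑ i ∈ Finset.range (countUpTo (genTime x₁) (genTime x₂ K)), residual x₂ s₂ (genTime x₁ i) -
        lam₁ * ∑ k ∈ Finset.range K, occupation x₂ s₂ k ^ 2 / 2) / weight (occupation x₂ s₂) K)
        atTop (𝓝 0)

variable {ν : Coord → Measure ℝ} [∀ i, IsProbabilityMeasure (ν i)] {lam₁ lam₂ mu₁ mu₂ : ℝ}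

theorem ae_tendsto_average_occupation (h : IsInputLaw ν lam₁ lam₂ mu₁ mu₂) (d : ℕ) :
    ∀ᵐ v ∂(Measure.infinitePi ν), Tendsto
      (fun n : ℕ => (∑ i ∈ Finset.range n, occupation (inX₂ v) (inS₂ v) i ^ d) / (n : ℝ))
      atTop (𝓝 ((d.factorial : ℝ) / (mu₂ + lam₂) ^ d)) :=
  ae_tendsto_average_min ν coordS₂_injective (e' := fun n => coordX₂ (n + 1))
    (fun _ _ he => by simpa using he) (fun _ _ => by simp) h.mu₂_pos h.lam₂_pos h.law_S₂
    (fun n => h.law_X₂ (n + 1)) d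

/-- The clock tends to infinity because the mean occupation time `1 / (mu₂ + lam₂)` is smaller than the
mean priority interarrival time. -/
theorem ae_regular (h : IsInputLaw ν lam₁ lam₂ mu₁ mu₂) :
    ∀ᵐ v ∂(Measure.infinitePi ν), Regular (inX₁ v) (inS₁ v) (inX₂ v) (inS₂ v) := by
  have hrate : 0 < 1 / lam₂ - 1 / (mu₂ + lam₂) := by
    have := one_div_lt_one_div_of_lt h.lam₂_pos (by linarith [h.mu₂_pos] : lam₂ < mu₂ + lam₂)
    linarith
  filter_upwards [ae_forall_pos ν h.ae_pos,
    ae_tendsto_average ν coordX₁_injective h.lam₁_pos h.law_X₁,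
    ae_tendsto_average ν coordX₂_injective h.lam₂_pos h.law_X₂,
    ae_tendsto_average_occupation h 1] with v hv hX₁ hX₂ hM
  have hM' : Tendsto (fun n : ℕ => (∑ i ∈ Finset.range n, occupation (inX₂ v) (inS₂ v) i) / (n : ℝ))
    atTop (𝓝 (1 / (mu₂ + lam₂))) := by simpa using hM
  have hC := tendsto_atTop_of_div hrate
    (tendsto_clock_genTime_div (x₂ := inX₂ v) (s₂ := inS₂ v) (fun _ => hv _) (fun _ => hv _) hX₂ hM')
  refine ⟨fun _ => hv _, fun _ => hv _, fun _ => hv _, fun _ => hv _,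
    tendsto_atTop_of_div (one_div_pos.2 h.lam₁_pos) (tendsto_genTime_div hX₁),
    tendsto_atTop_of_div (one_div_pos.2 h.lam₂_pos) (tendsto_genTime_div hX₂),
    tendsto_atTop_atTop_of_monotone clock_mono fun b => ?_⟩
  obtain ⟨n, hn⟩ := (hC.eventually_ge_atTop b).exists
  exact ⟨_, hn⟩

/-- Almost surely there are no simultaneous arrivals of the two streams. -/
theorem ae_genTime_ne_genTime (h : IsInputLaw ν lam₁ lam₂ mu₁ mu₂) :
    ∀ᵐ v ∂(Measure.infinitePi ν), ∀ i k, genTime (inX₁ v) i ≠ genTime (inX₂ v) k := by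
  refine ae_all_iff.2 fun i => ae_all_iff.2 fun k => ?_
  refine ae_genTime_ne ν coordX₁_injective h.law_X₁ i (g := fun v => genTime (inX₂ v) k)
    (measurable_genTime (fun _ => measurable_pi_apply _) k) fun v w hvw => ?_
  exact genTime_congr fun m _ => hvw _ (by simp)

theorem ae_typical (h : IsInputLaw ν lam₁ lam₂ mu₁ mu₂) :
    ∀ᵐ v ∂(Measure.infinitePi ν),
      Typical lam₁ lam₂ mu₁ mu₂ (inX₁ v) (inS₁ v) (inX₂ v) (inS₂ v) := by
  have hreg := ae_regular h
  have hM : ∀ᵐ v ∂(Measure.infinitePi ν), Tendsto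
      (fun n : ℕ => (∑ i ∈ Finset.range n, occupation (inX₂ v) (inS₂ v) i) / (n : ℝ)) atTop
      (𝓝 (1 / (mu₂ + lam₂))) := by
    filter_upwards [ae_tendsto_average_occupation h 1] with v hv
    simpa using hv
  have hM2 : ∀ᵐ v ∂(Measure.infinitePi ν), Tendsto
      (fun n : ℕ => (∑ i ∈ Finset.range n, occupation (inX₂ v) (inS₂ v) i ^ 2) / (n : ℝ)) atTop
      (𝓝 (2 / (mu₂ + lam₂) ^ 2)) := by
    filter_upwards [ae_tendsto_average_occupation h 2] with v hv
    simpa [Nat.factorial] using hv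
  have h1 := hreg.mp ((ae_tendsto_queueDensity_ordinary h).mono fun v hv hr =>
    tendsto_arrival_balance hr h.lam₁_pos.le hv.1.choose_spec hv.2)
  have h2 := hreg.mp ((ae_tendsto_workDensity h).mono fun v hv hr =>
    tendsto_delivery_balance hr h.mu₁_pos.le hv.1.choose_spec hv.2)
  have h3 := hreg.mp ((ae_tendsto_queueDensity_priority h).1.mono fun v hv hr =>
    tendsto_priority_balance hr h.lam₂_pos.le hv.1.choose_spec hv.2)
  have h4 : ∀ᵐ v ∂(Measure.infinitePi ν), Tendsto (fun N => (∑ n ∈ Finset.range N,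
      prioritySum (inX₁ v) (inS₁ v) (inX₂ v) (inS₂ v)
        (fun k => occupation (inX₂ v) (inS₂ v) k - 1 / (mu₂ + lam₂)) n) /
        weight (queue (inX₁ v) (inS₁ v) (inX₂ v) (inS₂ v)) N) atTop (𝓝 0) := by
    filter_upwards [hreg, ae_tendsto_queueDensity_mul_occupation h] with v hr ⟨l, hl⟩
    exact tendsto_occupation_balance hr hl
  have h5 := hreg.mp ((ae_genTime_ne_genTime h).mp ((ae_tendsto_residualDensity h).mono
    fun v hv hne hr => tendsto_residual_balance hr hne h.lam₁_pos.le hv.1.choose_spec hv.2))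
  filter_upwards [hreg, ae_tendsto_average ν coordX₁_injective h.lam₁_pos h.law_X₁,
    ae_tendsto_average ν coordS₁_injective h.mu₁_pos h.law_S₁,
    ae_tendsto_average ν coordX₂_injective h.lam₂_pos h.law_X₂, hM, hM2, h1, h2, h3, h4, h5] with
    v hr hX₁ hS₁ hX₂ hM hM2 h1 h2 h3 h4 h5
  exact ⟨hr, hX₁, hS₁, hX₂, hM, hM2, h1, h2, h3, h4, h5⟩

end Typical

section Limits

variable {lam₁ lam₂ mu₁ mu₂ : ℝ} {x₁ s₁ x₂ s₂ : ℕ → ℝ}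

theorem residual_nonneg (t : ℝ) : 0 ≤ residual x₂ s₂ t :=
  tsum_nonneg fun _ => Set.indicator_nonneg (fun _ _ => le_max_right _ _) _

/-- The rate of a function of time along the ordinary arrivals, from that along the priority
arrivals. -/
theorem Typical.tendsto_comp_genTime_div (h : Typical lam₁ lam₂ mu₁ mu₂ x₁ s₁ x₂ s₂)
    (hlam₂ : 0 < lam₂) {F : ℝ → ℝ} (hF : Monotone F) (hF0 : ∀ t, 0 ≤ F t) {c : ℝ}
    (hc : Tendsto (fun k : ℕ => F (genTime x₂ k) / k) atTop (𝓝 c)) :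
    Tendsto (fun n : ℕ => F (genTime x₁ n) / n) atTop (𝓝 (c * lam₂ / lam₁)) := by
  have h1 := tendsto_div_of_tendsto_comp_div hF hF0 (genTime_strictMono h.regular.x₂_pos).monotone
    (one_div_pos.2 hlam₂) (tendsto_genTime_div h.average_x₂) hc
  have h2 := (h1.comp h.regular.tendsto_genTime₁).mul (tendsto_genTime_div h.average_x₁)
  have e : c / (1 / lam₂) * (1 / lam₁) = c * lam₂ / lam₁ := by field_simp
  rw [e] at h2
  refine h2.congr fun n => ?_
  have := (genTime_pos h.regular.x₁_pos n).ne'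
  simp only [Function.comp]
  rw [div_mul_div_cancel₀ this]

/-- The average residual time of the priority packet found in service by an ordinary packet. -/
theorem Typical.tendsto_sum_residual_div (h : Typical lam₁ lam₂ mu₁ mu₂ x₁ s₁ x₂ s₂)
    (hlam₁ : 0 < lam₁) (hlam₂ : 0 < lam₂) :
    Tendsto (fun n : ℕ => (∑ i ∈ Finset.range n, residual x₂ s₂ (genTime x₁ i)) / (n : ℝ)) atTop
      (𝓝 (lam₂ / (mu₂ + lam₂) ^ 2)) := by
  have hG := genTime_strictMono h.regular.x₁_pos
  set F : ℝ → ℝ := fun t =>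
    ∑ i ∈ Finset.range (countUpTo (genTime x₁) t), residual x₂ s₂ (genTime x₁ i) with hFdef
  have hF : Monotone F := fun s t hst => Finset.sum_le_sum_of_subset_of_nonneg
    (Finset.range_subset_range.2 (countUpTo_mono hG.monotone h.regular.tendsto_genTime₁ hst))
    fun _ _ _ => residual_nonneg _
  have hw : Tendsto (fun K : ℕ => weight (occupation x₂ s₂) K / K) atTop
      (𝓝 (1 + 1 / (mu₂ + lam₂))) := by
    have h1 := (tendsto_genTime_div h.average_occupation).add
      ((tendsto_const_div_atTop_nhds_zero_nat (2 : ℝ)).const_add 1)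
    rw [add_zero, add_comm] at h1
    refine h1.congr' ?_
    filter_upwards [eventually_gt_atTop 0] with K hK
    have : (K : ℝ) ≠ 0 := by positivity
    rw [weight_eq, genTime]
    field_simp
    ring
  have hFP : Tendsto (fun K : ℕ => F (genTime x₂ K) / K) atTop (𝓝 (lam₁ / (mu₂ + lam₂) ^ 2)) := by
    have h1 := (h.residual_balance.mul hw).add
      (((h.average_occupation_sq).const_mul lam₁).div_const 2)
    have e : 0 * (1 + 1 / (mu₂ + lam₂)) + lam₁ * (2 / (mu₂ + lam₂) ^ 2) / 2 =
        lam₁ / (mu₂ + lam₂) ^ 2 := by ring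
    rw [e] at h1
    refine h1.congr fun K => ?_
    have := (weight_pos (fun n => (occupation_pos h.regular.x₂_pos h.regular.s₂_pos n).le) K).ne'
    rw [div_mul_div_cancel₀ this, ← Finset.sum_div]
    ring
  have h1 := h.tendsto_comp_genTime_div hlam₂ hF
    (fun t => Finset.sum_nonneg fun _ _ => residual_nonneg _) hFP
  have e : lam₁ / (mu₂ + lam₂) ^ 2 * lam₂ / lam₁ = lam₂ / (mu₂ + lam₂) ^ 2 := by field_simp
  rw [e] at h1
  have h2 := h1.mul (tendsto_natCast_div_add_atTop (1 : ℝ))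
  rw [mul_one] at h2
  refine (tendsto_add_atTop_iff_nat 1).1 (h2.congr' ?_)
  filter_upwards [eventually_gt_atTop 0] with n hn
  have : (n : ℝ) ≠ 0 := by positivity
  have hc : countUpTo (genTime x₁) (genTime x₁ n) = n + 1 := eq_of_forall_lt_iff fun k => by
    rw [lt_countUpTo_iff hG.monotone h.regular.tendsto_genTime₁, hG.le_iff_le, Nat.lt_succ_iff]
  rw [hFdef]
  simp only [hc]
  push_cast
  rw [div_mul_div_cancel₀ this]

theorem not_findsEmpty_succ (hs₁ : ∀ n, 0 < s₁ n) {n : ℕ} (h : ¬ FindsEmpty x₁ s₁ x₂ s₂ (n + 1)) :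
    clock x₂ s₂ (genTime x₁ (n + 1)) < deliveryLevel x₁ s₁ x₂ s₂ n := by
  unfold FindsEmpty at h
  push Not at h
  obtain ⟨i, hi, hlt⟩ := h
  exact hlt.trans_le ((deliveryLevel_strictMono hs₁).monotone (Nat.lt_succ_iff.1 hi))

theorem deliveryLevel_of_findsEmpty {n : ℕ} (h : FindsEmpty x₁ s₁ x₂ s₂ n) :
    deliveryLevel x₁ s₁ x₂ s₂ n = clock x₂ s₂ (genTime x₁ n) + s₁ n := by
  cases n with
  | zero => rfl
  | succ n => rw [deliveryLevel, max_eq_right (h n n.lt_succ_self)]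

/-- During a busy period the clock cannot advance by more than the work brought. -/
theorem clock_sub_sum_le_lastIndex (hs₁ : ∀ n, 0 < s₁ n) (N : ℕ) :
    clock x₂ s₂ (genTime x₁ N) - ∑ i ∈ Finset.range N, s₁ i ≤
      clock x₂ s₂ (genTime x₁ (lastIndex {n | FindsEmpty x₁ s₁ x₂ s₂ n} N)) -
        ∑ i ∈ Finset.range (lastIndex {n | FindsEmpty x₁ s₁ x₂ s₂ n} N), s₁ i := by
  obtain ⟨hle, hmem, hmax⟩ := lastIndex_spec (A := {n | FindsEmpty x₁ s₁ x₂ s₂ n})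
    (fun i hi => absurd hi (Nat.not_lt_zero i)) N
  generalize lastIndex {n | FindsEmpty x₁ s₁ x₂ s₂ n} N = m at hle hmem hmax ⊢
  have hnot : ∀ j, m < j → j ≤ N → ¬ FindsEmpty x₁ s₁ x₂ s₂ j := fun j hmj hjN hj =>
    absurd (hmax j hj hjN) (not_le.2 hmj)
  have key : ∀ d, m + d < N → deliveryLevel x₁ s₁ x₂ s₂ (m + d) =
      clock x₂ s₂ (genTime x₁ m) + (∑ i ∈ Finset.range (m + d + 1), s₁ i -
        ∑ i ∈ Finset.range m, s₁ i) := by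
    intro d
    induction d with
    | zero =>
      intro _
      rw [add_zero, deliveryLevel_of_findsEmpty hmem, Finset.sum_range_succ]
      ring
    | succ d ih =>
      intro hd
      have h1 := not_findsEmpty_succ hs₁ (hnot (m + d + 1) (by omega) (by omega))
      rw [← add_assoc, deliveryLevel, max_eq_left h1.le, ih (by omega),
        Finset.sum_range_succ _ (m + d + 1)]
      ring
  rcases hle.eq_or_lt with h | h
  · rw [h]
  · obtain ⟨d, rfl⟩ : ∃ d, N = m + d + 1 := ⟨N - m - 1, by omega⟩
    have h1 := not_findsEmpty_succ hs₁ (hnot (m + d + 1) (by omega) le_rfl)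
    rw [key d (by omega)] at h1
    linarith

theorem queue_of_findsEmpty (hs₁ : ∀ n, 0 < s₁ n) {N : ℕ} (h : FindsEmpty x₁ s₁ x₂ s₂ N) :
    queue x₁ s₁ x₂ s₂ N = 1 := by
  rw [queue, undelivered, Finset.sum_range_succ, if_pos (clock_genTime_lt_deliveryLevel hs₁ N),
    Finset.sum_eq_zero fun i hi => if_neg (not_lt.2 (h i (Finset.mem_range.1 hi))), zero_add]

/-- The average sojourn time along the packets that find the queue empty. -/
theorem Typical.tendsto_sum_sojourn_div_inf (h : Typical lam₁ lam₂ mu₁ mu₂ x₁ s₁ x₂ s₂)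
    (hlam₁ : 0 < lam₁) (hlam₂ : 0 < lam₂) (hmu₁ : 0 < mu₁)
    (hκ : 0 < 1 - lam₂ / (mu₂ + lam₂) - lam₁ / mu₁) :
    Tendsto (fun N : ℕ => (∑ i ∈ Finset.range N, sojourn x₁ s₁ x₂ s₂ i) / (N : ℝ))
      (atTop ⊓ 𝓟 {n | FindsEmpty x₁ s₁ x₂ s₂ n})
      (𝓝 ((1 / mu₁ + lam₂ / (mu₂ + lam₂) ^ 2) / (1 - lam₂ / (mu₂ + lam₂) - lam₁ / mu₁))) := by
  have hreg := h.regular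
  have hle : atTop ⊓ 𝓟 {n | FindsEmpty x₁ s₁ x₂ s₂ n} ≤ atTop := inf_le_left
  have hev : ∀ᶠ N in atTop ⊓ 𝓟 {n | FindsEmpty x₁ s₁ x₂ s₂ n},
      0 < N ∧ FindsEmpty x₁ s₁ x₂ s₂ N :=
    ((eventually_gt_atTop 0).filter_mono hle).and (mem_inf_of_right (mem_principal_self _))
  set Q : ℕ → ℝ := queue x₁ s₁ x₂ s₂
  have hu : Tendsto (fun N : ℕ => 1 + 3 / (N : ℝ)) atTop (𝓝 1) := by
    simpa using (tendsto_const_div_atTop_nhds_zero_nat (3 : ℝ)).const_add 1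
  have hw : ∀ N, 0 < N → FindsEmpty x₁ s₁ x₂ s₂ N →
      1 + 3 / (N : ℝ) + (∑ n ∈ Finset.range N, Q n) / N = weight Q N / N := by
    intro N hN hE
    have : (N : ℝ) ≠ 0 := by positivity
    rw [weight_eq, Finset.sum_range_succ, show Q N = 1 from queue_of_findsEmpty hreg.s₁_pos hE]
    field_simp
    ring
  have hw0 : ∀ N, weight Q N ≠ 0 := fun N => (weight_pos queue_nonneg N).ne'
  have hed := h.occupation_balance.add (h.priority_balance.const_mul (1 / (mu₂ + lam₂)))
  rw [mul_zero, add_zero] at hed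
  refine tendsto_of_balance_equations (q := fun N => (∑ n ∈ Finset.range N, Q n) / N)
    (w := fun N => (∑ n ∈ Finset.range N, queueWork x₁ s₁ x₂ s₂ n) / N)
    (d := fun N => (∑ n ∈ Finset.range N, prioritySum x₁ s₁ x₂ s₂ (occupation x₂ s₂) n) / N)
    hmu₁ hκ (h.arrival_balance.mono_left hle) (h.delivery_balance.mono_left hle)
    (hed.mono_left hle) (hu.mono_left hle)
    ((h.tendsto_sum_residual_div hlam₁ hlam₂).mono_left hle) ?_ ?_ ?_ ?_
  · filter_upwards [hev] with N ⟨hN, hE⟩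
    have hN' : (N : ℝ) ≠ 0 := by positivity
    -- both ends of the telescoping sum of queue lengths are `1`
    have hshift : ∑ n ∈ Finset.range N, Q (n + 1) = ∑ n ∈ Finset.range N, Q n := by
      have h1 := Finset.sum_range_succ Q N
      rw [Finset.sum_range_succ', show Q 0 = 1 from queue_zero hreg.s₁_pos,
        show Q N = 1 from queue_of_findsEmpty hreg.s₁_pos hE] at h1
      linarith
    rw [hw N hN hE, div_mul_div_cancel₀ (hw0 N), Finset.sum_sub_distrib, Finset.sum_sub_distrib,
      hshift, ← Finset.mul_sum, sum_queueArea hreg hE]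
    simp only [Finset.sum_const, Finset.card_range, nsmul_eq_mul, mul_one]
    field_simp
  · filter_upwards [hev] with N ⟨hN, hE⟩
    rw [hw N hN hE, div_mul_div_cancel₀ (hw0 N), Finset.sum_sub_distrib, ← Finset.mul_sum,
      sum_deliverySum hreg hE]
    ring
  · filter_upwards [hev] with N ⟨hN, hE⟩
    have hsplit : ∀ n, prioritySum x₁ s₁ x₂ s₂ (occupation x₂ s₂) n =
        prioritySum x₁ s₁ x₂ s₂ (fun k => occupation x₂ s₂ k - 1 / (mu₂ + lam₂)) n +
          1 / (mu₂ + lam₂) * prioritySum x₁ s₁ x₂ s₂ (fun _ => 1) n := by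
      intro n
      simp only [prioritySum, Finset.mul_sum, ← Finset.sum_add_distrib]
      exact Finset.sum_congr rfl fun k _ => by ring
    rw [hw N hN hE, add_mul, mul_assoc, div_mul_div_cancel₀ (hw0 N),
      div_mul_div_cancel₀ (hw0 N), Finset.sum_sub_distrib,
      ← Finset.mul_sum _ _ lam₂, sum_queueArea hreg hE]
    simp only [hsplit, Finset.sum_add_distrib, ← Finset.mul_sum]
    ring
  · filter_upwards [hev] with N ⟨hN, hE⟩
    rw [sum_sojourn_eq hreg hE, add_div, add_div]

/-- The average sojourn time. -/
theorem Typical.tendsto_sum_sojourn_div (h : Typical lam₁ lam₂ mu₁ mu₂ x₁ s₁ x₂ s₂)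
    (hlam₁ : 0 < lam₁) (hlam₂ : 0 < lam₂) (hmu₁ : 0 < mu₁) (hmu₂ : 0 < mu₂)
    (hκ : 0 < 1 - lam₂ / (mu₂ + lam₂) - lam₁ / mu₁) :
    Tendsto (fun N : ℕ => (∑ i ∈ Finset.range N, sojourn x₁ s₁ x₂ s₂ i) / (N : ℝ)) atTop
      (𝓝 ((1 / mu₁ + lam₂ / (mu₂ + lam₂) ^ 2) / (1 - lam₂ / (mu₂ + lam₂) - lam₁ / mu₁))) := by
  have hreg := h.regular
  have h0 : 0 ∈ {n | FindsEmpty x₁ s₁ x₂ s₂ n} := fun i hi => absurd hi (Nat.not_lt_zero i)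
  -- the work brought by the ordinary stream has a smaller rate than the clock
  have hY : Tendsto (fun n : ℕ => (clock x₂ s₂ (genTime x₁ n) - ∑ i ∈ Finset.range n, s₁ i) / n)
      atTop (𝓝 ((1 - lam₂ / (mu₂ + lam₂) - lam₁ / mu₁) / lam₁)) := by
    have h1 := (h.tendsto_comp_genTime_div hlam₂ clock_mono clock_nonneg
      (tendsto_clock_genTime_div hreg.x₂_pos hreg.s₂_pos h.average_x₂ h.average_occupation)).sub
      h.average_s₁
    have e : (1 / lam₂ - 1 / (mu₂ + lam₂)) * lam₂ / lam₁ - 1 / mu₁ =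
        (1 - lam₂ / (mu₂ + lam₂) - lam₁ / mu₁) / lam₁ := by
      have : mu₂ + lam₂ ≠ 0 := by positivity
      field_simp
    rw [e] at h1
    exact h1.congr fun n => by rw [sub_div]
  obtain ⟨hlast, hdiv⟩ := tendsto_lastIndex_div h0 (div_pos hκ hlam₁) hY
    (clock_sub_sum_le_lastIndex hreg.s₁_pos)
  refine tendsto_div_of_lastIndex h0 hlast hdiv (fun a b hab => ?_)
    (h.tendsto_sum_sojourn_div_inf hlam₁ hlam₂ hmu₁ hκ)
  exact Finset.sum_le_sum_of_subset_of_nonneg (Finset.range_subset_range.2 hab)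
    fun i _ _ => sojourn_nonneg hreg i

theorem sum_peakAge (h : Regular x₁ s₁ x₂ s₂) {Δ₀ : ℝ} (hΔ₀ : 0 ≤ Δ₀) (N : ℕ) :
    ∑ j ∈ Finset.range (N + 1), peakAge Δ₀ x₁ s₁ x₂ s₂ j =
      ∑ j ∈ Finset.range (N + 1), sojourn x₁ s₁ x₂ s₂ j + ∑ j ∈ Finset.range (N + 1), x₁ j + Δ₀ := by
  simp only [Finset.sum_range_succ', peakAge_zero h, peakAge_succ h hΔ₀, Finset.sum_add_distrib]
  ring

/-- The average peak age is the sum of the mean interarrival time and the average sojourn time. -/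
theorem Typical.tendsto_average_peakAge (h : Typical lam₁ lam₂ mu₁ mu₂ x₁ s₁ x₂ s₂)
    (hlam₁ : 0 < lam₁) (hlam₂ : 0 < lam₂) (hmu₁ : 0 < mu₁) (hmu₂ : 0 < mu₂)
    (hstable : lam₁ * (1 + lam₂ / mu₂) < mu₁) {Δ₀ : ℝ} (hΔ₀ : 0 ≤ Δ₀) :
    Tendsto (fun N : ℕ => (1 / (N : ℝ)) * ∑ j ∈ Finset.range N, peakAge Δ₀ x₁ s₁ x₂ s₂ j) atTop
      (𝓝 (1 / lam₁ + (2 * lam₂ * mu₂ + lam₂ * mu₁ + lam₂ ^ 2 + mu₂ ^ 2) /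
        ((mu₂ + lam₂) * (mu₁ * mu₂ - lam₁ * (mu₂ + lam₂))))) := by
  have hs : 0 < mu₂ + lam₂ := by positivity
  have hstable' : 0 < mu₁ * mu₂ - lam₁ * (mu₂ + lam₂) := by
    have h1 := mul_lt_mul_of_pos_right hstable hmu₂
    have h2 : lam₁ * (1 + lam₂ / mu₂) * mu₂ = lam₁ * (mu₂ + lam₂) := by field_simp
    linarith
  have hκe : 1 - lam₂ / (mu₂ + lam₂) - lam₁ / mu₁ =
      (mu₁ * mu₂ - lam₁ * (mu₂ + lam₂)) / (mu₁ * (mu₂ + lam₂)) := by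
    field_simp
    ring
  have hκ : 0 < 1 - lam₂ / (mu₂ + lam₂) - lam₁ / mu₁ := by
    rw [hκe]; positivity
  have hT := h.tendsto_sum_sojourn_div hlam₁ hlam₂ hmu₁ hmu₂ hκ
  have hsum := (hT.add h.average_x₁).add (tendsto_const_div_atTop_nhds_zero_nat Δ₀)
  have hval : (1 / mu₁ + lam₂ / (mu₂ + lam₂) ^ 2) / (1 - lam₂ / (mu₂ + lam₂) - lam₁ / mu₁) +
      1 / lam₁ + 0 = 1 / lam₁ + (2 * lam₂ * mu₂ + lam₂ * mu₁ + lam₂ ^ 2 + mu₂ ^ 2) /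
        ((mu₂ + lam₂) * (mu₁ * mu₂ - lam₁ * (mu₂ + lam₂))) := by
    rw [hκe, add_zero, add_comm]
    congr 1
    field_simp
    ring
  rw [hval] at hsum
  refine hsum.congr' ?_
  filter_upwards [eventually_gt_atTop 0] with N hN
  obtain ⟨M, rfl⟩ : ∃ M, N = M + 1 := ⟨N - 1, by omega⟩
  rw [sum_peakAge h.regular hΔ₀]
  ring

end Limits

end StatusQueue

theorem theorem2 {Ω : Type*} [MeasurableSpace Ω] (P : Measure Ω) [IsProbabilityMeasure P]
    (lam₁ lam₂ mu₁ mu₂ : ℝ)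
    (hlam₁ : 0 < lam₁) (hlam₂ : 0 < lam₂) (hmu₁ : 0 < mu₁) (hmu₂ : 0 < mu₂)
    (hstable : lam₁ * (1 + lam₂ / mu₂) < mu₁)
    (X₁ S₁ X₂ S₂ : ℕ → Ω → ℝ)
    (hinput : StatusQueue.IsInput P lam₁ lam₂ mu₁ mu₂ X₁ S₁ X₂ S₂)
    (Δ₀ : ℝ) (hΔ₀ : 0 ≤ Δ₀) :
    ∀ᵐ ω ∂P, Tendsto
      (fun N : ℕ => (1 / (N : ℝ)) * ∑ j ∈ Finset.range N,
        StatusQueue.peakAge Δ₀ (fun n => X₁ n ω) (fun n => S₁ n ω)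
          (fun n => X₂ n ω) (fun n => S₂ n ω) j)
      atTop
      (𝓝 (1 / lam₁ + (2 * lam₂ * mu₂ + lam₂ * mu₁ + lam₂ ^ 2 + mu₂ ^ 2) /
        ((mu₂ + lam₂) * (mu₁ * mu₂ - lam₁ * (mu₂ + lam₂))))) := by
  let ν : StatusQueue.Coord → Measure ℝ :=
    Sum.elim (Sum.elim (fun _ => expMeasure lam₁) fun _ => expMeasure mu₁)
      (Sum.elim (fun _ => expMeasure lam₂) fun _ => expMeasure mu₂)
  have hν : ∀ i, IsProbabilityMeasure (ν i) := by
    rintro ((n | n) | (n | n))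
    · exact isProbabilityMeasure_expMeasure hlam₁
    · exact isProbabilityMeasure_expMeasure hmu₁
    · exact isProbabilityMeasure_expMeasure hlam₂
    · exact isProbabilityMeasure_expMeasure hmu₂
  have hlaw : StatusQueue.IsInputLaw ν lam₁ lam₂ mu₁ mu₂ :=
    ⟨hlam₁, hlam₂, hmu₁, hmu₂, fun _ => rfl, fun _ => rfl, fun _ => rfl, fun _ => rfl⟩
  have hX : ∀ i, HasLaw (Sum.elim (Sum.elim X₁ S₁) (Sum.elim X₂ S₂) i) (ν i) P := by
    rintro ((n | n) | (n | n))
    · exact hinput.law_X₁ n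
    · exact hinput.law_S₁ n
    · exact hinput.law_X₂ n
    · exact hinput.law_S₂ n
  have hjoint := hinput.indep.hasLaw_infinitePi hX
    (aemeasurable_pi_lambda _ fun i => (hX i).aemeasurable)
  have hae := StatusQueue.ae_typical hlaw
  rw [← hjoint.map_eq] at hae
  filter_upwards [ae_of_ae_map hjoint.aemeasurable hae] with ω hω
  exact hω.tendsto_average_peakAge hlam₁ hlam₂ hmu₁ hmu₂ hstable hΔ₀
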